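/- **Setting.** Let $A$ be a finite totally ordered alphabet, $A^*$ the set of strings with empty string $\epsilon$, $<$ the shortlex order on $A^*$, and $\iota:A\to A$ an involution (formal inversion, extended to strings by $\iota(x_1\cdots x_n)=\iota(x_n)\cdots\iota(x_1)$). Let $R\subset A^*\times A^*$ be finite and contain $(x\iota(x),\epsilon)$ for every $x\in A$, so that $\langle A/R\rangle$ presents a group. The Thue congruence is the reflexive, symmetric, transitive closure of $s_1\lambda s_2\to s_1\rho s_2$, $(\lambda,\rho)\in R$, $s_1,s_2\in A^*$. *Automata.* A pair of strings is read as one string of pairs by padding the shorter string at its end with a symbol $\$$. Automata below are two-variable finite automata over padded pairs, with one initial state which is also the only final state; every state is labelled by a string, different states having different labels, and the initial state has label $\epsilon$. *Welding* means: identify the targets of arrows with equal letter and equal source, the sources of arrows with equal letter and equal target, and source and target of any arrow $(x,x)$ which begins or ends at the initial state, until nothing changes (an amalgamated state keeps its shortlex-least label); then drop the loops $(x,x)$ at the initial state. $\mathrm{SL2}$ accepts $(u,v)$ iff $u,v$ have no common first letter, $u>v$ and $|u|\le|v|+2$. $\mathrm{Set}(M)$ is the set of pairs accepted by both $M$ and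 $\mathrm{SL2}$. *Data.* A finite set of rules $S$, the disjoint union of $\mathrm{Considered}$, $\mathrm{This}$, $\mathrm{New}$, $\mathrm{Delete}$; an automaton $\mathrm{Rules}$, constant during a pass; an automaton $\mathrm{WDiff}$, some arrows of which are marked needed. Initially each relation $(p,q)\in R$ is replaced by a cyclic reduction of $p\,\iota(q)$ (with respect to $\iota$), which is dropped if empty and otherwise written as $l\,\iota(r)$ with $(l,r)$ accepted by $\mathrm{SL2}$. These rules $(l,r)$ and all $(x\iota(x),\epsilon)$ are put in $\mathrm{This}$; the other parts of $S$ are empty; $\mathrm{WDiff}=\mathrm{Rules}$ is obtained by welding the one-path automata of these rules (common initial and final state; a state is labelled by the word-difference $\iota(u')v'$ of the prefixes $u',v'$ read so far), all arrows being needed. *$R$-reduction* of $w$: as long as $w$ contains a left-hand side of a rule in $\mathrm{Set}(\mathrm{Rules})$, write $w=p\lambda q$, where $p\lambda$ is the shortest prefix of $w$ containing such a left-hand side and $\lambda$ is the shortest suffix of $p\lambda$ which is such a left-hand side; let $\rho$ be least with $(\lambda,\rho)\in S$ or, if there is none, least with $(\lambda,\rho)\in\mathrm{Set}(\mathrm{Rules})$;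 insert $(\lambda,\rho)$ in $\mathrm{New}$ if it is not in $S$; replace $w$ by $p\rho q$. *Minimization* of $(\lambda,\rho)$, with $u=u_1\cdots u_p$, $v=v_1\cdots v_q$ denoting the current sides: (1) $R$-reduce $u_1\cdots u_{p-1}$ inside $u$; if $u$ changes go to (3). (2) $R$-reduce $u_2\cdots u_p$ inside $u$. (3) If $u\ne\lambda$, $R$-reduce $u$. (4) While $p>q+2$, or $p=q+2$, $q>0$ and $u_1>v_1$, replace $(u,v)$ by $(u_1\cdots u_{p-1},v\,\iota(u_p))$. (5) If $p=q+2$ and $u_2>\iota(u_1)$, replace $(u,v)$ by $(u_2\cdots u_p,\iota(u_1)v)$. (6) Cancel common first letters. (7) Cancel common last letters. (8) $R$-reduce $v$. (9) If $v>u$ interchange them. (10) If $(u,v)$ has changed since (4) was last entered go to (4); otherwise output $(u,v)$. *Handling the output* $(\lambda_1,\rho_1)$: if it is not $(\epsilon,\epsilon)$, sew it into $\mathrm{WDiff}$: read it from the left from the initial state as far as possible, then read the remainder from the right from the final state as far as possible; read what is left along new arrows, where the state following a state labelled $w$ along the letter $(x,y)$ has as label the $R$-reduction of $\iota(x)wy$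 (leaving $S$ unchanged; it is the existing state of that label if there is one); mark all arrows used as needed; identify the two states where the readings meet; weld. Then, if $(\lambda_1,\rho_1)=(\lambda,\rho)$, leave it in $\mathrm{Considered}$, or move it from $\mathrm{New}$ to $\mathrm{This}$. Otherwise insert $(\lambda_1,\rho_1)$ in $\mathrm{This}$ unless it is $(\epsilon,\epsilon)$ or in $S$, and then delete $(\lambda,\rho)$ if a proper substring of $\lambda$ is $R$-reducible, and move it to $\mathrm{Delete}$ if not. *A pass* consists of: empty $\mathrm{Delete}$; minimize and handle each rule of $\mathrm{Considered}$; minimize and handle rules of $\mathrm{New}$ until $\mathrm{New}$ is empty; then, until $\mathrm{This}$ is empty, move a rule from $\mathrm{This}$ to $\mathrm{Considered}$ and, for each non-empty overlap of its left-hand side with the left-hand side of a rule in $\mathrm{Considered}$ (itself included) (a suffix $z$ of $\lambda'=s_1z$ which is a prefix of $\lambda''=zs_2$, in either order), $R$-reduce $\rho's_2$ and $s_1\rho''$ and, if the results differ, insert the pair, greater string first, in $\mathrm{New}$ unless it is in $S$. Finally, repeatedly replace the state labels of $\mathrm{WDiff}$ by their $R$-reductions with $\mathrm{WDiff}$ in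 place of $\mathrm{Rules}$ (leaving $S$ unchanged), identify states with equal labels and weld, until all labels are irreducible; delete the arrows which are not needed; the result becomes $\mathrm{Rules}$ for the next pass and the new $\mathrm{WDiff}$, with no arrow marked needed. Passes follow each other without end, elements of finite sets being processed in any order. Time $t=0,1,2,\dots$ counts the elementary operations (a single reduction step, a single step of minimization or of handling, and so on), and $S_t$ is $S$ at time $t$. A string is *permanently irreducible* if for arbitrarily large $t$ it contains no left-hand side of a rule in $S_t$. A rule $(\lambda,\rho)\in S_t$ is *permanent* if $\rho$ and all proper substrings of $\lambda$ are permanently irreducible. **Theorem.** For every run of this procedure, let $u\in A^*$ and let $v$ be the shortlex-least element of the Thue congruence class of $u$. Then there is a time $T$ such that for every $t\ge T$ there is a chain of elementary reductions $s_1\lambda s_2\to s_1\rho s_2$ from $u$ to $v$ whose rules $(\lambda,\rho)\in S_t$ are all permanent. There is also a time $T'$ such that for every $t\ge T'$, $R$-reduction of $u$, carried out from the configuration at time $t$, ends with $v$ and with no other string. -/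

import Mathlib

namespace WeldKB

/-! ### Strings, rules, rewriting -/

/-- A rewrite rule `(l, r)` on strings over `A`. -/
abbrev Rule (A : Type*) := List A × List A

instance {A : Type*} [DecidableEq A] : DecidableEq (Rule A) :=
  inferInstanceAs (DecidableEq (List A × List A))

/-- The strict shortlex order on strings. -/
def SLex {A : Type*} [LinearOrder A] (u v : List A) : Prop :=
  List.Shortlex (fun a b : A => a < b) u v

theorem SLex.wf {A : Type*} [Fintype A] [LinearOrder A] :
    WellFounded (SLex : List A → List A → Prop) :=
  List.Shortlex.wf (Finite.to_wellFoundedLT (α := A)).wf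

/-- `v` is the shortlex-least string satisfying `P`. -/
def IsSLexLeast {A : Type*} [LinearOrder A] (P : List A → Prop) (v : List A) : Prop :=
  P v ∧ ∀ w, P w → w = v ∨ SLex v w

/-- The string `v` arises from `u` by replacing one occurrence of `r.1` by `r.2`. -/
def RewritesBy {A : Type*} (r : Rule A) (u v : List A) : Prop :=
  ∃ s₁ s₂, u = s₁ ++ r.1 ++ s₂ ∧ v = s₁ ++ r.2 ++ s₂

/-- Elementary reduction with respect to a set of rules. -/
def Rewrites {A : Type*} (R : Set (Rule A)) (u v : List A) : Prop :=
  ∃ r ∈ R, RewritesBy r u v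

/-- The Thue congruence: reflexive, symmetric, transitive closure of elementary reduction. -/
def Thue {A : Type*} (R : Set (Rule A)) : List A → List A → Prop :=
  Relation.EqvGen (Rewrites R)

/-- Some substring of `u` is the left-hand side of a rule in `R`. -/
def Reducible {A : Type*} (R : Set (Rule A)) (u : List A) : Prop :=
  ∃ v, Rewrites R u v

/-- The formal inverse of a string, `inv` being the formal inversion of letters. -/
def formalInv {A : Type*} (inv : A → A) (w : List A) : List A := (w.map inv).reverse

/-! ### Two-variable automata -/

/-- Letters of the padded product alphabet; `none` is the padding symbol. -/
abbrev Letter (A : Type*) := Option A × Option A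

/-- The padded string of pairs of letters which encodes a pair of strings. -/
def pad {A : Type*} : List A → List A → List (Letter A)
  | [], [] => []
  | a :: u, [] => (some a, none) :: pad u []
  | [], b :: v => (none, some b) :: pad [] v
  | a :: u, b :: v => (some a, some b) :: pad u v

/-- An arrow of a two-variable automaton. The states of the automata used by the procedure carry
pairwise distinct strings as labels, and a state is identified with its label. The string `[]`
is the unique initial state and the unique final state. An automaton is given by its finite
set of arrows; its states are `[]` and the ends of its arrows. -/
structure Arrow (A : Type*) where
  src : List A
  lbl : Letter A
  dst : List A
deriving DecidableEq

/-- The list of arrows is a path from the state `s` to the state `t`. -/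
def IsWalk {A : Type*} : List A → List (Arrow A) → List A → Prop
  | s, [], t => s = t
  | s, a :: as, t => a.src = s ∧ IsWalk a.dst as t

/-- The automaton `M` accepts the pair of strings `r`. -/
def Accepts {A : Type*} (M : Finset (Arrow A)) (r : Rule A) : Prop :=
  ∃ as : List (Arrow A), (∀ a ∈ as, a ∈ M) ∧ IsWalk [] as [] ∧ as.map Arrow.lbl = pad r.1 r.2

/-- The arrows of the five-state automaton `SL2`, with states `1, …, 5`. -/
inductive SL2Arrow {A : Type*} [LinearOrder A] : ℕ → Letter A → ℕ → Prop
  | gt (x y : A) : y < x → SL2Arrow 1 (some x, some y) 2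
  | lt (x y : A) : x < y → SL2Arrow 1 (some x, some y) 3
  | pad₁ (x : A) : SL2Arrow 1 (some x, none) 4
  | loop₂ (x y : A) : SL2Arrow 2 (some x, some y) 2
  | pad₂ (x : A) : SL2Arrow 2 (some x, none) 4
  | loop₃ (x y : A) : SL2Arrow 3 (some x, some y) 3
  | pad₃ (x : A) : SL2Arrow 3 (some x, none) 4
  | pad₄ (x : A) : SL2Arrow 4 (some x, none) 5

/-- Paths in `SL2`. -/
inductive SL2Path {A : Type*} [LinearOrder A] : ℕ → List (Letter A) → ℕ → Prop
  | nil (i : ℕ) : SL2Path i [] i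
  | cons (i j k : ℕ) (l : Letter A) (ls : List (Letter A)) :
      SL2Arrow i l j → SL2Path j ls k → SL2Path i (l :: ls) k

/-- `SL2` accepts the pair `r`; the initial state is `1`, the final states are `2`, `4`, `5`. -/
def SL2Accepts {A : Type*} [LinearOrder A] (r : Rule A) : Prop :=
  SL2Path 1 (pad r.1 r.2) 2 ∨ SL2Path 1 (pad r.1 r.2) 4 ∨ SL2Path 1 (pad r.1 r.2) 5

/-- The possibly infinite set of rules held implicitly by the automaton `M`. -/
def setOfRules {A : Type*} [LinearOrder A] (M : Finset (Arrow A)) : Set (Rule A) :=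
  {r | Accepts M r ∧ SL2Accepts r}

/-- `x⁻¹ p y`, as a string, for a letter `(x, y)` of the product alphabet (a padding symbol
counts as the identity). -/
def stepLabel {A : Type*} (inv : A → A) (l : Letter A) (p : List A) : List A :=
  l.1.toList.map inv ++ p ++ l.2.toList

/-- The path from the state `p` to the final state which reads the given string of letters; an
intermediate state is labelled by the word-difference read off along the path. -/
def pathFrom {A : Type*} [DecidableEq A] (inv : A → A) :
    List A → List (Letter A) → Finset (Arrow A)
  | _, [] => ∅
  | p, [l] => {⟨p, l, []⟩}
  | p, l :: l' :: ls =>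
      insert ⟨p, l, stepLabel inv l p⟩ (pathFrom inv (stepLabel inv l p) (l' :: ls))

/-- The automaton of a single rule. -/
def ruleAutomaton {A : Type*} [DecidableEq A] (inv : A → A) (r : Rule A) : Finset (Arrow A) :=
  pathFrom inv [] (pad r.1 r.2)

/-! ### Welding -/

/-- The identifications of states made by welding the automaton `M` with one additional
`ε`-arrow joining `p` and `q`: arrows with the same letter and the same source get the same target,
arrows with the same letter and the same target get the same source, and an arrow labelled
`(x, x)` which starts or ends at the initial state becomes a loop. -/
inductive WeldRel {A : Type*} (M : Finset (Arrow A)) (p q : List A) : List A → List A → Prop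
  | refl (s) : WeldRel M p q s s
  | symm (s t) : WeldRel M p q s t → WeldRel M p q t s
  | trans (s t u) : WeldRel M p q s t → WeldRel M p q t u → WeldRel M p q s u
  | join : WeldRel M p q p q
  | forward (a b : Arrow A) : a ∈ M → b ∈ M → a.lbl = b.lbl →
      WeldRel M p q a.src b.src → WeldRel M p q a.dst b.dst
  | backward (a b : Arrow A) : a ∈ M → b ∈ M → a.lbl = b.lbl →
      WeldRel M p q a.dst b.dst → WeldRel M p q a.src b.src
  | diagOut (a : Arrow A) : a ∈ M → a.lbl.1 = a.lbl.2 →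
      WeldRel M p q a.src [] → WeldRel M p q a.dst []
  | diagIn (a : Arrow A) : a ∈ M → a.lbl.1 = a.lbl.2 →
      WeldRel M p q a.dst [] → WeldRel M p q a.src []

/-- An amalgamated state is labelled by the shortlex-least label of its members. -/
noncomputable def weldRep {A : Type*} [Fintype A] [LinearOrder A] (M : Finset (Arrow A))
    (p q s : List A) : List A :=
  SLex.wf.min {t | WeldRel M p q s t} ⟨s, WeldRel.refl s⟩

/-- Rename states by `f`. -/
def mapStates {A : Type*} [DecidableEq A] (f : List A → List A) (M : Finset (Arrow A)) :
    Finset (Arrow A) :=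
  M.image fun a => ⟨f a.src, a.lbl, f a.dst⟩

/-- Omit the loops labelled `(x, x)` at the initial state. -/
def dropLoops {A : Type*} [DecidableEq A] (M : Finset (Arrow A)) : Finset (Arrow A) :=
  M.filter fun a => ¬ (a.src = [] ∧ a.dst = [] ∧ a.lbl.1 = a.lbl.2)

/-- The automaton `WDiff`, with the set of those of its arrows which are marked as needed (a state
is needed when it is an end of a needed arrow). -/
structure WDiff (A : Type*) where
  arrows : Finset (Arrow A)
  needed : Finset (Arrow A)

/-- Join `p` and `q` by an `ε`-arrow and weld. -/
noncomputable def weld {A : Type*} [Fintype A] [LinearOrder A] (W : WDiff A) (p q : List A) :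
    WDiff A where
  arrows := dropLoops (mapStates (weldRep W.arrows p q) W.arrows)
  needed := dropLoops (mapStates (weldRep W.arrows p q) W.needed)

/-! ### Configurations of the procedure -/

/-- The steps of the minimization routine. -/
inductive MinLine
  | front | back | whole | shorten | shift | cancelLeft | cancelRight | rhs | swap | again

/-- The stages of handling the output of minimization. -/
inductive HandleLine
  | sew | install | discard

/-- What the procedure is doing. -/
inductive Phase (A : Type*)
  /-- A Knuth-Bendix pass is about to begin. -/
  | beginPass
  /-- Rules are taken for minimization from `todo`, the rules of `Considered` not yet processed
  in this pass, and afterwards from `New`. -/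
  | scan (todo : Finset (Rule A))
  /-- The rule `inp` is being minimized; its current value is `cur`, and `entry` was its
  value when the routine last began its main loop. -/
  | minimize (todo : Finset (Rule A)) (inp : Rule A) (line : MinLine) (cur entry : Rule A)
  /-- The output `out` of minimizing `inp` is being handled. -/
  | handle (todo : Finset (Rule A)) (inp out : Rule A) (line : HandleLine)
  /-- The rules of `This` are to be compared with those of `Considered`. -/
  | compare
  /-- The overlaps `((r₁, r₂), k)` of length `k` in `todo` remain to be examined. -/
  | overlaps (todo : Finset ((Rule A × Rule A) × ℕ))
  /-- The two sides `a`, `b` of a critical pair are being reduced. -/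
  | resolve (todo : Finset ((Rule A × Rule A) × ℕ)) (a b : List A)

/-- A configuration of the procedure. The number of the current pass is `pass`, `rules` is the
automaton `Rules[pass]` (before a pass begins, the automaton for the pass to come), and the four
finite sets make up the finite set of rules `S`. -/
structure Config (A : Type*) where
  pass : ℕ
  rules : Finset (Arrow A)
  considered : Finset (Rule A)
  thisRules : Finset (Rule A)
  newRules : Finset (Rule A)
  deleteRules : Finset (Rule A)
  wdiff : WDiff A
  phase : Phase A

/-- The finite set of rules `S`. -/
def Config.store {A : Type*} [DecidableEq A] (c : Config A) : Finset (Rule A) :=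
  c.considered ∪ c.thisRules ∪ c.newRules ∪ c.deleteRules

/-- Insert a rule in `New` unless it is already in `S`. -/
def Config.addNew {A : Type*} [DecidableEq A] (c : Config A) (r : Rule A) : Config A :=
  if r ∈ c.store then c else { c with newRules := insert r c.newRules }

/-! ### Rapid reduction -/

/-- `w` is reducible with respect to the rules held implicitly by `Rules`. -/
def RReducible {A : Type*} [LinearOrder A] (c : Config A) (w : List A) : Prop :=
  Reducible (setOfRules c.rules) w

/-- `l` is the left-hand side of a rule held implicitly by `Rules`. -/
def IsLhs {A : Type*} [LinearOrder A] (c : Config A) (l : List A) : Prop :=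
  ∃ ρ, (l, ρ) ∈ setOfRules c.rules

/-- `p ++ l` is the shortest reducible prefix of `p ++ l ++ q`, and `l` is its shortest suffix
which is the left-hand side of a rule. -/
def IsRedex {A : Type*} [LinearOrder A] (c : Config A) (p l : List A) : Prop :=
  IsLhs c l ∧ (∀ x, x <+: p ++ l → x ≠ p ++ l → ¬ RReducible c x) ∧
    ∀ x, x <:+ l → x ≠ l → ¬ IsLhs c x

/-- The right-hand side used for `l`: the least one which `S` provides, and, if there is none,
the least one which `Rules` provides. -/
def IsRhs {A : Type*} [LinearOrder A] (c : Config A) (l ρ : List A) : Prop :=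
  ((∃ ρ', (l, ρ') ∈ c.store) ∧ IsSLexLeast (fun ρ' => (l, ρ') ∈ c.store) ρ) ∨
    ((¬ ∃ ρ', (l, ρ') ∈ c.store) ∧ IsSLexLeast (fun ρ' => (l, ρ') ∈ setOfRules c.rules) ρ)

/-- One step of `R`-reduction, acting on a configuration and a string: the rule that is used is
inserted in `New` if it is not in `S`. -/
def RStep {A : Type*} [LinearOrder A] (x y : Config A × List A) : Prop :=
  ∃ p l q ρ, x.2 = p ++ l ++ q ∧ IsRedex x.1 p l ∧ IsRhs x.1 l ρ ∧
    y = (x.1.addNew (l, ρ), p ++ ρ ++ q)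

/-- `R`-reduction of `u`, started in the configuration `c`, ends with the string `v`. -/
def RReducesTo {A : Type*} [LinearOrder A] (c : Config A) (u v : List A) : Prop :=
  ∃ c' : Config A, Relation.ReflTransGen RStep (c, u) (c', v) ∧ ¬ RReducible c' v

/-! ### The minimization routine -/

/-- Move the last letter of the left-hand side to the right-hand side. -/
def Shorten {A : Type*} [LinearOrder A] (inv : A → A) (r r' : Rule A) : Prop :=
  ∃ w x, r.1 = w ++ [x] ∧
    (r.2.length + 2 < r.1.length ∨
      (r.1.length = r.2.length + 2 ∧ ∃ a b, r.1.head? = some a ∧ r.2.head? = some b ∧ b < a)) ∧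
    r' = (w, r.2 ++ [inv x])

/-- Move the first letter of the left-hand side to the right-hand side. -/
def Shift {A : Type*} [LinearOrder A] (inv : A → A) (r r' : Rule A) : Prop :=
  ∃ a b w, r.1 = a :: b :: w ∧ r.1.length = r.2.length + 2 ∧ inv a < b ∧
    r' = (b :: w, inv a :: r.2)

/-- Cancel a common first letter. -/
def CancelLeft {A : Type*} (r r' : Rule A) : Prop :=
  ∃ x, r.1 = x :: r'.1 ∧ r.2 = x :: r'.2

/-- Cancel a common last letter. -/
def CancelRight {A : Type*} (r r' : Rule A) : Prop :=
  ∃ x, r.1 = r'.1 ++ [x] ∧ r.2 = r'.2 ++ [x]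

/-- The steps of the minimization routine which do not involve reduction. -/
inductive Tidy {A : Type*} [LinearOrder A] (inv : A → A) :
    MinLine → Rule A → MinLine → Rule A → Prop
  | shorten (r r') : Shorten inv r r' → Tidy inv .shorten r .shorten r'
  | shortenDone (r) : (¬ ∃ r', Shorten inv r r') → Tidy inv .shorten r .shift r
  | shift (r r') : Shift inv r r' → Tidy inv .shift r .cancelLeft r'
  | shiftDone (r) : (¬ ∃ r', Shift inv r r') → Tidy inv .shift r .cancelLeft r
  | cancelLeft (r r') : CancelLeft r r' → Tidy inv .cancelLeft r .cancelLeft r'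
  | cancelLeftDone (r) : (¬ ∃ r', CancelLeft r r') → Tidy inv .cancelLeft r .cancelRight r
  | cancelRight (r r') : CancelRight r r' → Tidy inv .cancelRight r .cancelRight r'
  | cancelRightDone (r) : (¬ ∃ r', CancelRight r r') → Tidy inv .cancelRight r .rhs r
  | swap (u v) : SLex u v → Tidy inv .swap (u, v) .again (v, u)
  | swapDone (u v) : ¬ SLex u v → Tidy inv .swap (u, v) .again (u, v)

/-! ### Sewing, relabelling, overlaps -/

/-- The result of sewing the rule `r` into `WDiff`. The rule is read from the left as far as
possible (the path `f`), and what is left of it is read from the right as far as possible (the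
path `b`). The rest is read along new arrows `m`, where the label of each next state is obtained
by `R`-reduction. All these arrows are needed. Then the end of `m` is joined to the source of `b`
and the automaton is welded. -/
def Sew {A : Type*} [Fintype A] [LinearOrder A] (inv : A → A) (c : Config A) (r : Rule A)
    (W : WDiff A) : Prop :=
  ∃ (f m b : List (Arrow A)) (s e t : List A),
    (f ++ m ++ b).map Arrow.lbl = pad r.1 r.2 ∧
    (∀ a ∈ f, a ∈ c.wdiff.arrows) ∧ IsWalk [] f s ∧
    (∀ a ∈ c.wdiff.arrows, a.src = s → ((m ++ b).map Arrow.lbl).head? ≠ some a.lbl) ∧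
    (∀ a ∈ b, a ∈ c.wdiff.arrows) ∧ IsWalk t b [] ∧
    (∀ a ∈ c.wdiff.arrows, a.dst = t → (m.map Arrow.lbl).getLast? ≠ some a.lbl) ∧
    IsWalk s m e ∧ (∀ a ∈ m, RReducesTo c (stepLabel inv a.lbl a.src) a.dst) ∧
    W = weld ⟨c.wdiff.arrows ∪ (f ++ m ++ b).toFinset,
      c.wdiff.needed ∪ (f ++ m ++ b).toFinset⟩ e t

/-- Replace each state label by its reduction with respect to `WDiff` itself, identify states
which now have the same label, and weld. -/
def RelabelStep {A : Type*} [Fintype A] [LinearOrder A] (c : Config A) (W W' : WDiff A) : Prop :=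
  ∃ f : List A → List A, (∀ s, RReducesTo { c with rules := W.arrows } s (f s)) ∧
    W' = weld ⟨mapStates f W.arrows, mapStates f W.needed⟩ [] []

/-- Relabelling is repeated until all state labels are irreducible with respect to `WDiff`. -/
def Relabelled {A : Type*} [Fintype A] [LinearOrder A] (c : Config A) (W W' : WDiff A) : Prop :=
  Relation.ReflTransGen (RelabelStep c) W W' ∧
    ∀ a ∈ W'.arrows, ¬ Reducible (setOfRules W'.arrows) a.src ∧
      ¬ Reducible (setOfRules W'.arrows) a.dst

/-- A suffix of length `k ≥ 1` of the left-hand side of the first rule is a prefix of the left-hand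
side of the second. -/
def IsOverlap {A : Type*} (o : (Rule A × Rule A) × ℕ) : Prop :=
  1 ≤ o.2 ∧ o.2 ≤ o.1.1.1.length ∧ o.2 ≤ o.1.2.1.length ∧
    o.1.1.1.drop (o.1.1.1.length - o.2) = o.1.2.1.take o.2

instance {A : Type*} [DecidableEq A] : DecidablePred (IsOverlap (A := A)) :=
  fun _ => inferInstanceAs (Decidable (_ ∧ _ ∧ _ ∧ _))

/-- The overlaps between the rule `r` and the rules in `C`, in both orders. -/
def overlapsWith {A : Type*} [DecidableEq A] (r : Rule A) (C : Finset (Rule A)) :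
    Finset ((Rule A × Rule A) × ℕ) :=
  ((({r} ×ˢ C) ∪ (C ×ˢ {r})) ×ˢ Finset.range (r.1.length + 1)).filter IsOverlap

/-- The two ways of rewriting the overlap `s₁ z s₂` of `s₁ z` and `z s₂`. -/
def overlapLeft {A : Type*} (o : (Rule A × Rule A) × ℕ) : List A :=
  o.1.1.2 ++ o.1.2.1.drop o.2

/-- See `overlapLeft`. -/
def overlapRight {A : Type*} (o : (Rule A × Rule A) × ℕ) : List A :=
  o.1.1.1.take (o.1.1.1.length - o.2) ++ o.1.2.2

/-! ### The procedure -/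

/-- One operation of the procedure. The order in which the elements of a finite set are processed
is left open. -/
inductive Step {A : Type*} [Fintype A] [LinearOrder A] (inv : A → A) :
    Config A → Config A → Prop
  -- A pass begins.
  | beginPass (c : Config A) : c.phase = .beginPass →
      Step inv c { c with
        pass := c.pass + 1, deleteRules := ∅, phase := .scan c.considered }
  -- Rules of `Considered`, and then those of `New`, are minimized.
  | pickConsidered (c : Config A) (todo r) : c.phase = .scan todo → r ∈ todo →
      Step inv c { c with phase := .minimize (todo.erase r) r .front r r }
  | pickNew (c : Config A) (r) : c.phase = .scan ∅ → r ∈ c.newRules →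
      Step inv c { c with phase := .minimize ∅ r .front r r }
  | scanDone (c : Config A) : c.phase = .scan ∅ → c.newRules = ∅ →
      Step inv c { c with phase := .compare }
  -- Minimization: reduce the maximal proper prefix of the left-hand side.
  | front (c c' : Config A) (todo inp w w' x v e) :
      c.phase = .minimize todo inp .front (w ++ [x], v) e → RStep (c, w) (c', w') →
      Step inv c { c' with phase := .minimize todo inp .front (w' ++ [x], v) e }
  | frontSame (c : Config A) (todo inp w x v e) :
      c.phase = .minimize todo inp .front (w ++ [x], v) e → ¬ RReducible c w →
      w ++ [x] = inp.1 →
      Step inv c { c with phase := .minimize todo inp .back (w ++ [x], v) e }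
  | frontChanged (c : Config A) (todo inp w x v e) :
      c.phase = .minimize todo inp .front (w ++ [x], v) e → ¬ RReducible c w →
      w ++ [x] ≠ inp.1 →
      Step inv c { c with phase := .minimize todo inp .whole (w ++ [x], v) e }
  -- Minimization: reduce the maximal proper suffix of the left-hand side.
  | back (c c' : Config A) (todo inp w w' x v e) :
      c.phase = .minimize todo inp .back (x :: w, v) e → RStep (c, w) (c', w') →
      Step inv c { c' with phase := .minimize todo inp .back (x :: w', v) e }
  | backDone (c : Config A) (todo inp w x v e) :
      c.phase = .minimize todo inp .back (x :: w, v) e → ¬ RReducible c w →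
      Step inv c { c with phase := .minimize todo inp .whole (x :: w, v) e }
  -- Minimization: reduce the left-hand side if it has changed, and enter the main loop.
  | whole (c c' : Config A) (todo inp u u' v e) :
      c.phase = .minimize todo inp .whole (u, v) e → u ≠ inp.1 → RStep (c, u) (c', u') →
      Step inv c { c' with phase := .minimize todo inp .whole (u', v) e }
  | wholeDone (c : Config A) (todo inp u v e) :
      c.phase = .minimize todo inp .whole (u, v) e → (u = inp.1 ∨ ¬ RReducible c u) →
      Step inv c { c with phase := .minimize todo inp .shorten (u, v) (u, v) }
  | tidy (c : Config A) (todo inp line r line' r' e) :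
      c.phase = .minimize todo inp line r e → Tidy inv line r line' r' →
      Step inv c { c with phase := .minimize todo inp line' r' e }
  -- Minimization: reduce the right-hand side.
  | rhs (c c' : Config A) (todo inp u v v' e) :
      c.phase = .minimize todo inp .rhs (u, v) e → RStep (c, v) (c', v') →
      Step inv c { c' with phase := .minimize todo inp .rhs (u, v') e }
  | rhsDone (c : Config A) (todo inp u v e) :
      c.phase = .minimize todo inp .rhs (u, v) e → ¬ RReducible c v →
      Step inv c { c with phase := .minimize todo inp .swap (u, v) e }
  -- Minimization: repeat the main loop as long as it has an effect, and then output the rule.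
  | again (c : Config A) (todo inp r e) :
      c.phase = .minimize todo inp .again r e → r ≠ e →
      Step inv c { c with phase := .minimize todo inp .shorten r r }
  | output (c : Config A) (todo inp r e) :
      c.phase = .minimize todo inp .again r e → r = e →
      Step inv c { c with phase := .handle todo inp r .sew }
  -- The output, unless trivial, is sewn into `WDiff`.
  | sew (c : Config A) (todo inp out W) :
      c.phase = .handle todo inp out .sew → out ≠ ([], []) → Sew inv c out W →
      Step inv c { c with wdiff := W, phase := .handle todo inp out .install }
  | sewNothing (c : Config A) (todo inp out) :
      c.phase = .handle todo inp out .sew → out = ([], []) →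
      Step inv c { c with phase := .handle todo inp out .install }
  -- A minimal rule stays in `Considered`, or is moved from `New` to `This`.
  | keep (c : Config A) (todo inp out) :
      c.phase = .handle todo inp out .install → out = inp → inp ∉ c.newRules →
      Step inv c { c with phase := .scan todo }
  | promote (c : Config A) (todo inp out) :
      c.phase = .handle todo inp out .install → out = inp → inp ∈ c.newRules →
      Step inv c { c with
        newRules := c.newRules.erase inp, thisRules := insert inp c.thisRules,
        phase := .scan todo }
  -- Otherwise the output, unless trivial or already in `S`, is inserted in `This`.
  | installOld (c : Config A) (todo inp out) :
      c.phase = .handle todo inp out .install → out ≠ inp →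
      (out = ([], []) ∨ out ∈ c.store) →
      Step inv c { c with phase := .handle todo inp out .discard }
  | install (c : Config A) (todo inp out) :
      c.phase = .handle todo inp out .install → out ≠ inp → out ≠ ([], []) → out ∉ c.store →
      Step inv c { c with
        thisRules := insert out c.thisRules, phase := .handle todo inp out .discard }
  -- The rule which was not minimal is deleted at once if a proper substring of its left-hand side
  -- is reducible, and is moved to `Delete` otherwise.
  | discardNow (c : Config A) (todo inp out) :
      c.phase = .handle todo inp out .discard →
      (∃ x, x <:+: inp.1 ∧ x ≠ inp.1 ∧ RReducible c x) →
      Step inv c { c with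
        considered := c.considered.erase inp, newRules := c.newRules.erase inp,
        phase := .scan todo }
  | discardLater (c : Config A) (todo inp out) :
      c.phase = .handle todo inp out .discard →
      (¬ ∃ x, x <:+: inp.1 ∧ x ≠ inp.1 ∧ RReducible c x) →
      Step inv c { c with
        considered := c.considered.erase inp, newRules := c.newRules.erase inp,
        deleteRules := insert inp c.deleteRules, phase := .scan todo }
  -- Each rule of `This` is moved to `Considered` and compared with the rules there.
  | take (c : Config A) (r) : c.phase = .compare → r ∈ c.thisRules →
      Step inv c { c with
        thisRules := c.thisRules.erase r, considered := insert r c.considered,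
        phase := .overlaps (overlapsWith r (insert r c.considered)) }
  | overlap (c : Config A) (todo) (o : (Rule A × Rule A) × ℕ) : c.phase = .overlaps todo → o ∈ todo →
      Step inv c { c with phase := .resolve (todo.erase o) (overlapLeft o) (overlapRight o) }
  | overlapsDone (c : Config A) : c.phase = .overlaps ∅ →
      Step inv c { c with phase := .compare }
  -- Both sides of a critical pair are reduced; if the results differ, they form a new rule.
  | resolveLeft (c c' : Config A) (todo a a' b) : c.phase = .resolve todo a b →
      RStep (c, a) (c', a') →
      Step inv c { c' with phase := .resolve todo a' b }
  | resolveRight (c c' : Config A) (todo a b b') : c.phase = .resolve todo a b →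
      ¬ RReducible c a → RStep (c, b) (c', b') →
      Step inv c { c' with phase := .resolve todo a b' }
  | resolveEq (c : Config A) (todo a) : c.phase = .resolve todo a a → ¬ RReducible c a →
      Step inv c { c with phase := .overlaps todo }
  | resolveGt (c : Config A) (todo a b) : c.phase = .resolve todo a b →
      ¬ RReducible c a → ¬ RReducible c b → SLex b a →
      Step inv c { c.addNew (a, b) with phase := .overlaps todo }
  | resolveLt (c : Config A) (todo a b) : c.phase = .resolve todo a b →
      ¬ RReducible c a → ¬ RReducible c b → SLex a b →
      Step inv c { c.addNew (b, a) with phase := .overlaps todo }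
  -- The pass ends: the states of `WDiff` are relabelled, the arrows which are not needed are
  -- deleted, and the result becomes `Rules` for the next pass.
  | endPass (c : Config A) (W : WDiff A) : c.phase = .compare → c.thisRules = ∅ →
      Relabelled c c.wdiff W →
      Step inv c { c with
        rules := W.needed, wdiff := ⟨W.needed, ∅⟩, phase := .beginPass }

/-! ### Initial arrangements -/

/-- Cancellation of an inverse pair of letters in a cyclic word. -/
inductive CyclicCancel {A : Type*} (inv : A → A) : List A → List A → Prop
  | inside (p q : List A) (x : A) : CyclicCancel inv (p ++ [x, inv x] ++ q) (p ++ q)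
  | ends (w : List A) (x : A) : CyclicCancel inv ([x] ++ w ++ [inv x]) w

/-- The cyclically reduced word `w` is obtained from the relator `l r⁻¹` of the relation `e`. -/
def IsCyclicRelator {A : Type*} (inv : A → A) (e : Rule A) (w : List A) : Prop :=
  Relation.ReflTransGen (CyclicCancel inv) (e.1 ++ formalInv inv e.2) w ∧
    ¬ ∃ w', CyclicCancel inv w w'

/-- The initial rule made from the relation `e`: the cyclically reduced relator is written as
`l r⁻¹` where `(l, r)` is accepted by `SL2`; a trivial relator is dropped. -/
def IsInitialRule {A : Type*} [LinearOrder A] (inv : A → A) (e : Rule A) :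
    Option (Rule A) → Prop
  | none => IsCyclicRelator inv e []
  | some r => IsCyclicRelator inv e (r.1 ++ formalInv inv r.2) ∧ SL2Accepts r

/-- The initial set of rules: one for each relation, and the rules making `inv x` inverse to
`x`. -/
def IsInitialRules {A : Type*} [Fintype A] [LinearOrder A] (inv : A → A) (R I : Finset (Rule A)) :
    Prop :=
  ∃ choice : Rule A → Option (Rule A), (∀ e ∈ R, IsInitialRule inv e (choice e)) ∧
    I = R.biUnion (fun e => (choice e).toFinset) ∪
      Finset.univ.image fun x : A => ([x, inv x], [])

/-- The configuration in which the procedure starts with the initial rules `I`: they are all in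
`This`, and `WDiff = Rules[1]` is obtained by welding their automata. -/
noncomputable def start {A : Type*} [Fintype A] [LinearOrder A] (inv : A → A)
    (I : Finset (Rule A)) : Config A :=
  let M := I.biUnion (ruleAutomaton inv)
  let W := weld ⟨M, M⟩ [] []
  { pass := 0, rules := W.arrows, considered := ∅, thisRules := I, newRules := ∅,
    deleteRules := ∅, wdiff := W, phase := .beginPass }

/-- `σ t` is the configuration at time `t` in a run of the procedure on the presentation
`⟨A | R⟩`. -/
def IsRun {A : Type*} [Fintype A] [LinearOrder A] (inv : A → A) (R : Finset (Rule A))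
    (σ : ℕ → Config A) : Prop :=
  (∃ I, IsInitialRules inv R I ∧ σ 0 = start inv I) ∧ ∀ t, Step inv (σ t) (σ (t + 1))

/-! ### Permanent rules -/

/-- There are arbitrarily large times at which `w` is `S`-irreducible. -/
def PermanentlyIrreducible {A : Type*} [DecidableEq A] (σ : ℕ → Config A) (w : List A) : Prop :=
  ∀ T, ∃ t ≥ T, ¬ Reducible (↑(σ t).store : Set (Rule A)) w

/-- The right-hand side and the proper substrings of the left-hand side are permanently
irreducible. -/
def Permanent {A : Type*} [DecidableEq A] (σ : ℕ → Config A) (r : Rule A) : Prop :=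
  PermanentlyIrreducible σ r.2 ∧
    ∀ x, x <:+: r.1 → x ≠ r.1 → PermanentlyIrreducible σ x

/-- An elementary reduction at time `t` whose associated rule is a permanent rule of `S`. -/
def PermanentReduction {A : Type*} [DecidableEq A] (σ : ℕ → Config A) (t : ℕ) (u v : List A) :
    Prop :=
  ∃ r ∈ (σ t).store, Permanent σ r ∧ RewritesBy r u v

end WeldKB

set_option linter.unusedSectionVars false

namespace WeldKB

variable {A : Type*}

/-! ### The rank of a string in the shortlex order -/

section Rank

variable [LinearOrder A]

/-! A string over a finite alphabet has finitely many shortlex predecessors, so the order is encoded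
by a natural number, `rank`. Let X be the set `everStored σ` of all rules that are ever in S, and P
the set `persistent σ` of those that are in S from some time on. The theorem follows once X is
confluent, every X-reducible string contains a left-hand side of P, and every left-hand side of P is
eventually recognized by `Rules` for ever.

Soundness. The Thue classes form a group (`exists_isEval`). Along every arrow the label of the
target is the word-difference in this group, and welding, sewing and relabelling respect this. Hence
all accepted and all stored rules hold in the group, and X generates the congruence of R
(`IsRun.thue_iff`).

Redundancy of deleted rules. A rule gets a `weight`, which every change made by minimization lowers.
Throughout the routine the two sides of the input stay connected by lighter rules of X and the
current rule, through strings not above the input's left-hand side (`MinInv`). So a rule that leaves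
S is `Derivable` from lighter ones, and by induction on the weight a reduction by any rule of X can
be traded for one by a rule of P, up to a chain below the reduced string (`Complete.exists_mem`).

Passes end. While `New` is being emptied, the rules that can still enter it form a finite set
(`avail`), and a handled rule of `New` leaves this set for good. This gives a decreasing measure
(`IsRun.exists_beginPass`).

Persistent rules. Since passes recur, a persistent rule cannot stay in `This`, `New` or `Delete`; it
settles in `Considered`, where its overlaps are examined, and in every later pass it is found
minimal and sewn into `WDiff`. Critical pairs of P are thus connected below their overlap, and
well-founded induction yields confluence of X (`Complete.peak`, `Complete.confluent`).

Rapid reduction. Welding turns the path of a sewn rule into a path that may use dropped loops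
(`Traces`). Cutting it at these loops shows that the left-hand side is reducible by the next `Rules`
(`Traces.reducible`), so left-hand sides of P are eventually always R-reducible. As persistent rules
are found minimal again and again, their right-hand sides and the proper substrings of their
left-hand sides are X-irreducible: persistent rules are permanent. Finally, only finitely many
strings have rank at most `rank u`, so at late times an R-irreducible result of reducing u is
X-irreducible, hence equal to v. -/

theorem sLex_iff {u v : List A} :
    SLex u v ↔ u.length < v.length ∨ u.length = v.length ∧ List.Lex (· < ·) u v :=
  List.shortlex_def

theorem sLex_irrefl (u : List A) : ¬ SLex u u := by
  rw [sLex_iff]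
  rintro (h | ⟨-, h⟩)
  · exact lt_irrefl _ h
  · exact lt_irrefl u h

theorem SLex.trans {u v w : List A} (h₁ : SLex u v) (h₂ : SLex v w) : SLex u w := by
  rw [sLex_iff] at *
  rcases h₁ with h₁ | ⟨e₁, h₁⟩ <;> rcases h₂ with h₂ | ⟨e₂, h₂⟩
  · exact .inl (h₁.trans h₂)
  · exact .inl (e₂ ▸ h₁)
  · exact .inl (e₁ ▸ h₂)
  · exact .inr ⟨e₁.trans e₂, lt_trans (α := List A) h₁ h₂⟩

theorem sLex_trichotomy (u v : List A) : SLex u v ∨ u = v ∨ SLex v u := by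
  rw [sLex_iff, sLex_iff]
  rcases lt_trichotomy u.length v.length with h | h | h
  · exact .inl (.inl h)
  · rcases lt_trichotomy u v with h' | h' | h'
    · exact .inl (.inr ⟨h, h'⟩)
    · exact .inr (.inl h')
    · exact .inr (.inr (.inr ⟨h.symm, h'⟩))
  · exact .inr (.inr (.inl h))

/-- Equal lengths exclude that `u` is a proper prefix of `v`, a case in which a common suffix could
reverse the comparison. -/
theorem lex_append_right {u v : List A} (hl : u.length = v.length)
    (h : List.Lex (· < ·) u v) (w : List A) : List.Lex (· < ·) (u ++ w) (v ++ w) := by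
  induction h with
  | nil => simp at hl
  | cons _ ih => exact .cons (ih (by simpa using hl))
  | rel h => exact .rel h

theorem SLex.append {u v : List A} (h : SLex u v) (s w : List A) :
    SLex (s ++ u ++ w) (s ++ v ++ w) := by
  have h' : SLex (u ++ w) (v ++ w) := by
    rw [sLex_iff] at *
    rcases h with h | ⟨e, h⟩
    · left; simpa using h
    · exact .inr ⟨by simp [e], lex_append_right e h w⟩
  rw [List.append_assoc, List.append_assoc]
  exact List.Shortlex.append_left h' s

variable [Fintype A]

theorem finite_sLex (w : List A) : {v : List A | SLex v w}.Finite := by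
  refine (List.finite_length_le A w.length).subset fun v hv => ?_
  rw [Set.mem_ofPred_eq, sLex_iff] at hv
  rcases hv with h | h
  · exact h.le
  · exact h.1.le

/-- The number of strings which precede `w` in the shortlex order. -/
noncomputable def rank (w : List A) : ℕ := {v : List A | SLex v w}.ncard

theorem rank_lt_of_sLex {u v : List A} (h : SLex u v) : rank u < rank v := by
  refine Set.ncard_lt_ncard ⟨fun x hx => SLex.trans hx h, fun hs => ?_⟩ (finite_sLex v)
  exact sLex_irrefl u (hs h)

theorem rank_lt_iff {u v : List A} : rank u < rank v ↔ SLex u v := by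
  refine ⟨fun h => ?_, rank_lt_of_sLex⟩
  rcases sLex_trichotomy u v with h' | rfl | h'
  · exact h'
  · exact absurd h (lt_irrefl _)
  · exact absurd (rank_lt_of_sLex h') h.not_gt

theorem rank_injective : Function.Injective (rank : List A → ℕ) := fun u v h => by
  rcases sLex_trichotomy u v with h' | h' | h'
  · exact absurd h (rank_lt_of_sLex h').ne
  · exact h'
  · exact absurd h (rank_lt_of_sLex h').ne'

theorem rank_lt_of_length {u v : List A} (h : u.length < v.length) : rank u < rank v :=
  rank_lt_of_sLex (sLex_iff.2 (.inl h))

theorem length_le_of_rank {u v : List A} (h : rank u ≤ rank v) : u.length ≤ v.length := by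
  by_contra hc
  exact absurd (rank_lt_of_length (not_le.1 hc)) h.not_gt

theorem rank_append_lt {u v : List A} (h : rank u < rank v) (s w : List A) :
    rank (s ++ u ++ w) < rank (s ++ v ++ w) :=
  rank_lt_of_sLex ((rank_lt_iff.1 h).append s w)

theorem rank_infix_le {u v : List A} (h : u <:+: v) : rank u ≤ rank v := by
  obtain ⟨s, w, rfl⟩ := h
  by_cases hl : u.length = (s ++ u ++ w).length
  · simp only [List.length_append] at hl
    have hs : s = [] := List.eq_nil_of_length_eq_zero (by omega)
    have hw : w = [] := List.eq_nil_of_length_eq_zero (by omega)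
    simp [hs, hw]
  · refine (rank_lt_of_length (lt_of_le_of_ne ?_ hl)).le
    simp only [List.length_append]; omega

theorem rank_infix_lt {u v : List A} (h : u <:+: v) (hne : u ≠ v) : rank u < rank v :=
  lt_of_le_of_ne (rank_infix_le h) fun e => hne (rank_injective e)

theorem finite_rank_le (n : ℕ) : {w : List A | rank w ≤ n}.Finite :=
  (Set.finite_Iic n).preimage rank_injective.injOn

theorem rank_cons_lt {a b : A} {u v : List A} (hl : u.length = v.length) (h : a < b) :
    rank (a :: u) < rank (b :: v) :=
  rank_lt_of_sLex (sLex_iff.2 (.inr ⟨by simp [hl], .rel h⟩))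

theorem exists_isSLexLeast {P : List A → Prop} (h : ∃ w, P w) : ∃ w, IsSLexLeast P w := by
  obtain ⟨w, hw, hmin⟩ := SLex.wf.has_min {w | P w} h
  refine ⟨w, hw, fun x hx => ?_⟩
  rcases sLex_trichotomy w x with h' | h' | h'
  · exact .inr h'
  · exact .inl h'.symm
  · exact absurd h' (hmin x hx)

/-! ### The weight of a rule -/

/-- A weight which every change made by the minimization routine decreases. -/
noncomputable def weight (r : Rule A) : ℕ := 4 ^ rank r.1 + 2 * 4 ^ rank r.2

theorem pow_succ_le {m n : ℕ} (h : m < n) : 4 * 4 ^ m ≤ 4 ^ n := by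
  have := Nat.pow_le_pow_right (n := 4) (by norm_num) h
  rwa [Nat.pow_succ, mul_comm] at this

theorem four_pow_pos (n : ℕ) : 0 < 4 ^ n := by positivity

theorem weight_lt_fst {u u' v : List A} (h : rank u' < rank u) :
    weight (u', v) < weight (u, v) := by
  have := pow_succ_le h
  have := four_pow_pos (rank u')
  simp only [weight]; omega

theorem weight_lt_snd {u v v' : List A} (h : rank v' < rank v) :
    weight (u, v') < weight (u, v) := by
  have := pow_succ_le h
  have := four_pow_pos (rank v')
  simp only [weight]; omega

/-- With `k = rank u` the weight of `r` is at most `3 * 4 ^ (k - 1) < 4 ^ k`. Base 4 is what makes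
every rule with both sides before `u` lighter than any rule with left-hand side `u`. -/
theorem weight_lt_of_rank_lt {r : Rule A} {u v : List A} (h₁ : rank r.1 < rank u)
    (h₂ : rank r.2 < rank u) : weight r < weight (u, v) := by
  have := pow_succ_le h₁
  have := pow_succ_le h₂
  have := four_pow_pos (rank v)
  simp only [weight]; omega

/-- The factor 2 on the right-hand side serves this purpose: turning a wrongly oriented rule round
must also be a decrease. -/
theorem weight_swap_lt {u v : List A} (h : rank u < rank v) : weight (v, u) < weight (u, v) := by
  have := pow_succ_le h
  have := four_pow_pos (rank u)
  simp only [weight]; omega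

/-- Applied with `s` the input of minimization and `r` an intermediate rule, perhaps wrongly
oriented: the weight alone keeps both sides of `r` within reach of `s.1`. -/
theorem rank_fst_le_of_weight {r s : Rule A} (hs : rank s.2 < rank s.1)
    (h : weight r ≤ weight s) : rank r.1 ≤ rank s.1 := by
  by_contra hc
  have := pow_succ_le (not_le.1 hc)
  have := pow_succ_le hs
  have := four_pow_pos (rank s.2)
  simp only [weight] at h; omega

theorem rank_snd_lt_of_weight {r s : Rule A} (hs : rank s.2 < rank s.1)
    (h : weight r ≤ weight s) : rank r.2 < rank s.1 := by
  by_contra hc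
  have := Nat.pow_le_pow_right (n := 4) (by norm_num) (not_lt.1 hc)
  have := pow_succ_le hs
  have := four_pow_pos (rank r.1)
  simp only [weight] at h; omega

end Rank

/-! ### Connections below a bound -/

theorem RewritesBy.context {r : Rule A} {u v : List A} (h : RewritesBy r u v) (s w : List A) :
    RewritesBy r (s ++ u ++ w) (s ++ v ++ w) := by
  obtain ⟨p, q, rfl, rfl⟩ := h
  exact ⟨s ++ p, q ++ w, by simp, by simp⟩

theorem Rewrites.context {X : Set (Rule A)} {u v : List A} (h : Rewrites X u v) (s w : List A) :
    Rewrites X (s ++ u ++ w) (s ++ v ++ w) := by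
  obtain ⟨r, hr, h⟩ := h
  exact ⟨r, hr, h.context s w⟩

section Conn

variable [LinearOrder A]

/-- A single rewriting in either direction between strings of rank less than `n`. -/
def Link (X : Set (Rule A)) (n : ℕ) (u v : List A) : Prop :=
  rank u < n ∧ rank v < n ∧ (Rewrites X u v ∨ Rewrites X v u)

/-- A chain of rewritings, in both directions, through strings of rank less than `n`. -/
def Conn (X : Set (Rule A)) (n : ℕ) : List A → List A → Prop :=
  Relation.ReflTransGen (Link X n)

theorem Link.symm {X : Set (Rule A)} {n : ℕ} {u v : List A} (h : Link X n u v) : Link X n v u :=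
  ⟨h.2.1, h.1, h.2.2.symm⟩

theorem Conn.refl {X : Set (Rule A)} {n : ℕ} (u : List A) : Conn X n u u :=
  Relation.ReflTransGen.refl

theorem Conn.symm {X : Set (Rule A)} {n : ℕ} {u v : List A} (h : Conn X n u v) : Conn X n v u := by
  induction h with
  | refl => exact Conn.refl _
  | tail _ h ih => exact .head h.symm ih

theorem Conn.trans {X : Set (Rule A)} {n : ℕ} {u v w : List A} (h₁ : Conn X n u v)
    (h₂ : Conn X n v w) : Conn X n u w :=
  Relation.ReflTransGen.trans h₁ h₂

/-- Substitution of chains for single links. The old bound `m` is handed to the substitution, which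
may need it to stay below `n`. -/
theorem Conn.bind {X Y : Set (Rule A)} {m n : ℕ} {u v : List A} (h : Conn X m u v)
    (hl : ∀ a b, rank a < m → rank b < m → Rewrites X a b → Conn Y n a b) : Conn Y n u v := by
  induction h with
  | refl => exact Conn.refl _
  | tail _ h ih =>
    rcases h.2.2 with h' | h'
    · exact ih.trans (hl _ _ h.1 h.2.1 h')
    · exact ih.trans (hl _ _ h.2.1 h.1 h').symm

theorem Conn.single {X : Set (Rule A)} {n : ℕ} {u v : List A} (h : Rewrites X u v)
    (hu : rank u < n) (hv : rank v < n) : Conn X n u v :=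
  Relation.ReflTransGen.single ⟨hu, hv, .inl h⟩

theorem Conn.rule {X : Set (Rule A)} {n : ℕ} {r : Rule A} (hr : r ∈ X)
    (s w : List A) (hu : rank (s ++ r.1 ++ w) < n) (hv : rank (s ++ r.2 ++ w) < n) :
    Conn X n (s ++ r.1 ++ w) (s ++ r.2 ++ w) :=
  .single ⟨r, hr, s, w, rfl, rfl⟩ hu hv

theorem Conn.rank_lt {X : Set (Rule A)} {n : ℕ} {u v : List A} (h : Conn X n u v)
    (hu : rank u < n) : rank v < n := by
  induction h with
  | refl => exact hu
  | tail _ h _ => exact h.2.1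

/-- The bound is the rank of a string, because that string has to be put into the same context as
the chain. -/
theorem Conn.context [Fintype A] {X : Set (Rule A)} {m : List A} {u v : List A}
    (h : Conn X (rank m) u v) (s w : List A) :
    Conn X (rank (s ++ m ++ w)) (s ++ u ++ w) (s ++ v ++ w) := by
  refine Relation.ReflTransGen.lift (fun x => s ++ x ++ w) (fun a b hab => ?_) _ _ h
  exact ⟨rank_append_lt hab.1 s w, rank_append_lt hab.2.1 s w,
    hab.2.2.imp (·.context s w) (·.context s w)⟩

end Conn

theorem Reducible.infix {X : Set (Rule A)} {u v : List A} (h : Reducible X u) (huv : u <:+: v) :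
    Reducible X v := by
  obtain ⟨w, r, hr, p, q, rfl, rfl⟩ := h
  obtain ⟨s, t, rfl⟩ := huv
  exact ⟨s ++ (p ++ r.2 ++ q) ++ t, r, hr, s ++ p, q ++ t, by simp, by simp⟩

theorem reducible_iff {X : Set (Rule A)} {u : List A} :
    Reducible X u ↔ ∃ r ∈ X, r.1 <:+: u := by
  constructor
  · rintro ⟨w, r, hr, p, q, rfl, rfl⟩
    exact ⟨r, hr, p, q, rfl⟩
  · rintro ⟨r, hr, p, q, rfl⟩
    exact ⟨_, r, hr, p, q, rfl, rfl⟩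

/-- Reduces irreducibility of all proper substrings to the two maximal ones, which are those that
minimization tests. -/
theorem infix_dropLast_or_tail {x w : List A} (h : x <:+: w) (hne : x ≠ w) :
    x <:+: w.dropLast ∨ x <:+: w.tail := by
  obtain ⟨s, t, rfl⟩ := h
  rcases List.eq_nil_or_concat t with rfl | ⟨t, a, rfl⟩
  · cases s with
    | nil => simp at hne
    | cons a s => exact .inr ⟨s, [], by simp⟩
  · refine .inl ⟨s, t, ?_⟩
    rw [List.concat_eq_append, ← List.append_assoc, List.dropLast_concat]

/-! ### The automaton `SL2` -/

section SL2

variable [LinearOrder A]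

/-- States 4 and 5 count the letters read against padding, at most two. Only state 2, where the
first string already leads, is itself final; from 1 and 3 a surplus letter is required. -/
theorem sL2Path_pad_nil {u : List A} {i k : ℕ} (hi : i = 1 ∨ i = 2 ∨ i = 3)
    (h : SL2Path i (pad u []) k) (hk : k = 2 ∨ k = 4 ∨ k = 5) :
    u.length ≤ 2 ∧ (i ≠ 2 → 0 < u.length) := by
  match u, h with
  | [], h => rw [pad] at h; cases h; exact ⟨by simp, by omega⟩
  | [a], _ => simp
  | [a, b], _ => simp
  | a :: b :: c :: u, h =>
    exfalso
    rw [pad, pad, pad] at h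
    cases h with
    | cons _ j _ _ _ h₁ h₂ =>
      have hj : j = 4 := by cases h₁ <;> first | rfl | omega
      subst hj
      cases h₂ with
      | cons _ j _ _ _ h₁ h₂ =>
        cases h₁
        cases h₂ with
        | cons _ j _ _ _ h₁ h₂ => cases h₁

theorem sL2Path_pad {u v : List A} {i k : ℕ} (hi : i = 2 ∨ i = 3)
    (h : SL2Path i (pad u v) k) (hk : k = 2 ∨ k = 4 ∨ k = 5) :
    v.length ≤ u.length ∧ u.length ≤ v.length + 2 ∧ (i ≠ 2 → v.length < u.length) := by
  induction u generalizing v with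
  | nil =>
    cases v with
    | nil => simp only [pad] at h; cases h; simp; omega
    | cons b v => simp only [pad] at h; cases h with | cons _ j _ _ _ h₁ _ => cases h₁
  | cons a u ih =>
    cases v with
    | nil => have := sL2Path_pad_nil (by omega) h hk; simpa using this.1
    | cons b v =>
      simp only [pad] at h
      cases h with
      | cons _ j _ _ _ h₁ h₂ =>
        have hj : j = i := by cases h₁ <;> simp_all
        subst hj
        have := ih h₂
        simp only [List.length_cons]; omega

/-- The conditions on a rule which `SL2` checks. -/
theorem sL2Accepts_iff {u v : List A} :
    SL2Accepts (u, v) ↔ u ≠ [] ∧ v.length ≤ u.length ∧ u.length ≤ v.length + 2 ∧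
      (∀ a b, u.head? = some a → v.head? = some b →
        a ≠ b ∧ (u.length = v.length → b < a)) := by
  have key : SL2Accepts (u, v) ↔ ∃ k, (k = 2 ∨ k = 4 ∨ k = 5) ∧ SL2Path 1 (pad u v) k := by
    simp [SL2Accepts]
  rw [key]
  constructor
  · rintro ⟨k, hk, h⟩
    match u, v with
    | [], [] => simp only [pad] at h; cases h; omega
    | [], b :: v => simp only [pad] at h; cases h with | cons _ j _ _ _ h₁ _ => cases h₁
    | a :: u, [] => have := sL2Path_pad_nil (by omega) h hk; simpa using this.1
    | a :: u, b :: v =>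
      simp only [pad] at h
      cases h with
      | cons _ j _ _ _ h₁ h₂ =>
        cases h₁ with
        | gt _ _ hlt =>
          have := sL2Path_pad (by omega) h₂ hk
          simp only [List.length_cons, List.head?_cons, Option.some.injEq]
          refine ⟨by simp, by omega, by omega, ?_⟩
          rintro _ _ rfl rfl
          exact ⟨hlt.ne', fun _ => hlt⟩
        | lt _ _ hlt =>
          have := sL2Path_pad (by omega) h₂ hk
          simp only [List.length_cons, List.head?_cons, Option.some.injEq]
          refine ⟨by simp, by omega, by omega, ?_⟩
          rintro _ _ rfl rfl
          exact ⟨hlt.ne, fun _ => by omega⟩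
  · rintro ⟨hu, h₁, h₂, h₃⟩
    have hnil : ∀ u : List A, ∀ i, (i = 1 ∨ i = 2 ∨ i = 3) → u ≠ [] → u.length ≤ 2 →
        ∃ k, (k = 2 ∨ k = 4 ∨ k = 5) ∧ SL2Path i (pad u []) k := by
      intro u i hi hu hl
      have h4 : ∀ a : A, SL2Arrow i (some a, none) 4 := by
        rintro a; rcases hi with rfl | rfl | rfl
        exacts [.pad₁ a, .pad₂ a, .pad₃ a]
      match u with
      | [a] => rw [pad, pad]; exact ⟨4, by simp, .cons _ _ _ _ _ (h4 a) (.nil _)⟩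
      | [a, b] => rw [pad, pad, pad]; exact ⟨5, by simp, .cons _ _ _ _ _ (h4 a) (.cons _ _ _ _ _ (.pad₄ b) (.nil _))⟩
      | _ :: _ :: _ :: _ => simp at hl
    have hpath : ∀ u v : List A, ∀ i, (i = 2 ∨ i = 3) → v.length ≤ u.length →
        u.length ≤ v.length + 2 → (i ≠ 2 → v.length < u.length) →
        ∃ k, (k = 2 ∨ k = 4 ∨ k = 5) ∧ SL2Path i (pad u v) k := by
      intro u
      induction u with
      | nil =>
        intro v i hi hl _ h2
        have : v = [] := List.eq_nil_of_length_eq_zero (by simpa using hl)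
        subst this
        have : i = 2 := by by_contra hc; simpa using h2 hc
        subst this
        rw [pad]
        exact ⟨2, by simp, .nil _⟩
      | cons a u ih =>
        intro v i hi h₁ h₂ h₃
        cases v with
        | nil => exact hnil _ i (by omega) (by simp) (by simpa using h₂)
        | cons b v =>
          simp only [List.length_cons] at h₁ h₂ h₃
          obtain ⟨k, hk, hp⟩ := ih v i hi (by omega) (by omega) (by omega)
          rw [pad]
          refine ⟨k, hk, .cons _ i _ _ _ ?_ hp⟩
          rcases hi with rfl | rfl
          exacts [.loop₂ a b, .loop₃ a b]
    match u, v with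
    | [], _ => exact absurd rfl hu
    | a :: u, [] => exact hnil _ 1 (by omega) hu (by simpa using h₂)
    | a :: u, b :: v =>
      obtain ⟨hab, hlt⟩ := h₃ a b rfl rfl
      simp only [List.length_cons] at h₁ h₂ hlt
      rcases lt_or_gt_of_ne hab with h | h
      · have hne : u.length ≠ v.length := fun e => (hlt (by omega)).not_gt h
        obtain ⟨k, hk, hp⟩ := hpath u v 3 (by omega) (by omega) (by omega) (by omega)
        exact ⟨k, hk, by rw [pad]; exact .cons _ _ _ _ _ (.lt a b h) hp⟩
      · obtain ⟨k, hk, hp⟩ := hpath u v 2 (by omega) (by omega) (by omega) (by omega)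
        exact ⟨k, hk, by rw [pad]; exact .cons _ _ _ _ _ (.gt a b h) hp⟩

theorem SL2Accepts.sLex {r : Rule A} (h : SL2Accepts r) : SLex r.2 r.1 := by
  obtain ⟨u, v⟩ := r
  obtain ⟨hu, h₁, -, h₃⟩ := sL2Accepts_iff.1 h
  rw [sLex_iff]
  rcases h₁.lt_or_eq with h | h
  · exact .inl h
  · refine .inr ⟨h, ?_⟩
    match u, v with
    | [], _ => exact absurd rfl hu
    | a :: u, [] => exact .nil
    | a :: u, b :: v => exact .rel ((h₃ a b rfl rfl).2 h.symm)

end SL2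

end WeldKB

namespace WeldKB

variable {A : Type*}

/-! ### Evaluation of strings in a group -/

/-- `φ` evaluates strings in a group in such a way that `inv x` is inverse to `x`. -/
structure IsEval {G : Type*} [Group G] (inv : A → A) (φ : List A → G) : Prop where
  append : ∀ u v, φ (u ++ v) = φ u * φ v
  letter : ∀ x, φ [inv x] = (φ [x])⁻¹

section Eval

variable {G : Type*} [Group G] {inv : A → A} {φ : List A → G}

theorem IsEval.nil (h : IsEval inv φ) : φ [] = 1 := by
  have := h.append [] []
  simpa using this

theorem IsEval.cons (h : IsEval inv φ) (x : A) (w : List A) : φ (x :: w) = φ [x] * φ w :=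
  h.append [x] w

theorem IsEval.formalInv (h : IsEval inv φ) (w : List A) : φ (formalInv inv w) = (φ w)⁻¹ := by
  induction w with
  | nil => simp [WeldKB.formalInv, h.nil]
  | cons x w ih =>
    have : WeldKB.formalInv inv (x :: w) = WeldKB.formalInv inv w ++ [inv x] := by
      simp [WeldKB.formalInv]
    rw [this, h.append, ih, h.letter, h.cons x w, mul_inv_rev]

theorem IsEval.map_toList (h : IsEval inv φ) (o : Option A) :
    φ (o.toList.map inv) = (φ o.toList)⁻¹ := by
  cases o with
  | none => simp [h.nil]
  | some x => simp [h.letter]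

theorem IsEval.context (h : IsEval inv φ) {u v : List A} (huv : φ u = φ v) (s w : List A) :
    φ (s ++ u ++ w) = φ (s ++ v ++ w) := by
  simp only [h.append, huv]

theorem IsEval.cancel (h : IsEval inv φ) (x : A) : φ [x, inv x] = φ [] := by
  rw [h.cons, h.letter, mul_inv_cancel, h.nil]

/-- Cancelling at the two ends is a conjugation, which preserves triviality of the value but not the
value itself. -/
theorem CyclicCancel.eval (h : IsEval inv φ) {w w' : List A} (hw : CyclicCancel inv w w') :
    φ w = 1 ↔ φ w' = 1 := by
  cases hw with
  | inside p q x => rw [h.context (h.cancel x) p q]; simp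
  | ends _ x =>
    simp only [h.append, h.letter]
    constructor
    · intro h1
      have : φ w' = (φ [x])⁻¹ * (φ [x] * φ w' * (φ [x])⁻¹) * φ [x] := by group
      rw [this, h1]; group
    · intro h1; rw [h1]; group

theorem IsCyclicRelator.eval (h : IsEval inv φ) {e : Rule A} {w : List A}
    (hw : IsCyclicRelator inv e w) : φ e.1 = φ e.2 ↔ φ w = 1 := by
  have key : φ (e.1 ++ WeldKB.formalInv inv e.2) = 1 ↔ φ w = 1 := by
    obtain ⟨hw, -⟩ := hw
    induction hw with
    | refl => rfl
    | tail _ h' ih => exact ih.trans (h'.eval h)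
  rw [← key, h.append, h.formalInv, mul_inv_eq_one]

theorem IsInitialRule.eval_of_rule [LinearOrder A] (h : IsEval inv φ) {e r : Rule A}
    (hr : IsInitialRule inv e (some r)) : φ e.1 = φ e.2 ↔ φ r.1 = φ r.2 := by
  rw [hr.1.eval h, h.append, h.formalInv, mul_inv_eq_one]

theorem IsEval.thue (h : IsEval inv φ) {X : Set (Rule A)} (hX : ∀ r ∈ X, φ r.1 = φ r.2)
    {u v : List A} (huv : Thue X u v) : φ u = φ v := by
  induction huv with
  | rel _ _ h' => obtain ⟨r, hr, s, w, rfl, rfl⟩ := h'; exact h.context (hX r hr) s w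
  | refl => rfl
  | symm _ _ _ ih => exact ih.symm
  | trans _ _ _ _ _ ih₁ ih₂ => exact ih₁.trans ih₂

end Eval

theorem Thue.context {X : Set (Rule A)} {u v : List A} (h : Thue X u v) (s w : List A) :
    Thue X (s ++ u ++ w) (s ++ v ++ w) := by
  induction h with
  | rel _ _ h => exact .rel _ _ (h.context s w)
  | refl => exact .refl _
  | symm _ _ _ ih => exact .symm _ _ ih
  | trans _ _ _ _ _ ih₁ ih₂ => exact .trans _ _ _ ih₁ ih₂

theorem Thue.append {X : Set (Rule A)} {u u' v v' : List A} (h : Thue X u u')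
    (h' : Thue X v v') : Thue X (u ++ v) (u' ++ v') := by
  have h₁ := h.context [] v
  have h₂ := h'.context u' []
  simp only [List.nil_append, List.append_nil] at h₁ h₂
  exact .trans _ _ _ h₁ h₂

theorem Thue.of_mem {X : Set (Rule A)} {r : Rule A} (h : r ∈ X) : Thue X r.1 r.2 :=
  .rel _ _ ⟨r, h, [], [], by simp, by simp⟩

/-- The quotient of the strings by a Thue congruence for which the letters are invertible. -/
theorem exists_isEval.{u} {A : Type u} {inv : A → A} (hinv : Function.Involutive inv) (X : Set (Rule A))
    (hX : ∀ x, ([x, inv x], []) ∈ X) :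
    ∃ (G : Type u) (_ : Group G) (φ : List A → G), IsEval inv φ ∧
      ∀ u v, Thue X u v ↔ φ u = φ v := by
  let s : Setoid (List A) := ⟨Thue X, Relation.EqvGen.is_equivalence _⟩
  have hcancel : ∀ w : List A, Thue X (formalInv inv w ++ w) [] := by
    intro w
    induction w with
    | nil => exact .refl _
    | cons x w ih =>
      -- The rule of the letter `inv x`, since `inv` is an involution.
      have h₁ : Thue X [inv x, x] [] := by
        have := Thue.of_mem (hX (inv x))
        rwa [hinv x] at this
      have h₂ := h₁.context (formalInv inv w) w
      simp only [List.append_nil] at h₂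
      refine .trans _ _ _ ?_ (.trans _ _ _ h₂ ih)
      have : formalInv inv (x :: w) ++ x :: w = formalInv inv w ++ [inv x, x] ++ w := by
        simp [formalInv]
      rw [this]
      exact .refl _
  let _ : Mul (Quotient s) := ⟨Quotient.map₂ (· ++ ·) fun _ _ h _ _ h' => Thue.append h h'⟩
  let _ : One (Quotient s) := ⟨Quotient.mk s []⟩
  -- Inverting a chosen representative avoids proving that `formalInv` respects the congruence; the
  -- left group axioms need no more.
  let _ : Inv (Quotient s) := ⟨fun q => Quotient.mk s (formalInv inv q.out)⟩
  have hmul : ∀ u v : List A, Quotient.mk s u * Quotient.mk s v = Quotient.mk s (u ++ v) :=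
    fun _ _ => rfl
  have hone : (1 : Quotient s) = Quotient.mk s [] := rfl
  let _ : Group (Quotient s) := Group.ofLeftAxioms
    (by
      rintro ⟨a⟩ ⟨b⟩ ⟨c⟩
      change Quotient.mk s a * Quotient.mk s b * Quotient.mk s c =
        Quotient.mk s a * (Quotient.mk s b * Quotient.mk s c)
      simp only [hmul, List.append_assoc])
    (by
      rintro ⟨a⟩
      change 1 * Quotient.mk s a = Quotient.mk s a
      rw [hone, hmul, List.nil_append])
    (by
      intro q
      have : Quotient.mk s (formalInv inv q.out) * Quotient.mk s q.out = 1 :=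
        Quotient.sound (hcancel _)
      rwa [Quotient.out_eq] at this)
  refine ⟨Quotient s, inferInstance, Quotient.mk s, ⟨fun _ _ => rfl, fun x => ?_⟩,
    fun u v => (Quotient.eq (r := s)).symm⟩
  refine (inv_eq_of_mul_eq_one_right ?_).symm
  exact Quotient.sound (Thue.of_mem (hX x))

/-! ### Walks -/

theorem isWalk_append {s t : List A} {as bs : List (Arrow A)} :
    IsWalk s (as ++ bs) t ↔ ∃ m, IsWalk s as m ∧ IsWalk m bs t := by
  induction as generalizing s with
  | nil => simp [IsWalk]
  | cons a as ih => simp [IsWalk, ih, and_assoc]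

/-- Rename the ends of an arrow. -/
def Arrow.rename (f : List A → List A) (a : Arrow A) : Arrow A := ⟨f a.src, a.lbl, f a.dst⟩

theorem isWalk_map {s t : List A} {as : List (Arrow A)} (f : List A → List A)
    (h : IsWalk s as t) : IsWalk (f s) (as.map (Arrow.rename f)) (f t) := by
  induction as generalizing s with
  | nil => exact congrArg f h
  | cons a as ih => exact ⟨congrArg f h.1, ih h.2⟩

theorem map_lbl_rename (f : List A → List A) (as : List (Arrow A)) :
    (as.map (Arrow.rename f)).map Arrow.lbl = as.map Arrow.lbl := by
  simp [Arrow.rename]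

/-- The first string of a padded pair. -/
def left (ls : List (Letter A)) : List A := ls.flatMap fun l => l.1.toList

/-- The second string of a padded pair. -/
def right (ls : List (Letter A)) : List A := ls.flatMap fun l => l.2.toList

theorem left_right_pad (u v : List A) : left (pad u v) = u ∧ right (pad u v) = v := by
  induction u generalizing v with
  | nil =>
    induction v with
    | nil => simp [pad, left, right]
    | cons b v ih => simpa [pad, left, right] using ih
  | cons a u ih =>
    cases v with
    | nil => simpa [pad, left, right] using ih []
    | cons b v => simpa [pad, left, right] using ih v

/-! ### Word-differences along arrows and walks -/

section Valid

variable {G : Type*} [Group G] {inv : A → A} {φ : List A → G}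

/-- The label of the target of the arrow is the word-difference which the arrow produces. -/
def Arrow.Valid (φ : List A → G) (a : Arrow A) : Prop :=
  φ a.dst = (φ a.lbl.1.toList)⁻¹ * φ a.src * φ a.lbl.2.toList

theorem IsEval.stepLabel (h : IsEval inv φ) (l : Letter A) (p : List A) :
    φ (stepLabel inv l p) = (φ l.1.toList)⁻¹ * φ p * φ l.2.toList := by
  simp only [WeldKB.stepLabel, h.append, h.map_toList]

/-- The factors telescope along the walk. For a closed walk at `[]` this says that the two strings
read have the same value. -/
theorem IsWalk.eval (h : IsEval inv φ) {s t : List A} {as : List (Arrow A)}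
    (hv : ∀ a ∈ as, a.Valid φ) (hw : IsWalk s as t) :
    φ t = (φ (left (as.map Arrow.lbl)))⁻¹ * φ s * φ (right (as.map Arrow.lbl)) := by
  induction as generalizing s with
  | nil =>
    have : s = t := hw
    simp [left, right, h.nil, this]
  | cons a as ih =>
    have ha : φ a.dst = (φ a.lbl.1.toList)⁻¹ * φ a.src * φ a.lbl.2.toList :=
      hv a List.mem_cons_self
    rw [ih (fun b hb => hv b (List.mem_cons_of_mem _ hb)) hw.2, ha, hw.1]
    simp only [left, right, List.map_cons, List.flatMap_cons, h.append]
    group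

theorem Accepts.eval (h : IsEval inv φ) {M : Finset (Arrow A)} (hM : ∀ a ∈ M, a.Valid φ)
    {r : Rule A} (hr : Accepts M r) : φ r.1 = φ r.2 := by
  obtain ⟨as, hsub, hw, hl⟩ := hr
  have := hw.eval h fun a ha => hM a (hsub a ha)
  rw [hl, (left_right_pad _ _).1, (left_right_pad _ _).2, h.nil, mul_one] at this
  exact (inv_mul_eq_one.1 this.symm)

/-- In a group a valid arrow's letter and either end determine the value of the other end, and a
letter `(x, x)` takes the value 1 to 1 in both directions. So each clause of welding identifies
states of equal value only. -/
theorem WeldRel.eval (h : IsEval inv φ) {M : Finset (Arrow A)} (hM : ∀ a ∈ M, a.Valid φ)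
    {p q s t : List A} (hpq : φ p = φ q) (hst : WeldRel M p q s t) : φ s = φ t := by
  induction hst with
  | refl => rfl
  | symm _ _ _ ih => exact ih.symm
  | trans _ _ _ _ _ ih₁ ih₂ => exact ih₁.trans ih₂
  | join => exact hpq
  | forward a b ha hb hl _ ih =>
    have h₁ := hM a ha
    have h₂ := hM b hb
    unfold Arrow.Valid at h₁ h₂
    rw [h₁, h₂, hl, ih]
  | backward a b ha hb hl _ ih =>
    have h₁ := hM a ha
    have h₂ := hM b hb
    unfold Arrow.Valid at h₁ h₂
    rw [h₁, h₂, hl] at ih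
    exact mul_left_cancel (mul_right_cancel ih)
  | diagOut a ha hl _ ih =>
    have h₁ := hM a ha
    unfold Arrow.Valid at h₁
    rw [h₁, hl, ih, h.nil]; group
  | diagIn a ha hl _ ih =>
    have h₁ := hM a ha
    unfold Arrow.Valid at h₁
    rw [h₁, hl, h.nil] at ih
    have : φ a.src = φ a.lbl.2.toList *
      ((φ a.lbl.2.toList)⁻¹ * φ a.src * φ a.lbl.2.toList) * (φ a.lbl.2.toList)⁻¹ := by group
    rw [this, ih, h.nil]; group

/-- Inner arrows are valid by construction. The last one is made to end at `[]` whatever its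
word-difference; `hp` makes that difference trivial. -/
theorem pathFrom_valid [DecidableEq A] (h : IsEval inv φ) (ls : List (Letter A)) (p : List A)
    (hp : (φ (left ls))⁻¹ * φ p * φ (right ls) = 1) :
    ∀ a ∈ pathFrom inv p ls, a.Valid φ := by
  induction ls generalizing p with
  | nil => simp [pathFrom]
  | cons l ls ih =>
    cases ls with
    | nil =>
      simp only [pathFrom, Finset.mem_singleton, forall_eq, Arrow.Valid, h.nil]
      simpa [left, right] using hp.symm
    | cons l' ls =>
      simp only [pathFrom, Finset.mem_insert, forall_eq_or_imp]
      refine ⟨h.stepLabel l p, ih _ ?_⟩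
      rw [h.stepLabel, ← hp]
      simp only [left, right, List.flatMap_cons, h.append]
      group

theorem ruleAutomaton_valid [DecidableEq A] (h : IsEval inv φ) {r : Rule A}
    (hr : φ r.1 = φ r.2) : ∀ a ∈ ruleAutomaton inv r, a.Valid φ := by
  refine pathFrom_valid h _ _ ?_
  rw [(left_right_pad _ _).1, (left_right_pad _ _).2, h.nil, hr]
  group

end Valid

/-! ### Welding -/

section Weld

variable [Fintype A] [LinearOrder A]

theorem weldRel_weldRep (M : Finset (Arrow A)) (p q s : List A) :
    WeldRel M p q s (weldRep M p q s) :=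
  SLex.wf.min_mem {t | WeldRel M p q s t} ⟨s, WeldRel.refl s⟩

theorem weldRep_eq {M : Finset (Arrow A)} {p q s t : List A} (h : WeldRel M p q s t) :
    weldRep M p q s = weldRep M p q t := by
  have : {x | WeldRel M p q s x} = {x | WeldRel M p q t x} := by
    ext x
    exact ⟨fun hx => .trans _ _ _ (.symm _ _ h) hx, fun hx => .trans _ _ _ h hx⟩
  simp only [weldRep, this]

/-- The empty string is the shortlex-least label, so the class of the initial state always keeps it.
-/
theorem weldRep_eq_nil {M : Finset (Arrow A)} {p q s : List A} :
    weldRep M p q s = [] ↔ WeldRel M p q s [] := by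
  constructor
  · intro h
    have := weldRel_weldRep M p q s
    rwa [h] at this
  · intro h
    rcases List.shortlex_nil_or_eq_nil (r := fun a b : A => a < b) (weldRep M p q s) with h' | h'
    · exact absurd h' (SLex.wf.not_lt_min {t | WeldRel M p q s t} h)
    · exact h'

theorem weldRep_nil (M : Finset (Arrow A)) (p q : List A) : weldRep M p q [] = [] :=
  weldRep_eq_nil.2 (.refl _)

theorem mem_mapStates {f : List A → List A} {M : Finset (Arrow A)} {b : Arrow A} :
    b ∈ mapStates f M ↔ ∃ a ∈ M, a.rename f = b := by
  simp [mapStates, Arrow.rename]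

/-- No arrow labelled `(x, x)` begins or ends at the initial state. -/
def NoDiag (M : Finset (Arrow A)) : Prop :=
  ∀ a ∈ M, a.lbl.1 = a.lbl.2 → a.src ≠ [] ∧ a.dst ≠ []

/-- Welding has turned each such arrow into a loop at the initial state, and these loops are
dropped. -/
theorem weld_noDiag (W : WDiff A) (p q : List A) : NoDiag (weld W p q).arrows := by
  intro b hb hl
  simp only [weld, dropLoops, Finset.mem_filter, mem_mapStates] at hb
  obtain ⟨⟨a, ha, rfl⟩, hn⟩ := hb
  simp only [Arrow.rename] at hl hn ⊢
  refine ⟨fun h => hn ⟨h, ?_, hl⟩, fun h => hn ⟨?_, h, hl⟩⟩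
  · exact weldRep_eq_nil.2 (.diagOut a ha hl (weldRep_eq_nil.1 h))
  · exact weldRep_eq_nil.2 (.diagIn a ha hl (weldRep_eq_nil.1 h))

theorem mapStates_mono {f : List A → List A} {M N : Finset (Arrow A)} (h : M ⊆ N) :
    mapStates f M ⊆ mapStates f N :=
  Finset.image_subset_image h

theorem weld_needed_subset {W : WDiff A} (h : W.needed ⊆ W.arrows) (p q : List A) :
    (weld W p q).needed ⊆ (weld W p q).arrows :=
  Finset.filter_subset_filter _ (mapStates_mono h)

theorem mapStates_valid {G : Type*} [Group G] {φ : List A → G} {f : List A → List A}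
    (hf : ∀ s, φ (f s) = φ s) {M : Finset (Arrow A)} (hM : ∀ a ∈ M, a.Valid φ) :
    ∀ a ∈ mapStates f M, a.Valid φ := by
  intro b hb
  obtain ⟨a, ha, rfl⟩ := mem_mapStates.1 hb
  have := hM a ha
  simp only [Arrow.Valid, Arrow.rename, hf] at this ⊢
  exact this

theorem weld_valid {G : Type*} [Group G] {inv : A → A} {φ : List A → G} (h : IsEval inv φ)
    {W : WDiff A} (hW : ∀ a ∈ W.arrows, a.Valid φ) {p q : List A} (hpq : φ p = φ q) :
    ∀ a ∈ (weld W p q).arrows, a.Valid φ := fun a ha =>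
  mapStates_valid (fun s => ((weldRel_weldRep W.arrows p q s).eval h hW hpq).symm) hW a
    (Finset.filter_subset _ _ ha)

/-! ### Traces -/

/-- `M`, together with all loops labelled `(x, x)` at the initial state, accepts `ls`. -/
def Traces (M : Finset (Arrow A)) (ls : List (Letter A)) : Prop :=
  ∃ as : List (Arrow A), (∀ a ∈ as, a ∈ M ∨ (a.src = [] ∧ a.dst = [] ∧ a.lbl.1 = a.lbl.2)) ∧
    IsWalk [] as [] ∧ as.map Arrow.lbl = ls

theorem Traces.mono {M N : Finset (Arrow A)} {ls : List (Letter A)} (h : Traces M ls)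
    (hMN : M ⊆ N) : Traces N ls := by
  obtain ⟨as, h₁, h₂⟩ := h
  exact ⟨as, fun a ha => (h₁ a ha).imp_left fun h => hMN h, h₂⟩

theorem Traces.mapStates {M : Finset (Arrow A)} {ls : List (Letter A)} (h : Traces M ls)
    {f : List A → List A} (hf : f [] = []) : Traces (mapStates f M) ls := by
  obtain ⟨as, h₁, h₂, h₃⟩ := h
  refine ⟨as.map (Arrow.rename f), ?_, ?_, (map_lbl_rename f as).trans h₃⟩
  · intro b hb
    obtain ⟨a, ha, rfl⟩ := List.mem_map.1 hb
    rcases h₁ a ha with h | ⟨h, h', h''⟩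
    · exact .inl (mem_mapStates.2 ⟨a, h, rfl⟩)
    · exact .inr ⟨by simp [Arrow.rename, h, hf], by simp [Arrow.rename, h', hf], h''⟩
  · have := isWalk_map f h₂
    rwa [hf] at this

theorem Traces.dropLoops {M : Finset (Arrow A)} {ls : List (Letter A)} (h : Traces M ls) :
    Traces (dropLoops M) ls := by
  obtain ⟨as, h₁, h₂⟩ := h
  refine ⟨as, fun a ha => ?_, h₂⟩
  rcases h₁ a ha with h | h
  · by_cases hl : a.src = [] ∧ a.dst = [] ∧ a.lbl.1 = a.lbl.2
    · exact .inr hl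
    · exact .inl (Finset.mem_filter.2 ⟨h, hl⟩)
  · exact .inr h

/-- Acceptance itself may be lost in welding, because the image of a path can run through a dropped
loop; being traced survives. It is stated for needed arrows, which are the ones handed on to the
next `Rules`. -/
theorem Traces.weld {W : WDiff A} {ls : List (Letter A)} (h : Traces W.needed ls)
    (p q : List A) : Traces (weld W p q).needed ls :=
  (h.mapStates (weldRep_nil _ _ _)).dropLoops

/-- Joining the ends of two half-paths produces a path. -/
theorem traces_weld_of_halves {W : WDiff A} {as bs : List (Arrow A)} {e t : List A}
    (has : ∀ a ∈ as, a ∈ W.needed) (hbs : ∀ a ∈ bs, a ∈ W.needed)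
    (h₁ : IsWalk [] as e) (h₂ : IsWalk t bs []) :
    Traces (weld W e t).needed ((as ++ bs).map Arrow.lbl) := by
  refine Traces.dropLoops ⟨(as ++ bs).map (Arrow.rename (weldRep W.arrows e t)), ?_, ?_,
    map_lbl_rename _ _⟩
  · intro b hb
    obtain ⟨a, ha, rfl⟩ := List.mem_map.1 hb
    rw [List.mem_append] at ha
    exact .inl (mem_mapStates.2 ⟨a, ha.elim (has a) (hbs a), rfl⟩)
  · have h₁' := isWalk_map (weldRep W.arrows e t) h₁
    have h₂' := isWalk_map (weldRep W.arrows e t) h₂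
    rw [weldRep_nil] at h₁' h₂'
    rw [weldRep_eq (WeldRel.join (M := W.arrows) (p := e) (q := t))] at h₁'
    rw [List.map_append]
    exact isWalk_append.2 ⟨_, h₁', h₂'⟩

/-- A padded pair never contains the letter with two padding symbols, so a diagonal letter is a
genuine `(x, x)`. No padding precedes it, whence the equal lengths of `u₁` and `v₁`. -/
theorem pad_eq_append_cons {u v : List A} {ls ls' : List (Letter A)} {l : Letter A}
    (h : pad u v = ls ++ l :: ls') (hl : l.1 = l.2) :
    ∃ u₁ v₁ x u₂ v₂, u = u₁ ++ x :: u₂ ∧ v = v₁ ++ x :: v₂ ∧ u₁.length = v₁.length ∧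
      ls = pad u₁ v₁ ∧ ls' = pad u₂ v₂ := by
  induction ls generalizing u v with
  | nil =>
    match u, v with
    | [], [] => simp [pad] at h
    | a :: u, [] =>
      simp only [pad, List.nil_append, List.cons.injEq] at h
      rw [← h.1] at hl; simp at hl
    | [], b :: v =>
      simp only [pad, List.nil_append, List.cons.injEq] at h
      rw [← h.1] at hl; simp at hl
    | a :: u, b :: v =>
      simp only [pad, List.nil_append, List.cons.injEq] at h
      rw [← h.1] at hl
      simp only [Option.some.injEq] at hl
      subst hl
      exact ⟨[], [], a, u, v, rfl, rfl, rfl, by simp [pad], h.2.symm⟩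
  | cons k ls ih =>
    match u, v with
    | [], [] => simp [pad] at h
    | a :: u, [] =>
      simp only [pad, List.cons_append, List.cons.injEq] at h
      obtain ⟨u₁, v₁, x, u₂, v₂, -, h', -⟩ := ih h.2
      simp at h'
    | [], b :: v =>
      simp only [pad, List.cons_append, List.cons.injEq] at h
      obtain ⟨u₁, v₁, x, u₂, v₂, h', -⟩ := ih h.2
      simp at h'
    | a :: u, b :: v =>
      simp only [pad, List.cons_append, List.cons.injEq] at h
      obtain ⟨u₁, v₁, x, u₂, v₂, rfl, rfl, hl', rfl, rfl⟩ := ih h.2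
      exact ⟨a :: u₁, b :: v₁, x, u₂, v₂, rfl, rfl, by simp [hl'], by simp [pad, ← h.1], rfl⟩

theorem exists_first_not_mem {α : Type*} (P : α → Prop) (as : List α) :
    (∀ a ∈ as, P a) ∨ ∃ bs b cs, as = bs ++ b :: cs ∧ (∀ a ∈ bs, P a) ∧ ¬ P b := by
  induction as with
  | nil => simp
  | cons a as ih =>
    by_cases ha : P a
    · rcases ih with h | ⟨bs, b, cs, rfl, h, hb⟩
      · exact .inl (by simpa [ha] using h)
      · exact .inr ⟨a :: bs, b, cs, rfl, by simpa [ha] using h, hb⟩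
    · exact .inr ⟨[], a, as, rfl, by simp, ha⟩

/-- The first arrow leaves the initial state and so cannot be diagonal; this supplies the clause of
`SL2` about first letters. -/
theorem NoDiag.head_ne {M : Finset (Arrow A)} (hM : NoDiag M) {as : List (Arrow A)} {t : List A}
    (has : ∀ a ∈ as, a ∈ M) (hw : IsWalk [] as t) {u v : List A}
    (hl : as.map Arrow.lbl = pad u v) {a b : A} (hu : u.head? = some a)
    (hv : v.head? = some b) : a ≠ b := by
  rintro rfl
  obtain ⟨u, rfl⟩ : ∃ u', u = a :: u' := by cases u <;> simp_all
  obtain ⟨v, rfl⟩ : ∃ v', v = a :: v' := by cases v <;> simp_all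
  cases as with
  | nil => simp [pad] at hl
  | cons c as =>
    simp only [pad, List.map_cons, List.cons.injEq] at hl
    exact (hM c (has c List.mem_cons_self) (by rw [hl.1])).1 hw.1

/-- If a rule is traced, its left-hand side contains a left-hand side of an accepted rule. -/
theorem Traces.reducible_of_length {M : Finset (Arrow A)} (hM : NoDiag M) {u v : List A}
    (h : Traces M (pad u v)) (hlt : v.length < u.length) (hle : u.length ≤ v.length + 2) :
    Reducible (setOfRules M) u := by
  induction hn : u.length using Nat.strong_induction_on generalizing u v with
  | _ n ih =>
  subst hn
  obtain ⟨as, h₁, h₂, h₃⟩ := h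
  rcases exists_first_not_mem (· ∈ M) as with has | ⟨bs, b, cs, rfl, hbs, hb⟩
  · refine reducible_iff.2 ⟨(u, v), ⟨⟨as, has, h₂, h₃⟩, ?_⟩, List.infix_refl u⟩
    refine sL2Accepts_iff.2 ⟨fun hu => by simp [hu] at hlt, hlt.le, hle, fun a b ha hb => ?_⟩
    exact ⟨hM.head_ne has h₂ h₃ ha hb, fun h => absurd h hlt.ne'⟩
  · obtain ⟨hs, hd, hl⟩ := (h₁ b (by simp)).resolve_left hb
    rw [List.map_append, List.map_cons] at h₃
    obtain ⟨u₁, v₁, x, u₂, v₂, rfl, rfl, hlen, -, hls'⟩ := pad_eq_append_cons h₃.symm hl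
    obtain ⟨m, -, -, hw⟩ := isWalk_append.1 h₂
    rw [hd] at hw
    simp only [List.length_append, List.length_cons] at hlt hle ih
    -- What precedes the end of the loop has equal length on both sides, so the remainder keeps the
    -- length difference, and it is again read from the initial state.
    refine (ih u₂.length (by omega) (u := u₂) (v := v₂)
      ⟨cs, fun a ha => h₁ a (by simp [ha]), hw, hls'⟩ (by omega) (by omega) rfl).infix ?_
    exact ⟨u₁ ++ [x], [], by simp⟩

/-- Dropped loops are read at returns to the initial state, so the segments between them are read by
closed paths of `M`. If `u` is longer, the last segment is an accepted rule; for equal lengths it is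
the first one, which inherits the greater first letter of `u`. -/
theorem Traces.reducible {M : Finset (Arrow A)} (hM : NoDiag M) {u v : List A}
    (h : Traces M (pad u v)) (hSL : SL2Accepts (u, v)) : Reducible (setOfRules M) u := by
  obtain ⟨hu, hle, hle', hhead⟩ := sL2Accepts_iff.1 hSL
  rcases hle.lt_or_eq with hlt | heq
  · exact h.reducible_of_length hM hlt hle'
  obtain ⟨as, h₁, h₂, h₃⟩ := h
  rcases exists_first_not_mem (· ∈ M) as with has | ⟨bs, b, cs, rfl, hbs, hb⟩
  · exact reducible_iff.2 ⟨(u, v), ⟨⟨as, has, h₂, h₃⟩, hSL⟩, List.infix_refl u⟩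
  · obtain ⟨hs, hd, hl⟩ := (h₁ b (by simp)).resolve_left hb
    rw [List.map_append, List.map_cons] at h₃
    obtain ⟨u₁, v₁, x, u₂, v₂, rfl, rfl, hlen, hls, -⟩ := pad_eq_append_cons h₃.symm hl
    obtain ⟨m, hw, hm, -⟩ := isWalk_append.1 h₂
    rw [← hm, hs] at hw
    refine reducible_iff.2 ⟨(u₁, v₁), ⟨⟨bs, hbs, hw, hls⟩, ?_⟩, [], x :: u₂, rfl⟩
    refine sL2Accepts_iff.2 ⟨?_, hlen.ge, by omega, fun a c ha hc => ?_⟩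
    -- An empty first segment would mean that `u` and `v` both begin with the letter of the loop.
    · rintro rfl
      have : v₁ = [] := List.eq_nil_of_length_eq_zero (by simpa using hlen.symm)
      subst this
      exact (hhead x x rfl rfl).1 rfl
    · have := hhead a c (by rw [List.head?_append, ha]; rfl) (by rw [List.head?_append, hc]; rfl)
      exact ⟨this.1, fun _ => this.2 heq.symm⟩

end Weld

end WeldKB

namespace WeldKB

variable {A : Type*} [Fintype A] [LinearOrder A]

/-! ### Invariants of configurations -/

section Core

variable {G : Type*} [Group G] {inv : A → A} {φ : List A → G}

/-- The invariants of the data kept by the procedure. -/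
structure Core (φ : List A → G) (C T N D : Finset (Rule A)) (M : Finset (Arrow A))
    (W : WDiff A) : Prop where
  disj_considered : ∀ r ∈ C, r ∉ T ∧ r ∉ N ∧ r ∉ D
  disj_this : ∀ r ∈ T, r ∉ N ∧ r ∉ D
  disj_new : ∀ r ∈ N, r ∉ D
  ordered : ∀ r ∈ C ∪ T ∪ N ∪ D, rank r.2 < rank r.1
  sound : ∀ r ∈ C ∪ T ∪ N ∪ D, φ r.1 = φ r.2
  rules_valid : ∀ a ∈ M, a.Valid φ
  rules_noDiag : NoDiag M
  arrows_valid : ∀ a ∈ W.arrows, a.Valid φ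
  arrows_noDiag : NoDiag W.arrows
  needed_subset : W.needed ⊆ W.arrows

/-- The data of the configuration `c` satisfy the invariants. -/
abbrev Config.Core (φ : List A → G) (c : Config A) : Prop :=
  WeldKB.Core φ c.considered c.thisRules c.newRules c.deleteRules c.rules c.wdiff

theorem store_addNew (c : Config A) (r : Rule A) : (c.addNew r).store = insert r c.store := by
  unfold Config.addNew
  split_ifs with h
  · exact (Finset.insert_eq_of_mem h).symm
  · ext x; simp [Config.store]

theorem addNew_eq (c : Config A) (r : Rule A) :
    c.addNew r = { c with newRules := (c.addNew r).newRules } := by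
  unfold Config.addNew
  split_ifs <;> rfl

theorem mem_newRules_addNew {c : Config A} {r s : Rule A} :
    s ∈ (c.addNew r).newRules ↔ s ∈ c.newRules ∨ (s = r ∧ r ∉ c.store) := by
  unfold Config.addNew
  split_ifs with h <;> simp [h, or_comm]

theorem rules_addNew (c : Config A) (r : Rule A) : (c.addNew r).rules = c.rules := by
  rw [addNew_eq]

theorem Config.Core.addNew {c : Config A} (h : c.Core φ) {r : Rule A}
    (hr : rank r.2 < rank r.1) (hφ : φ r.1 = φ r.2) : (c.addNew r).Core φ := by
  unfold Config.addNew
  split_ifs with hs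
  · exact h
  · simp only [Config.store, Finset.mem_union, not_or] at hs
    refine { h with disj_considered := ?_, disj_this := ?_, disj_new := ?_, ordered := ?_, sound := ?_ }
    · intro s hs'
      have := h.disj_considered s hs'
      refine ⟨this.1, ?_, this.2.2⟩
      simp only [Finset.mem_insert, not_or]
      exact ⟨by rintro rfl; exact hs.1.1.1 hs', this.2.1⟩
    · intro s hs'
      have := h.disj_this s hs'
      refine ⟨?_, this.2⟩
      simp only [Finset.mem_insert, not_or]
      exact ⟨by rintro rfl; exact hs.1.1.2 hs', this.1⟩
    · intro s hs'
      rcases Finset.mem_insert.1 hs' with rfl | hs'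
      · exact hs.2
      · exact h.disj_new s hs'
    · intro s hs'
      by_cases hsr : s = r
      · exact hsr ▸ hr
      · exact h.ordered s (by simpa [hsr] using hs')
    · intro s hs'
      by_cases hsr : s = r
      · exact hsr ▸ hφ
      · exact h.sound s (by simpa [hsr] using hs')

/-! ### Rapid reduction -/

theorem setOfRules_sound (h : IsEval inv φ) {M : Finset (Arrow A)} (hM : ∀ a ∈ M, a.Valid φ)
    {r : Rule A} (hr : r ∈ setOfRules M) : φ r.1 = φ r.2 ∧ rank r.2 < rank r.1 :=
  ⟨hr.1.eval h hM, rank_lt_of_sLex hr.2.sLex⟩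

/-- The rule used in a step of rapid reduction. -/
theorem RStep.exists_rule (he : IsEval inv φ) {c c' : Config A} (hc : c.Core φ) {w w' : List A}
    (h : RStep (c, w) (c', w')) :
    ∃ (r : Rule A) (p q : List A), w = p ++ r.1 ++ q ∧ w' = p ++ r.2 ++ q ∧ c' = c.addNew r ∧
      rank r.2 < rank r.1 ∧ φ r.1 = φ r.2 ∧ ∀ x, x <:+: r.1 → x ≠ r.1 → ¬ RReducible c x := by
  obtain ⟨p, l, q, ρ, hw, ⟨hl, hpre, hsuf⟩, hρ, heq⟩ := h
  simp only [Prod.mk.injEq] at heq hw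
  refine ⟨(l, ρ), p, q, hw, heq.2, heq.1, ?_⟩
  have key : φ l = φ ρ ∧ rank ρ < rank l := by
    rcases hρ with ⟨-, hρ⟩ | ⟨-, hρ⟩
    · exact ⟨hc.sound _ hρ.1, hc.ordered _ hρ.1⟩
    · exact setOfRules_sound he hc.rules_valid hρ.1
  refine ⟨key.2, key.1, fun x hx hne hred => ?_⟩
  obtain ⟨r, hr, s, t, hx'⟩ := reducible_iff.1 hred
  obtain ⟨s', t', hl'⟩ := hx
  change _ = l at hl'
  rw [← hx'] at hl'
  -- A smaller left-hand side inside `l` either is a suffix of `l`, against the choice of `l` as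
  -- shortest suffix, or ends earlier, against the choice of `p ++ l` as shortest reducible prefix.
  rcases List.eq_nil_or_concat (t ++ t') with ht | ⟨t'', y, ht⟩
  · obtain ⟨rfl, rfl⟩ := List.append_eq_nil_iff.1 ht
    simp only [List.append_nil] at hl' hx'
    have hrl : r.1 ≠ l := by
      rintro rfl
      have : (s' ++ (s ++ r.1)).length = r.1.length := by rw [hl']
      simp only [List.length_append] at this
      have hs : s = [] := List.eq_nil_of_length_eq_zero (by omega)
      subst hs
      exact hne hx'.symm
    exact hsuf r.1 ⟨s' ++ s, by rw [← hl']; simp⟩ hrl ⟨r.2, hr⟩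
  · refine hpre (p ++ (s' ++ (s ++ r.1)) ++ t'') ⟨[y], ?_⟩ ?_
      (reducible_iff.2 ⟨r, hr, p ++ s' ++ s, t'', by simp⟩)
    · rw [List.concat_eq_append] at ht
      rw [← hl']
      simp only [List.append_assoc, ht]
    · rw [← hl']
      intro heq
      have := congrArg List.length heq
      have h2 := congrArg List.length ht
      simp only [List.length_append, List.concat_eq_append, List.length_cons,
        List.length_nil] at this h2
      omega

theorem RStep.core (he : IsEval inv φ) {c c' : Config A} (hc : c.Core φ) {w w' : List A}
    (h : RStep (c, w) (c', w')) : c'.Core φ := by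
  obtain ⟨r, p, q, -, -, rfl, hr, hφ, -⟩ := h.exists_rule he hc
  exact hc.addNew hr hφ

theorem RStep.eval (he : IsEval inv φ) {c c' : Config A} (hc : c.Core φ) {w w' : List A}
    (h : RStep (c, w) (c', w')) : φ w = φ w' ∧ rank w' < rank w ∧ c'.rules = c.rules := by
  obtain ⟨r, p, q, rfl, rfl, rfl, hr, hφ, -⟩ := h.exists_rule he hc
  exact ⟨he.context hφ p q, rank_append_lt hr p q, rules_addNew _ _⟩

theorem RReducesTo.steps_eval (he : IsEval inv φ) {x y : Config A × List A} (hc : x.1.Core φ)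
    (h : Relation.ReflTransGen RStep x y) :
    y.1.Core φ ∧ φ x.2 = φ y.2 ∧ rank y.2 ≤ rank x.2 ∧ y.1.rules = x.1.rules := by
  induction h with
  | refl => exact ⟨hc, rfl, le_rfl, rfl⟩
  | tail _ h ih =>
    have := h.eval he ih.1
    exact ⟨h.core he ih.1, ih.2.1.trans this.1, this.2.1.le.trans ih.2.2.1,
      this.2.2.trans ih.2.2.2⟩

theorem RReducesTo.eval (he : IsEval inv φ) {c : Config A} (hc : c.Core φ) {u v : List A}
    (h : RReducesTo c u v) : φ u = φ v ∧ rank v ≤ rank u ∧ ¬ RReducible c v := by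
  obtain ⟨c', h, hv⟩ := h
  have := RReducesTo.steps_eval he (x := (c, u)) hc h
  refine ⟨this.2.1, this.2.2.1, ?_⟩
  unfold RReducible at hv
  rwa [this.2.2.2] at hv

/-- Needed so that relabelling leaves the initial state in place. -/
theorem RReducesTo.nil (he : IsEval inv φ) {c : Config A} (hc : c.Core φ) {v : List A}
    (h : RReducesTo c [] v) : v = [] :=
  List.eq_nil_of_length_eq_zero (by simpa using length_le_of_rank (h.eval he hc).2.1)

theorem exists_rStep {c : Config A} {w : List A} (h : RReducible c w) : ∃ y, RStep (c, w) y := by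
  obtain ⟨r, hr, s, t, rfl⟩ := reducible_iff.1 h
  have hP : ∃ n, ∃ x, x <+: s ++ r.1 ++ t ∧ RReducible c x ∧ x.length = n :=
    ⟨_, _, List.prefix_refl _, h, rfl⟩
  classical
  obtain ⟨x, hxp, hx, hxn⟩ := Nat.find_spec hP
  have hxmin : ∀ y, y <+: x → y ≠ x → ¬ RReducible c y := by
    intro y hy hne hred
    refine Nat.find_min hP (m := y.length) ?_ ⟨y, hy.trans hxp, hred, rfl⟩
    rw [← hxn]
    exact lt_of_le_of_ne hy.length_le fun e => hne (hy.eq_of_length e)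
  have hQ : ∃ n, ∃ l, l <:+ x ∧ IsLhs c l ∧ l.length = n := by
    obtain ⟨r', hr', s', t', rfl⟩ := reducible_iff.1 hx
    rcases List.eq_nil_or_concat t' with rfl | ⟨t', a, rfl⟩
    · exact ⟨_, r'.1, ⟨s', by simp⟩, ⟨r'.2, hr'⟩, rfl⟩
    -- A left-hand side ending before the end of `x` would make a shorter prefix reducible.
    · exfalso
      refine hxmin (s' ++ r'.1 ++ t') ⟨[a], by simp⟩ (by simp) ?_
      exact reducible_iff.2 ⟨r', hr', s', t', rfl⟩
  obtain ⟨l, ⟨p, hpl⟩, hl, hln⟩ := Nat.find_spec hQ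
  obtain ⟨q, hq⟩ := hxp
  have hρ : ∃ ρ, IsRhs c l ρ := by
    by_cases hs : ∃ ρ', (l, ρ') ∈ c.store
    · obtain ⟨ρ, hρ⟩ := exists_isSLexLeast hs
      exact ⟨ρ, .inl ⟨hs, hρ⟩⟩
    · obtain ⟨ρ, hρ⟩ := exists_isSLexLeast hl
      exact ⟨ρ, .inr ⟨hs, hρ⟩⟩
  obtain ⟨ρ, hρ⟩ := hρ
  refine ⟨_, p, l, q, ρ, by rw [hpl, hq], ⟨hl, by rwa [hpl], fun y hy hne hy' => ?_⟩, hρ, rfl⟩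
  refine Nat.find_min hQ (m := y.length) ?_ ⟨y, hy.trans ⟨p, hpl⟩, hy', rfl⟩
  rw [← hln]
  exact lt_of_le_of_ne hy.length_le fun e => hne (hy.eq_of_length e)

theorem exists_rReducesTo (he : IsEval inv φ) {c : Config A} (hc : c.Core φ) (u : List A) :
    ∃ v, RReducesTo c u v := by
  induction hn : rank u using Nat.strong_induction_on generalizing c u with
  | _ n ih =>
  subst hn
  by_cases h : RReducible c u
  · obtain ⟨⟨c', w⟩, hs⟩ := exists_rStep h
    obtain ⟨v, c'', hv, hirr⟩ := ih _ (hs.eval he hc).2.1 (hs.core he hc) w rfl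
    exact ⟨v, c'', .head hs hv, hirr⟩
  · exact ⟨u, c, .refl, h⟩

/-! ### Sewing and relabelling -/

/-- The invariants of the automaton `WDiff`. -/
structure WDiff.Good (φ : List A → G) (W : WDiff A) : Prop where
  valid : ∀ a ∈ W.arrows, a.Valid φ
  noDiag : NoDiag W.arrows
  needed_subset : W.needed ⊆ W.arrows

theorem WDiff.good_weld (he : IsEval inv φ) {W : WDiff A} (hv : ∀ a ∈ W.arrows, a.Valid φ)
    (hs : W.needed ⊆ W.arrows) {p q : List A} (hpq : φ p = φ q) : (weld W p q).Good φ :=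
  ⟨weld_valid he hv hpq, weld_noDiag W p q, weld_needed_subset hs p q⟩

theorem Config.Core.good {c : Config A} (h : c.Core φ) : c.wdiff.Good φ :=
  ⟨h.arrows_valid, h.arrows_noDiag, h.needed_subset⟩

theorem Core.of_good {C T N D : Finset (Rule A)} {M : Finset (Arrow A)} {W W' : WDiff A}
    (h : Core φ C T N D M W) (hW : W'.Good φ) : Core φ C T N D M W' :=
  { h with arrows_valid := hW.valid, arrows_noDiag := hW.noDiag, needed_subset := hW.needed_subset }

/-- The states `e` and `t` carry the word-differences computed from the left and from the right.
They have the same value because `r` holds in the group, so joining them is sound; the joined paths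
then trace `r`. -/
theorem Sew.good (he : IsEval inv φ) {c : Config A} (hc : c.Core φ) {r : Rule A}
    (hr : φ r.1 = φ r.2) {W : WDiff A} (h : Sew inv c r W) :
    W.Good φ ∧ Traces W.needed (pad r.1 r.2) ∧
      ∀ ls, Traces c.wdiff.needed ls → Traces W.needed ls := by
  obtain ⟨f, m, b, s, e, t, hl, hf, hfw, -, hb, hbw, -, hmw, hm, rfl⟩ := h
  have hfv : ∀ a ∈ f, a.Valid φ := fun a ha => hc.arrows_valid a (hf a ha)
  have hbv : ∀ a ∈ b, a.Valid φ := fun a ha => hc.arrows_valid a (hb a ha)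
  have hmv : ∀ a ∈ m, a.Valid φ := by
    intro a ha
    have := ((hm a ha).eval he hc).1
    rw [he.stepLabel] at this
    exact this.symm
  have hfm : IsWalk [] (f ++ m) e := isWalk_append.2 ⟨s, hfw, hmw⟩
  have h₁ := hfm.eval he (fun a ha => (List.mem_append.1 ha).elim (hfv a) (hmv a))
  have h₂ := hbw.eval he hbv
  have hlr := left_right_pad r.1 r.2
  rw [← hl, List.map_append] at hlr
  have hle : left ((f ++ m).map Arrow.lbl) ++ left (b.map Arrow.lbl) = r.1 := by
    rw [← hlr.1]; simp [left]
  have hre : right ((f ++ m).map Arrow.lbl) ++ right (b.map Arrow.lbl) = r.2 := by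
    rw [← hlr.2]; simp [right]
  rw [← hle, ← hre, he.append, he.append] at hr
  have het : φ e = φ t := by
    rw [he.nil] at h₁ h₂
    have h₃ : φ t = φ (left (b.map Arrow.lbl)) * (φ (right (b.map Arrow.lbl)))⁻¹ := by
      have : φ t = φ (left (b.map Arrow.lbl)) *
        ((φ (left (b.map Arrow.lbl)))⁻¹ * φ t * φ (right (b.map Arrow.lbl))) *
        (φ (right (b.map Arrow.lbl)))⁻¹ := by group
      rw [this, ← h₂]; group
    have h₄ : φ (right ((f ++ m).map Arrow.lbl)) = φ (left ((f ++ m).map Arrow.lbl)) *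
        φ (left (b.map Arrow.lbl)) * (φ (right (b.map Arrow.lbl)))⁻¹ := by
      rw [hr]; group
    rw [h₁, h₃, h₄]; group
  have hsub : ∀ a ∈ f ++ m ++ b,
      a ∈ c.wdiff.needed ∪ (f ++ m ++ b).toFinset := fun a ha =>
    Finset.mem_union_right _ (List.mem_toFinset.2 ha)
  refine ⟨WDiff.good_weld he ?_ (Finset.union_subset_union_left hc.needed_subset) het, ?_, ?_⟩
  · intro a ha
    rcases Finset.mem_union.1 ha with ha | ha
    · exact hc.arrows_valid a ha
    · rw [List.mem_toFinset, List.mem_append, List.mem_append] at ha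
      exact ha.elim (fun h => h.elim (hfv a) (hmv a)) (hbv a)
  · rw [← hl]
    exact traces_weld_of_halves (fun a ha => hsub a (List.mem_append_left _ ha))
      (fun a ha => hsub a (List.mem_append_right _ ha)) hfm hbw
  · exact fun ls hls => (hls.mono Finset.subset_union_left).weld _ _

/-- Reduction preserves values and fixes `[]`, so relabelling is a renaming that keeps validity and
traces. That `WDiff` reduces its own labels does no harm: its arrows are valid, so it may take the
place of `Rules` in `Core`. -/
theorem Relabelled.good (he : IsEval inv φ) {c : Config A} (hc : c.Core φ) {W W' : WDiff A}
    (hW : W.Good φ) (h : Relabelled c W W') :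
    W'.Good φ ∧ ∀ ls, Traces W.needed ls → Traces W'.needed ls := by
  obtain ⟨h, -⟩ := h
  induction h with
  | refl => exact ⟨hW, fun _ h => h⟩
  | @tail V V' _ h ih =>
    obtain ⟨hV, hT⟩ := ih
    obtain ⟨f, hf, rfl⟩ := h
    have hc' : Config.Core φ { c with rules := V.arrows } :=
      { hc with rules_valid := hV.valid, rules_noDiag := hV.noDiag }
    have hnil : f [] = [] := (hf []).nil he hc'
    refine ⟨WDiff.good_weld he ?_ (mapStates_mono hV.needed_subset) rfl,
      fun ls hls => Traces.weld ((hT ls hls).mapStates hnil) _ _⟩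
    exact mapStates_valid (fun s => ((hf s).eval he hc').1.symm) hV.valid

end Core

end WeldKB

namespace WeldKB

variable {A : Type*} [Fintype A] [LinearOrder A]

/-! ### The minimization routine -/

section Minimization

variable {G : Type*} [Group G] {inv : A → A} {φ : List A → G}

/-- The rules of `X` which are lighter than `r`. -/
def lighter (X : Set (Rule A)) (r : Rule A) : Set (Rule A) := {s ∈ X | weight s < weight r}

/-- The two sides of `r` are connected by lighter rules, through strings which do not exceed the
left-hand side. -/
def Derivable (X : Set (Rule A)) (r : Rule A) : Prop :=
  Conn (lighter X r) (rank r.1 + 1) r.1 r.2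

/-- The position of a line in the routine. -/
def MinLine.idx : MinLine → ℕ
  | .front => 0
  | .back => 1
  | .whole => 2
  | .shorten => 3
  | .shift => 4
  | .cancelLeft => 5
  | .cancelRight => 6
  | .rhs => 7
  | .swap => 8
  | .again => 9

/-- The invariants of the minimization of `inp`, `cur` being the current rule and `e` its value
when the main loop was last entered. -/
structure MinInv (inv : A → A) (φ : List A → G) (X : Set (Rule A)) (M : Finset (Arrow A))
    (inp : Rule A) (line : MinLine) (cur e : Rule A) : Prop where
  sound : φ cur.1 = φ cur.2
  conn : Conn (lighter X inp ∪ {cur}) (rank inp.1 + 1) inp.1 inp.2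
  le_entry : weight cur ≤ weight e
  input : weight cur < weight inp ∨ (cur = inp ∧
    (1 ≤ line.idx → ¬ Reducible (setOfRules M) inp.1.dropLast) ∧
    (2 ≤ line.idx → ¬ Reducible (setOfRules M) inp.1.tail))
  loop : weight cur < weight e ∨ (cur = e ∧
    (4 ≤ line.idx → ¬ ∃ r', Shorten inv cur r') ∧
    (6 ≤ line.idx → ¬ ∃ r' : Rule A, CancelLeft cur r') ∧
    (8 ≤ line.idx → ¬ Reducible (setOfRules M) cur.2) ∧
    (9 ≤ line.idx → ¬ SLex cur.1 cur.2))

theorem MinInv.start {X : Set (Rule A)} (M : Finset (Arrow A)) {inp : Rule A}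
    (hs : rank inp.2 < rank inp.1) (hφ : φ inp.1 = φ inp.2) :
    MinInv inv φ X M inp .front inp inp where
  sound := hφ
  conn := by
    have := Conn.rule (X := lighter X inp ∪ {inp}) (n := rank inp.1 + 1) (r := inp)
      (.inr rfl) [] [] (by simp) (by simp; omega)
    simpa using this
  le_entry := le_rfl
  input := .inr ⟨rfl, by simp [MinLine.idx], by simp [MinLine.idx]⟩
  loop := .inr ⟨rfl, by simp [MinLine.idx], by simp [MinLine.idx], by simp [MinLine.idx],
    by simp [MinLine.idx]⟩

variable {X : Set (Rule A)} {M : Finset (Arrow A)} {inp cur cur' e : Rule A}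
  {line line' : MinLine}

theorem MinInv.le_input (h : MinInv inv φ X M inp line cur e) : weight cur ≤ weight inp :=
  h.input.elim le_of_lt fun h => h.1 ▸ le_rfl

/-- A drop in weight puts both alternatives `input` and `loop` on their strict side, so the facts
attached to lines can be forgotten. What remains is `hc`: a use of `cur` in context can be replaced
by lighter rules and `cur'`. -/
theorem MinInv.change (h : MinInv inv φ X M inp line cur e) (hw : weight cur' < weight cur)
    (hφ : φ cur'.1 = φ cur'.2)
    (hc : ∀ s w, rank (s ++ cur.1 ++ w) ≤ rank inp.1 → rank (s ++ cur.2 ++ w) ≤ rank inp.1 →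
      Conn (lighter X inp ∪ {cur'}) (rank inp.1 + 1) (s ++ cur.1 ++ w) (s ++ cur.2 ++ w)) :
    MinInv inv φ X M inp line' cur' e where
  sound := hφ
  conn := by
    refine h.conn.bind fun a b ha hb hab => ?_
    obtain ⟨r, hr, s, w, rfl, rfl⟩ := hab
    rcases hr with hr | rfl
    · exact Conn.rule (.inl hr) s w ha hb
    · exact hc s w (by omega) (by omega)
  le_entry := hw.le.trans h.le_entry
  input := .inl (hw.trans_le h.le_input)
  loop := .inl (hw.trans_le h.le_entry)

theorem rank_insert_lt {u v : List A} (h : rank u < rank v) {n : ℕ} {s w s' w' : List A}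
    (hn : rank (s ++ (s' ++ v ++ w') ++ w) ≤ n) : rank (s ++ (s' ++ u ++ w') ++ w) < n :=
  (rank_append_lt (rank_append_lt h s' w') s w).trans_le hn

/-- Reduction of the left-hand side by a rule with smaller left-hand side. -/
theorem MinInv.change_lhs (he : IsEval inv φ) {r : Rule A} {s₀ w₀ v : List A}
    (h : MinInv inv φ X M inp line (s₀ ++ r.1 ++ w₀, v) e) (hr : r ∈ X)
    (hlt : rank r.2 < rank r.1) (hφ : φ r.1 = φ r.2) (hsm : rank r.1 < rank inp.1) :
    MinInv inv φ X M inp line' (s₀ ++ r.2 ++ w₀, v) e := by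
  have hlight : r ∈ lighter X inp := ⟨hr, weight_lt_of_rank_lt hsm (hlt.trans hsm)⟩
  refine h.change (weight_lt_fst (rank_append_lt hlt _ _)) ?_ fun s w h₁ h₂ => ?_
  · rw [← h.sound]; exact (he.context hφ _ _).symm
  · have h₃ := rank_insert_lt hlt h₁
    refine Conn.trans ?_ (Conn.rule (r := (s₀ ++ r.2 ++ w₀, v)) (.inr rfl) s w
      (by simpa using h₃.trans (Nat.lt_succ_self _)) (Nat.lt_succ_of_le h₂))
    refine .single (Rewrites.context ⟨r, .inl hlight, s₀, w₀, rfl, rfl⟩ s w)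
      (Nat.lt_succ_of_le h₁) (Nat.lt_succ_of_lt h₃)

/-- Reduction of the right-hand side. -/
theorem MinInv.change_rhs (he : IsEval inv φ) (hs : rank inp.2 < rank inp.1) {r : Rule A}
    {s₀ w₀ u : List A} (h : MinInv inv φ X M inp line (u, s₀ ++ r.1 ++ w₀) e) (hr : r ∈ X)
    (hlt : rank r.2 < rank r.1) (hφ : φ r.1 = φ r.2) :
    MinInv inv φ X M inp line' (u, s₀ ++ r.2 ++ w₀) e := by
  have hsm : rank r.1 < rank inp.1 :=
    (rank_infix_le ⟨s₀, w₀, rfl⟩).trans_lt (rank_snd_lt_of_weight hs h.le_input)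
  have hlight : r ∈ lighter X inp := ⟨hr, weight_lt_of_rank_lt hsm (hlt.trans hsm)⟩
  refine h.change (weight_lt_snd (rank_append_lt hlt _ _)) ?_ fun s w h₁ h₂ => ?_
  · exact h.sound.trans (he.context hφ _ _)
  · have h₃ := rank_insert_lt hlt h₂
    refine Conn.trans (Conn.rule (r := (u, s₀ ++ r.2 ++ w₀)) (.inr rfl) s w
      (Nat.lt_succ_of_le h₁) (by simpa using h₃.trans (Nat.lt_succ_self _))) (Conn.symm ?_)
    refine .single (Rewrites.context ⟨r, .inl hlight, s₀, w₀, rfl, rfl⟩ s w)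
      (Nat.lt_succ_of_le h₂) (Nat.lt_succ_of_lt h₃)

theorem lighter_of_infix {r : Rule A} (hr : r ∈ X)
    (hlt : rank r.2 < rank r.1) {u : List A} (hu : r.1 <:+: u) (hlt' : rank u < rank inp.1) :
    r ∈ lighter X inp := by
  have := (rank_infix_le hu).trans_lt hlt'
  exact ⟨hr, weight_lt_of_rank_lt this (hlt.trans this)⟩

theorem rank_nil_lt {u : List A} (hu : u ≠ []) : rank ([] : List A) < rank u :=
  rank_lt_of_length (List.length_pos_iff.2 hu)

/-- The old rule is recovered as `w x → r.2 x⁻¹ x → r.2`. The condition for shortening guarantees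
that the middle string precedes `r.1`. -/
theorem rank_shorten {r r' : Rule A} (h : Shorten inv r r') :
    ∃ w x, r.1 = w ++ [x] ∧ r' = (w, r.2 ++ [inv x]) ∧ rank (r.2 ++ [inv x] ++ [x]) < rank r.1 ∧
      (r.2 ++ [inv x]).length < r.1.length := by
  obtain ⟨w, x, hw, hc, rfl⟩ := h
  refine ⟨w, x, hw, rfl, ?_⟩
  rcases hc with hc | ⟨hc, a, b, ha, hb, hab⟩
  · exact ⟨rank_lt_of_length (by simpa using hc), by simp; omega⟩
  · refine ⟨?_, by simp; omega⟩
    obtain ⟨u, hu⟩ : ∃ u, r.1 = a :: u := List.head?_eq_some_iff.1 ha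
    obtain ⟨v, hv⟩ : ∃ v, r.2 = b :: v := List.head?_eq_some_iff.1 hb
    rw [hu, hv] at hc ⊢
    change rank (b :: (v ++ [inv x] ++ [x])) < _
    refine rank_cons_lt ?_ hab
    simp only [List.length_cons] at hc
    simp only [List.length_append, List.length_cons, List.length_nil]; omega

theorem Shorten.weight_lt {r r' : Rule A} (h : Shorten inv r r') : weight r' < weight r := by
  obtain ⟨w, x, h₁, rfl, -, h₃⟩ := rank_shorten h
  exact weight_lt_of_rank_lt (rank_lt_of_length (by simp [h₁])) (rank_lt_of_length h₃)

theorem Shift.weight_lt {r r' : Rule A} (h : Shift inv r r') : weight r' < weight r := by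
  obtain ⟨a, b, w, h₁, hlen, -, rfl⟩ := h
  exact weight_lt_of_rank_lt (rank_lt_of_length (by simp [h₁]))
    (rank_lt_of_length (by simp; omega))

theorem weight_lt_of_lengths {r r' : Rule A} (h₁ : r'.1.length < r.1.length)
    (h₂ : r'.2.length < r.2.length) : weight r' < weight r :=
  (weight_lt_fst (u := r.1) (v := r'.2) (rank_lt_of_length h₁)).trans
    (weight_lt_snd (rank_lt_of_length h₂))

theorem CancelLeft.weight_lt {r r' : Rule A} (h : CancelLeft r r') : weight r' < weight r := by
  obtain ⟨x, h₁, h₂⟩ := h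
  exact weight_lt_of_lengths (by simp [h₁]) (by simp [h₂])

theorem CancelRight.weight_lt {r r' : Rule A} (h : CancelRight r r') : weight r' < weight r := by
  obtain ⟨x, h₁, h₂⟩ := h
  exact weight_lt_of_lengths (by simp [h₁]) (by simp [h₂])

theorem Tidy.weight_lt_or {r r' : Rule A} (h : Tidy inv line r line' r') :
    weight r' < weight r ∨ (r' = r ∧ line.idx < line'.idx) := by
  cases h with
  | shorten _ _ h => exact .inl h.weight_lt
  | shift _ _ h => exact .inl h.weight_lt
  | cancelLeft _ _ h => exact .inl h.weight_lt
  | cancelRight _ _ h => exact .inl h.weight_lt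
  | swap u v h => exact .inl (weight_swap_lt (rank_lt_of_sLex h))
  | _ => exact .inr ⟨rfl, by decide⟩

/-- After an effective change the old rule is the new one in a context, possibly reversed, or
followed by an inverse rule `([x, inv x], [])`. Such an inverse rule acts on a string before
`cur.1`, hence is lighter than `inp`. -/
theorem Tidy.minInv (hinv : Function.Involutive inv) (he : IsEval inv φ)
    (hX : ∀ x, ([x, inv x], []) ∈ X) (hs : rank inp.2 < rank inp.1)
    (h : MinInv inv φ X M inp line cur e) (ht : Tidy inv line cur line' cur') :
    MinInv inv φ X M inp line' cur' e := by
  have hle := h.le_input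
  have hcur := rank_fst_le_of_weight hs hle
  cases ht with
  | shorten r r' hr =>
    have hw := hr.weight_lt
    obtain ⟨w, x, h₁, rfl, h₂, -⟩ := rank_shorten hr
    have hx : φ [inv x, x] = φ [] := by
      have := he.cancel (inv x)
      rwa [hinv] at this
    refine h.change hw ?_ fun s t hu hv => ?_
    · have := h.sound
      rw [h₁, he.append] at this
      rw [he.append, he.letter, ← this]; group
    · have hmem : ([inv x, x], []) ∈ lighter X inp := by
        refine lighter_of_infix (u := cur.2 ++ [inv x] ++ [x]) ?_ (rank_nil_lt (by simp))
          ⟨cur.2, [], by simp⟩ (h₂.trans_le hcur)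
        have := hX (inv x)
        rwa [hinv] at this
      have h₄ := (rank_append_lt h₂ s t).trans_le hu
      have c₁ := Conn.rule (X := lighter X inp ∪ {(w, cur.2 ++ [inv x])}) (n := rank inp.1 + 1)
        (r := (w, cur.2 ++ [inv x])) (.inr rfl) s ([x] ++ t)
        (by rw [h₁] at hu; simp only [List.append_assoc] at hu ⊢; omega)
        (by simp only [List.append_assoc] at h₄ ⊢; omega)
      have c₂ := Conn.rule (X := lighter X inp ∪ {(w, cur.2 ++ [inv x])}) (n := rank inp.1 + 1)
        (r := ([inv x, x], [])) (.inl hmem) (s ++ cur.2) t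
        (by simp only [List.append_assoc, List.cons_append, List.nil_append] at h₄ ⊢; omega)
        (by simp only [List.append_nil]; omega)
      rw [h₁]
      simp only [List.append_assoc, List.cons_append, List.nil_append] at c₁ c₂ ⊢
      exact c₁.trans c₂
  | shortenDone r hn =>
    exact ⟨h.sound, h.conn, h.le_entry, h.input.imp_right fun h => ⟨h.1, fun _ => h.2.1 (by decide),
      fun _ => h.2.2 (by decide)⟩, h.loop.imp_right fun h => ⟨h.1, fun _ => hn,
      by simp [MinLine.idx], by simp [MinLine.idx], by simp [MinLine.idx]⟩⟩
  | shift r r' hr =>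
    have hw := hr.weight_lt
    obtain ⟨a, b, w, h₁, hlen, hab, rfl⟩ := hr
    -- The middle string `a a⁻¹ cur.2` is as long as `cur.1`, has the same first letter, and a
    -- smaller second letter.
    have h₂ : rank ([a] ++ (inv a :: cur.2) ++ []) < rank ([a] ++ (b :: w) ++ []) := by
      refine rank_append_lt (rank_cons_lt ?_ hab) _ _
      rw [h₁] at hlen; simp at hlen; omega
    have h₁' : cur.1 = [a] ++ (b :: w) ++ [] := by simp [h₁]
    rw [← h₁'] at h₂
    refine h.change hw ?_ fun s t hu hv => ?_
    · have := h.sound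
      rw [h₁, he.cons] at this
      rw [he.cons (inv a), he.letter, ← this]; group
    · have hmem : ([a, inv a], []) ∈ lighter X inp :=
        lighter_of_infix (hX a) (rank_nil_lt (by simp)) ⟨[], cur.2, by simp⟩
          (h₂.trans_le hcur)
      have h₄ := (rank_append_lt h₂ s t).trans_le hu
      have c₁ := Conn.rule (X := lighter X inp ∪ {(b :: w, inv a :: cur.2)}) (n := rank inp.1 + 1)
        (r := (b :: w, inv a :: cur.2)) (.inr rfl) (s ++ [a]) t
        (by
          rw [h₁] at hu
          simp only [List.append_assoc, List.cons_append, List.nil_append] at hu ⊢; omega)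
        (by
          simp only [List.append_assoc, List.cons_append, List.nil_append, List.append_nil] at h₄ ⊢
          omega)
      have c₂ := Conn.rule (X := lighter X inp ∪ {(b :: w, inv a :: cur.2)}) (n := rank inp.1 + 1)
        (r := ([a, inv a], [])) (.inl hmem) s (cur.2 ++ t)
        (by
          simp only [List.append_assoc, List.cons_append, List.nil_append, List.append_nil] at h₄ ⊢
          omega)
        (by simp only [List.append_nil, List.append_assoc] at hv ⊢; omega)
      rw [h₁]
      simp only [List.append_assoc, List.cons_append, List.nil_append] at c₁ c₂ ⊢
      exact c₁.trans c₂
  | shiftDone r hn =>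
    exact ⟨h.sound, h.conn, h.le_entry, h.input.imp_right fun h => ⟨h.1, fun _ => h.2.1 (by decide),
      fun _ => h.2.2 (by decide)⟩, h.loop.imp_right fun h => ⟨h.1, fun _ => h.2.1 (by decide),
      by simp [MinLine.idx], by simp [MinLine.idx], by simp [MinLine.idx]⟩⟩
  | cancelLeft r r' hr =>
    have hw := hr.weight_lt
    obtain ⟨x, h₁, h₂⟩ := hr
    refine h.change hw ?_ fun s t hu hv => ?_
    · have := h.sound
      rw [h₁, h₂, he.cons x cur'.1, he.cons x cur'.2] at this
      exact mul_left_cancel this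
    · have := Conn.rule (X := lighter X inp ∪ {cur'}) (n := rank inp.1 + 1)
        (r := cur') (.inr rfl) (s ++ [x]) t
        (by rw [h₁] at hu; simp only [List.append_assoc, List.cons_append, List.nil_append] at hu ⊢; omega)
        (by rw [h₂] at hv; simp only [List.append_assoc, List.cons_append, List.nil_append] at hv ⊢; omega)
      rw [h₁, h₂]
      simpa using this
  | cancelLeftDone r hn =>
    exact ⟨h.sound, h.conn, h.le_entry, h.input.imp_right fun h => ⟨h.1, fun _ => h.2.1 (by decide),
      fun _ => h.2.2 (by decide)⟩, h.loop.imp_right fun h => ⟨h.1, fun _ => h.2.1 (by decide),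
      fun _ => hn, by simp [MinLine.idx], by simp [MinLine.idx]⟩⟩
  | cancelRight r r' hr =>
    have hw := hr.weight_lt
    obtain ⟨x, h₁, h₂⟩ := hr
    refine h.change hw ?_ fun s t hu hv => ?_
    · have := h.sound
      rw [h₁, h₂, he.append, he.append] at this
      exact mul_right_cancel this
    · have := Conn.rule (X := lighter X inp ∪ {cur'}) (n := rank inp.1 + 1)
        (r := cur') (.inr rfl) s ([x] ++ t)
        (by rw [h₁] at hu; simp only [List.append_assoc, List.cons_append, List.nil_append] at hu ⊢; omega)
        (by rw [h₂] at hv; simp only [List.append_assoc, List.cons_append, List.nil_append] at hv ⊢; omega)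
      rw [h₁, h₂]
      simpa using this
  | cancelRightDone r hn =>
    exact ⟨h.sound, h.conn, h.le_entry, h.input.imp_right fun h => ⟨h.1, fun _ => h.2.1 (by decide),
      fun _ => h.2.2 (by decide)⟩, h.loop.imp_right fun h => ⟨h.1, fun _ => h.2.1 (by decide),
      fun _ => h.2.2.1 (by decide), by simp [MinLine.idx], by simp [MinLine.idx]⟩⟩
  | swap u v huv =>
    refine h.change (weight_swap_lt (rank_lt_of_sLex huv)) h.sound.symm fun s t hu hv => ?_
    exact (Conn.rule (r := (v, u)) (.inr rfl) s t (by simp only at hv ⊢; omega)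
      (by simp only at hu ⊢; omega)).symm
  | swapDone u v huv =>
    exact ⟨h.sound, h.conn, h.le_entry, h.input.imp_right fun h => ⟨h.1, fun _ => h.2.1 (by decide),
      fun _ => h.2.2 (by decide)⟩, h.loop.imp_right fun h => ⟨h.1, fun _ => h.2.1 (by decide),
      fun _ => h.2.2.1 (by decide), fun _ => h.2.2.2.1 (by decide), fun _ => huv⟩⟩

/-- The properties of the output `out` of the minimization of `inp`. -/
structure OutInv (φ : List A → G) (X : Set (Rule A)) (M : Finset (Arrow A))
    (inp out : Rule A) : Prop where
  sound : φ out.1 = φ out.2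
  conn : Conn (lighter X inp ∪ {out}) (rank inp.1 + 1) inp.1 inp.2
  lighter_or_eq : weight out < weight inp ∨ (out = inp ∧
    ¬ Reducible (setOfRules M) inp.1.dropLast ∧ ¬ Reducible (setOfRules M) inp.1.tail)
  sL2Accepts : out ≠ ([], []) → SL2Accepts out
  rhs_irreducible : ¬ Reducible (setOfRules M) out.2

/-- Failure to shorten bounds the length difference by 2, failure to cancel separates the first
letters, and failure to swap orients the rule; for equal lengths the distinct first letters then
decide the order. -/
theorem sL2Accepts_of_tidy {r : Rule A} (hne : r ≠ ([], [])) (h₁ : ¬ ∃ r', Shorten inv r r')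
    (h₂ : ¬ ∃ r' : Rule A, CancelLeft r r') (h₃ : ¬ SLex r.1 r.2) : SL2Accepts r := by
  obtain ⟨u, v⟩ := r
  have hlt : SLex v u := by
    rcases sLex_trichotomy u v with h | h | h
    · exact absurd h h₃
    · subst h
      cases u with
      | nil => exact absurd rfl hne
      | cons x u => exact absurd ⟨(u, u), x, rfl, rfl⟩ h₂
    · exact h
  have hu : u ≠ [] := by
    rintro rfl
    exact List.not_shortlex_nil_right hlt
  have hle : u.length ≤ v.length + 2 := by
    by_contra hc
    obtain ⟨w, x, rfl⟩ := (List.eq_nil_or_concat u).resolve_left hu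
    rw [List.concat_eq_append] at *
    exact h₁ ⟨_, w, x, rfl, .inl (not_le.1 hc), rfl⟩
  rw [sLex_iff] at hlt
  refine sL2Accepts_iff.2 ⟨hu, hlt.elim le_of_lt fun h => h.1.le, hle, fun a b ha hb => ?_⟩
  cases u with
  | nil => simp at ha
  | cons a' u =>
  cases v with
  | nil => simp at hb
  | cons b' v =>
  simp only [List.head?_cons, Option.some.injEq] at ha hb
  subst ha hb
  have hab : a' ≠ b' := by
    rintro rfl
    exact h₂ ⟨(u, v), a', rfl, rfl⟩
  refine ⟨hab, fun hl => ?_⟩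
  rcases hlt with h | ⟨-, h⟩
  · omega
  · cases h with
    | cons _ => exact absurd rfl hab
    | rel h => exact h

theorem MinInv.output (h : MinInv inv φ X M inp .again cur cur) : OutInv φ X M inp cur := by
  obtain ⟨-, h₁, h₂, h₃, h₄⟩ := h.loop.resolve_left (lt_irrefl _)
  exact ⟨h.sound, h.conn, h.input.imp_right fun h => ⟨h.1, h.2.1 (by decide), h.2.2 (by decide)⟩,
    fun hne => sL2Accepts_of_tidy hne (h₁ (by decide)) (h₂ (by decide)) (h₄ (by decide)),
    h₃ (by decide)⟩

/-- A rule which is replaced by another rule, or found to be trivial, is derivable. -/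
theorem OutInv.derivable {out : Rule A} (h : OutInv φ X M inp out)
    (hne : out ≠ inp) (hout : out = ([], []) ∨ out ∈ X) : Derivable X inp := by
  refine h.conn.bind fun a b ha hb hab => ?_
  obtain ⟨r, hr, s, w, rfl, rfl⟩ := hab
  rcases hr with hr | hr
  · exact Conn.rule hr s w ha hb
  · rw [Set.mem_singleton_iff] at hr
    rw [hr] at ha hb ⊢
    rcases hout with rfl | hout
    · exact .refl _
    · have : out ∈ lighter X inp := ⟨hout, h.lighter_or_eq.resolve_right fun h => hne h.1⟩
      exact Conn.rule this s w ha hb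

end Minimization

end WeldKB

namespace WeldKB

variable {A : Type*} [Fintype A] [LinearOrder A]

/-! ### The invariants of the procedure -/

section Invariants

/-- The string in which the two left-hand sides overlap. -/
def overlapWord (o : (Rule A × Rule A) × ℕ) : List A := o.1.1.1 ++ o.1.2.1.drop o.2

theorem IsOverlap.word_eq {o : (Rule A × Rule A) × ℕ} (h : IsOverlap o) :
    overlapWord o = o.1.1.1.take (o.1.1.1.length - o.2) ++ o.1.2.1 := by
  conv_lhs => rw [overlapWord, ← List.take_append_drop (o.1.1.1.length - o.2) o.1.1.1, h.2.2.2]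
  rw [List.append_assoc, List.take_append_drop]

theorem rank_overlapLeft {o : (Rule A × Rule A) × ℕ} (h : rank o.1.1.2 < rank o.1.1.1) :
    rank (overlapLeft o) < rank (overlapWord o) := by
  simpa [overlapLeft, overlapWord] using rank_append_lt h [] (o.1.2.1.drop o.2)

theorem rank_overlapRight {o : (Rule A × Rule A) × ℕ} (ho : IsOverlap o)
    (h : rank o.1.2.2 < rank o.1.2.1) : rank (overlapRight o) < rank (overlapWord o) := by
  rw [ho.word_eq]
  simpa [overlapRight] using rank_append_lt h (o.1.1.1.take (o.1.1.1.length - o.2)) []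

/-- The critical pair of the overlap is connected below the overlap. -/
def Resolved (X : Set (Rule A)) (o : (Rule A × Rule A) × ℕ) : Prop :=
  Conn X (rank (overlapWord o)) (overlapLeft o) (overlapRight o)

/-- The overlap is waiting to be resolved, or being resolved. -/
def Pending (X : Set (Rule A)) (o : (Rule A × Rule A) × ℕ) : Phase A → Prop
  | .overlaps todo => o ∈ todo
  | .resolve todo a b => o ∈ todo ∨ (Conn X (rank (overlapWord o)) (overlapLeft o) a ∧
      Conn X (rank (overlapWord o)) (overlapRight o) b ∧
      rank a < rank (overlapWord o) ∧ rank b < rank (overlapWord o))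
  | _ => False

variable {G : Type*} [Group G] {inv : A → A} {φ : List A → G}

/-- The invariants of a phase, depending on `Considered`, `New`, `Rules` and the needed arrows. -/
def PhaseInv (inv : A → A) (φ : List A → G) (X : Set (Rule A)) (C N : Finset (Rule A))
    (M W : Finset (Arrow A)) : Phase A → Prop
  | .scan todo => todo ⊆ C
  | .minimize todo inp line cur e => todo ⊆ C ∧ inp ∉ todo ∧ (inp ∈ C ∨ inp ∈ N) ∧
      MinInv inv φ X M inp line cur e
  | .handle todo inp out line => todo ⊆ C ∧ inp ∉ todo ∧ (inp ∈ C ∨ inp ∈ N) ∧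
      OutInv φ X M inp out ∧ (line = .sew ∨ out = ([], []) ∨ Traces W (pad out.1 out.2)) ∧
      (line = .discard → out ≠ inp ∧ (out = ([], []) ∨ out ∈ X))
  | .overlaps todo => ∀ o ∈ todo, o.1.1 ∈ C ∧ o.1.2 ∈ C ∧ IsOverlap o
  | .resolve todo a b => (∀ o ∈ todo, o.1.1 ∈ C ∧ o.1.2 ∈ C ∧ IsOverlap o) ∧ φ a = φ b
  | _ => True

/-- The invariants of a configuration; `X` is the set of all rules which ever occur. -/
structure Inv (inv : A → A) (φ : List A → G) (X : Set (Rule A)) (c : Config A) : Prop where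
  core : c.Core φ
  phase : PhaseInv inv φ X c.considered c.newRules c.rules c.wdiff.needed c.phase
  deleted : ∀ r ∈ c.deleteRules, Derivable X r
  overlaps : ∀ o : (Rule A × Rule A) × ℕ, o.1.1 ∈ c.considered → o.1.2 ∈ c.considered →
    IsOverlap o → Resolved X o ∨ Pending X o c.phase

variable {X : Set (Rule A)} {c c' : Config A}

theorem mem_store_considered {r : Rule A} (h : r ∈ c.considered) : r ∈ c.store := by
  simp [Config.store, h]

theorem mem_store_new {r : Rule A} (h : r ∈ c.newRules) : r ∈ c.store := by
  simp [Config.store, h]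

theorem Inv.set_phase (h : Inv inv φ X c) (ph : Phase A)
    (hph : PhaseInv inv φ X c.considered c.newRules c.rules c.wdiff.needed ph)
    (hov : ∀ o, Pending X o c.phase → Resolved X o ∨ Pending X o ph) :
    Inv inv φ X { c with phase := ph } :=
  ⟨h.core, hph, h.deleted, fun o h₁ h₂ h₃ => (h.overlaps o h₁ h₂ h₃).elim .inl (hov o)⟩

theorem Inv.addNew_phase (h : Inv inv φ X c) {r : Rule A} (hr : rank r.2 < rank r.1)
    (hφ : φ r.1 = φ r.2) (ph : Phase A)
    (hph : PhaseInv inv φ X c.considered (c.addNew r).newRules c.rules c.wdiff.needed ph)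
    (hov : ∀ o, Pending X o c.phase → Resolved X o ∨ Pending X o ph) :
    Inv inv φ X { c.addNew r with phase := ph } := by
  have hcore := h.core.addNew hr hφ
  rw [addNew_eq] at hcore ⊢
  exact ⟨hcore, hph, h.deleted, fun o h₁ h₂ h₃ => (h.overlaps o h₁ h₂ h₃).elim .inl (hov o)⟩

theorem Inv.resolved (h : Inv inv φ X c) (hp : ∀ o, ¬ Pending X o c.phase)
    {o : (Rule A × Rule A) × ℕ} (h₁ : o.1.1 ∈ c.considered) (h₂ : o.1.2 ∈ c.considered)
    (h₃ : IsOverlap o) : Resolved X o :=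
  (h.overlaps o h₁ h₂ h₃).resolve_right (hp o)

theorem mem_newRules_of_addNew {r s : Rule A} (h : s ∈ c.considered ∨ s ∈ c.newRules) :
    s ∈ c.considered ∨ s ∈ (c.addNew r).newRules :=
  h.imp_right fun h => mem_newRules_addNew.2 (.inl h)

theorem mem_of_addNew_subset {r : Rule A} {ph : Phase A}
    (h : ∀ s ∈ ({ c.addNew r with phase := ph } : Config A).store, s ∈ X) : r ∈ X := by
  refine h r ?_
  change r ∈ (c.addNew r).store
  rw [store_addNew]
  exact Finset.mem_insert_self _ _

theorem Inv.inp_ordered (h : Inv inv φ X c) {r : Rule A} (hr : r ∈ c.considered ∨ r ∈ c.newRules) :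
    rank r.2 < rank r.1 :=
  h.core.ordered r (hr.elim mem_store_considered mem_store_new)

theorem isOverlap_of_mem {r : Rule A} {C : Finset (Rule A)} {o : (Rule A × Rule A) × ℕ}
    (h : o ∈ overlapsWith r C) : IsOverlap o := (Finset.mem_filter.1 h).2

theorem mem_overlapsWith {r : Rule A} {C : Finset (Rule A)} {o : (Rule A × Rule A) × ℕ} :
    o ∈ overlapsWith r C ↔ ((o.1.1 = r ∧ o.1.2 ∈ C) ∨ (o.1.1 ∈ C ∧ o.1.2 = r)) ∧ IsOverlap o := by
  obtain ⟨⟨r₁, r₂⟩, k⟩ := o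
  simp only [overlapsWith, Finset.mem_filter, Finset.mem_product, Finset.mem_union,
    Finset.mem_singleton, Finset.mem_range]
  constructor
  · exact fun h => ⟨h.1.1, h.2⟩
  · refine fun h => ⟨⟨h.1, ?_⟩, h.2⟩
    have h₁ : k ≤ r₁.1.length := h.2.2.1
    have h₂ : k ≤ r₂.1.length := h.2.2.2.1
    rcases h.1 with ⟨rfl, -⟩ | ⟨-, rfl⟩ <;> omega

/-- The data of a configuration are unchanged, up to the sets of rules. -/
theorem Core.subset {C T N D C' T' N' D' : Finset (Rule A)} {M : Finset (Arrow A)} {W : WDiff A}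
    (h : Core φ C T N D M W)
    (hd : ∀ r, (r ∈ C' → r ∉ T' ∧ r ∉ N' ∧ r ∉ D') ∧ (r ∈ T' → r ∉ N' ∧ r ∉ D') ∧
      (r ∈ N' → r ∉ D'))
    (hs : ∀ r ∈ C' ∪ T' ∪ N' ∪ D', r ∉ C ∪ T ∪ N ∪ D → rank r.2 < rank r.1 ∧ φ r.1 = φ r.2) :
    Core φ C' T' N' D' M W :=
  { h with
    disj_considered := fun r => (hd r).1
    disj_this := fun r => (hd r).2.1
    disj_new := fun r => (hd r).2.2
    ordered := fun r hr => by
      by_cases hr' : r ∈ C ∪ T ∪ N ∪ D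
      · exact h.ordered r hr'
      · exact (hs r hr hr').1
    sound := fun r hr => by
      by_cases hr' : r ∈ C ∪ T ∪ N ∪ D
      · exact h.sound r hr'
      · exact (hs r hr hr').2 }

set_option maxHeartbeats 4000000 in
-- `X` contains the stores before and after the step and does not change, so recorded chains survive
-- the deletion of their rules. `take` makes new overlaps pending, reductions of a critical pair
-- keep both chains below the overlap, and `discardLater` is the only case that must supply a
-- derivation.
theorem Step.preserves_inv (hinv : Function.Involutive inv) (he : IsEval inv φ)
    (hX : ∀ x, ([x, inv x], []) ∈ X) (hsub : ∀ r ∈ c.store, r ∈ X) (hsub' : ∀ r ∈ c'.store, r ∈ X)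
    (h : Inv inv φ X c) (hs : Step inv c c') : Inv inv φ X c' := by
  have hd : ∀ r, (r ∈ c.considered → r ∉ c.thisRules ∧ r ∉ c.newRules ∧ r ∉ c.deleteRules) ∧
      (r ∈ c.thisRules → r ∉ c.newRules ∧ r ∉ c.deleteRules) ∧
      (r ∈ c.newRules → r ∉ c.deleteRules) := fun r =>
    ⟨h.core.disj_considered r, h.core.disj_this r, h.core.disj_new r⟩
  have hp := h.phase
  have hpend := h.overlaps
  cases hs with
  | beginPass hc =>
    rw [hc] at hpend
    exact ⟨h.core.subset (fun r => by have := hd r; simp; tauto) (fun r hr hr' => by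
      exfalso; simp at hr hr'; tauto), Finset.Subset.refl _, by simp,
      fun o h₁ h₂ h₃ => (hpend o h₁ h₂ h₃).imp_right fun h => h⟩
  | pickConsidered todo r hc hr =>
    rw [hc] at hp
    have hr' : r ∈ c.considered ∨ r ∈ c.newRules := .inl (hp hr)
    refine h.set_phase _ ⟨(Finset.erase_subset _ _).trans hp, Finset.notMem_erase _ _, hr',
      MinInv.start _ (h.inp_ordered hr') ?_⟩ (by rw [hc]; exact fun _ h => h.elim)
    exact h.core.sound r (mem_store_considered (hp hr))
  | pickNew r hc hr =>
    refine h.set_phase _ ⟨Finset.empty_subset _, Finset.notMem_empty _, .inr hr,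
      MinInv.start _ (h.inp_ordered (.inr hr)) ?_⟩ (by rw [hc]; exact fun _ h => h.elim)
    exact h.core.sound r (mem_store_new hr)
  | scanDone hc hn => exact h.set_phase _ trivial (by rw [hc]; exact fun _ h => h.elim)
  | front c' todo inp w w' x v e hc hr =>
    rw [hc] at hp
    obtain ⟨h₁, h₂, h₃, hm⟩ := hp
    obtain ⟨r, p, q, rfl, rfl, rfl, hlt, hφ, -⟩ := hr.exists_rule he h.core
    have hrX := mem_of_addNew_subset hsub'
    refine h.addNew_phase hlt hφ _ ⟨h₁, h₂, mem_newRules_of_addNew h₃, ?_⟩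
      (by rw [hc]; exact fun _ h => h.elim)
    -- Only a proper prefix is being reduced, so `r.1` lies strictly below the left-hand side of the
    -- input.
    have hsm := (rank_infix_lt (u := r.1) (v := p ++ r.1 ++ q ++ [x]) ⟨p, q ++ [x], by simp⟩
      (fun e => by have := congrArg List.length e; simp at this; omega)).trans_le
      (rank_fst_le_of_weight (h.inp_ordered h₃) hm.le_input)
    rw [List.append_assoc] at hm ⊢
    exact hm.change_lhs he hrX hlt hφ hsm
  | frontSame todo inp w x v e hc hirr heq =>
    rw [hc] at hp
    obtain ⟨h₁, h₂, h₃, hm⟩ := hp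
    refine h.set_phase _ ⟨h₁, h₂, h₃, ⟨hm.sound, hm.conn, hm.le_entry, ?_, ?_⟩⟩
      (by rw [hc]; exact fun _ h => h.elim)
    · refine hm.input.imp_right fun h => ⟨h.1, fun _ => ?_, by simp [MinLine.idx]⟩
      rw [← heq, List.dropLast_concat]
      exact hirr
    · exact hm.loop.imp_right fun h => ⟨h.1, by simp [MinLine.idx], by simp [MinLine.idx],
        by simp [MinLine.idx], by simp [MinLine.idx]⟩
  | frontChanged todo inp w x v e hc hirr heq =>
    rw [hc] at hp
    obtain ⟨h₁, h₂, h₃, hm⟩ := hp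
    refine h.set_phase _ ⟨h₁, h₂, h₃, ⟨hm.sound, hm.conn, hm.le_entry, ?_, ?_⟩⟩
      (by rw [hc]; exact fun _ h => h.elim)
    · exact .inl (hm.input.resolve_right fun h => heq (congrArg Prod.fst h.1))
    · exact hm.loop.imp_right fun h => ⟨h.1, by simp [MinLine.idx], by simp [MinLine.idx],
        by simp [MinLine.idx], by simp [MinLine.idx]⟩
  | back c' todo inp w w' x v e hc hr =>
    rw [hc] at hp
    obtain ⟨h₁, h₂, h₃, hm⟩ := hp
    obtain ⟨r, p, q, rfl, rfl, rfl, hlt, hφ, -⟩ := hr.exists_rule he h.core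
    have hrX := mem_of_addNew_subset hsub'
    refine h.addNew_phase hlt hφ _ ⟨h₁, h₂, mem_newRules_of_addNew h₃, ?_⟩
      (by rw [hc]; exact fun _ h => h.elim)
    have hsm := (rank_infix_lt (u := r.1) (v := x :: (p ++ r.1 ++ q)) ⟨x :: p, q, by simp⟩
      (fun e => by have := congrArg List.length e; simp at this; omega)).trans_le
      (rank_fst_le_of_weight (h.inp_ordered h₃) hm.le_input)
    exact MinInv.change_lhs (s₀ := x :: p) he hm hrX hlt hφ hsm
  | backDone todo inp w x v e hc hirr =>
    rw [hc] at hp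
    obtain ⟨h₁, h₂, h₃, hm⟩ := hp
    refine h.set_phase _ ⟨h₁, h₂, h₃, ⟨hm.sound, hm.conn, hm.le_entry, ?_, ?_⟩⟩
      (by rw [hc]; exact fun _ h => h.elim)
    · refine hm.input.imp_right fun h => ⟨h.1, fun _ => h.2.1 (by decide), fun _ => ?_⟩
      rw [← congrArg Prod.fst h.1]
      exact hirr
    · exact hm.loop.imp_right fun h => ⟨h.1, by simp [MinLine.idx], by simp [MinLine.idx],
        by simp [MinLine.idx], by simp [MinLine.idx]⟩
  | whole c' todo inp u u' v e hc hne hr =>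
    rw [hc] at hp
    obtain ⟨h₁, h₂, h₃, hm⟩ := hp
    obtain ⟨r, p, q, rfl, rfl, rfl, hlt, hφ, -⟩ := hr.exists_rule he h.core
    have hrX := mem_of_addNew_subset hsub'
    refine h.addNew_phase hlt hφ _ ⟨h₁, h₂, mem_newRules_of_addNew h₃, ?_⟩
      (by rw [hc]; exact fun _ h => h.elim)
    -- Here the strictness comes from the condition that the left-hand side has changed; otherwise
    -- `r` need not be lighter than `inp`.
    have hsm := (rank_infix_le (u := r.1) (v := p ++ r.1 ++ q) ⟨p, q, rfl⟩).trans_lt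
      (lt_of_le_of_ne (rank_fst_le_of_weight (h.inp_ordered h₃) hm.le_input)
        fun e => hne (rank_injective e))
    exact hm.change_lhs he hrX hlt hφ hsm
  | wholeDone todo inp u v e hc hirr =>
    rw [hc] at hp
    obtain ⟨h₁, h₂, h₃, hm⟩ := hp
    refine h.set_phase _ ⟨h₁, h₂, h₃, ⟨hm.sound, hm.conn, le_rfl, ?_, ?_⟩⟩
      (by rw [hc]; exact fun _ h => h.elim)
    · exact hm.input.imp_right fun h => ⟨h.1, fun _ => h.2.1 (by decide),
        fun _ => h.2.2 (by decide)⟩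
    · exact .inr ⟨rfl, by simp [MinLine.idx], by simp [MinLine.idx],
        by simp [MinLine.idx], by simp [MinLine.idx]⟩
  | tidy todo inp line r line' r' e hc ht =>
    rw [hc] at hp
    obtain ⟨h₁, h₂, h₃, hm⟩ := hp
    exact h.set_phase _ ⟨h₁, h₂, h₃, ht.minInv hinv he hX (h.inp_ordered h₃) hm⟩
      (by rw [hc]; exact fun _ h => h.elim)
  | rhs c' todo inp u v v' e hc hr =>
    rw [hc] at hp
    obtain ⟨h₁, h₂, h₃, hm⟩ := hp
    obtain ⟨r, p, q, rfl, rfl, rfl, hlt, hφ, -⟩ := hr.exists_rule he h.core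
    have hrX := mem_of_addNew_subset hsub'
    exact h.addNew_phase hlt hφ _ ⟨h₁, h₂, mem_newRules_of_addNew h₃,
      hm.change_rhs he (h.inp_ordered h₃) hrX hlt hφ⟩ (by rw [hc]; exact fun _ h => h.elim)
  | rhsDone todo inp u v e hc hirr =>
    rw [hc] at hp
    obtain ⟨h₁, h₂, h₃, hm⟩ := hp
    refine h.set_phase _ ⟨h₁, h₂, h₃, ⟨hm.sound, hm.conn, hm.le_entry, ?_, ?_⟩⟩
      (by rw [hc]; exact fun _ h => h.elim)
    · exact hm.input.imp_right fun h => ⟨h.1, fun _ => h.2.1 (by decide),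
        fun _ => h.2.2 (by decide)⟩
    · exact hm.loop.imp_right fun h => ⟨h.1, fun _ => h.2.1 (by decide),
        fun _ => h.2.2.1 (by decide), fun _ => hirr, by simp [MinLine.idx]⟩
  | again todo inp r e hc hne =>
    rw [hc] at hp
    obtain ⟨h₁, h₂, h₃, hm⟩ := hp
    refine h.set_phase _ ⟨h₁, h₂, h₃, ⟨hm.sound, hm.conn, le_rfl, ?_, ?_⟩⟩
      (by rw [hc]; exact fun _ h => h.elim)
    · exact hm.input.imp_right fun h => ⟨h.1, fun _ => h.2.1 (by decide),
        fun _ => h.2.2 (by decide)⟩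
    · exact .inr ⟨rfl, by simp [MinLine.idx], by simp [MinLine.idx],
        by simp [MinLine.idx], by simp [MinLine.idx]⟩
  | output todo inp r e hc heq =>
    rw [hc] at hp
    obtain ⟨h₁, h₂, h₃, hm⟩ := hp
    subst heq
    exact h.set_phase _ ⟨h₁, h₂, h₃, hm.output, .inl rfl, by simp⟩
      (by rw [hc]; exact fun _ h => h.elim)
  | sew todo inp out W hc hne hW =>
    rw [hc] at hp hpend
    obtain ⟨h₁, h₂, h₃, ho, -⟩ := hp
    obtain ⟨hg, ht, -⟩ := hW.good he h.core ho.sound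
    exact ⟨h.core.of_good hg, ⟨h₁, h₂, h₃, ho, .inr (.inr ht), by simp⟩, h.deleted, hpend⟩
  | sewNothing todo inp out hc heq =>
    rw [hc] at hp
    obtain ⟨h₁, h₂, h₃, ho, -⟩ := hp
    exact h.set_phase _ ⟨h₁, h₂, h₃, ho, .inr (.inl heq), by simp⟩
      (by rw [hc]; exact fun _ h => h.elim)
  | keep todo inp out hc heq hn =>
    rw [hc] at hp
    exact h.set_phase _ hp.1 (by rw [hc]; exact fun _ h => h.elim)
  | promote todo inp out hc heq hn =>
    rw [hc] at hp hpend
    refine ⟨h.core.subset (fun r => ?_) fun r hr hr' => ?_, hp.1, h.deleted, hpend⟩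
    · have := hd r
      by_cases hr : r = inp
      · subst hr; simp; tauto
      · simp [hr]; tauto
    · exfalso
      by_cases hri : r = inp
      · subst hri; simp [hn] at hr'
      · simp [hri] at hr hr'; tauto
  | installOld todo inp out hc hne hold =>
    rw [hc] at hp
    obtain ⟨h₁, h₂, h₃, ho, ht, -⟩ := hp
    exact h.set_phase _ ⟨h₁, h₂, h₃, ho, .inr (ht.resolve_left (by simp)),
      fun _ => ⟨hne, hold.imp_right (hsub _)⟩⟩ (by rw [hc]; exact fun _ h => h.elim)
  | install todo inp out hc hne hne' hnew =>
    rw [hc] at hp hpend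
    obtain ⟨h₁, h₂, h₃, ho, ht, -⟩ := hp
    refine ⟨h.core.subset (fun r => ?_) fun r hr hr' => ?_,
      ⟨h₁, h₂, h₃, ho, .inr (ht.resolve_left (by simp)),
        fun _ => ⟨hne, .inr (hsub' out (by simp [Config.store]))⟩⟩, h.deleted, hpend⟩
    · have := hd r
      simp only [Config.store, Finset.mem_union, not_or] at hnew
      by_cases hr : r = out
      · subst hr; simp; tauto
      · simp [hr]; tauto
    · by_cases hri : r = out
      · subst hri
        exact ⟨rank_lt_of_sLex (ho.sL2Accepts hne').sLex, ho.sound⟩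
      · exfalso; simp [hri] at hr hr'; tauto
  | discardNow todo inp out hc hred =>
    rw [hc] at hp hpend
    obtain ⟨h₁, h₂, h₃, ho, ht, hx⟩ := hp
    refine ⟨h.core.subset (fun r => ?_) fun r hr hr' => ?_, ?_, h.deleted, fun o ho₁ ho₂ =>
      hpend o (Finset.mem_of_mem_erase ho₁) (Finset.mem_of_mem_erase ho₂)⟩
    · have := hd r; simp; tauto
    · exfalso; simp at hr hr'; tauto
    · exact fun r hr => Finset.mem_erase.2 ⟨by rintro rfl; exact h₂ hr, h₁ hr⟩
  | discardLater todo inp out hc hred =>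
    rw [hc] at hp hpend
    obtain ⟨h₁, h₂, h₃, ho, ht, hx⟩ := hp
    refine ⟨h.core.subset (fun r => ?_) fun r hr hr' => ?_, ?_, ?_, fun o ho₁ ho₂ =>
      hpend o (Finset.mem_of_mem_erase ho₁) (Finset.mem_of_mem_erase ho₂)⟩
    · have := hd r
      by_cases hr : r = inp
      · subst hr; simp; tauto
      · simp [hr]; tauto
    · exfalso
      by_cases hri : r = inp
      · subst hri; simp at hr'; tauto
      · simp [hri] at hr hr'; tauto
    · exact fun r hr => Finset.mem_erase.2 ⟨by rintro rfl; exact h₂ hr, h₁ hr⟩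
    · intro r hr
      rcases Finset.mem_insert.1 hr with rfl | hr
      · exact ho.derivable (hx rfl).1 (hx rfl).2
      · exact h.deleted r hr
  | take r hc hr =>
    rw [hc] at hpend
    refine ⟨h.core.subset (fun s => ?_) fun s hs hs' => ?_, ?_, h.deleted, ?_⟩
    · have := hd s
      by_cases hs : s = r
      · subst hs; simp; tauto
      · simp [hs]; tauto
    · exfalso
      by_cases hri : s = r
      · subst hri; simp [hr] at hs'
      · simp [hri] at hs hs'; tauto
    · intro o ho
      have := (mem_overlapsWith.1 ho).1
      refine ⟨?_, ?_, isOverlap_of_mem ho⟩ <;>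
      rcases this with ⟨h₁, h₂⟩ | ⟨h₁, h₂⟩ <;> first | exact h₁ | exact h₂ | skip
      · exact h₁ ▸ Finset.mem_insert_self _ _
      · exact h₂ ▸ Finset.mem_insert_self _ _
    · intro o h₁ h₂ h₃
      by_cases hr₁ : o.1.1 = r
      · exact .inr (mem_overlapsWith.2 ⟨.inl ⟨hr₁, h₂⟩, h₃⟩)
      by_cases hr₂ : o.1.2 = r
      · exact .inr (mem_overlapsWith.2 ⟨.inr ⟨h₁, hr₂⟩, h₃⟩)
      · exact (hpend o (Finset.mem_of_mem_insert_of_ne h₁ hr₁)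
          (Finset.mem_of_mem_insert_of_ne h₂ hr₂) h₃).imp_right fun h => h.elim
  | overlap todo o hc ho =>
    rw [hc] at hp
    have h₁ := hp o ho
    refine h.set_phase _ ⟨fun o' ho' => hp o' (Finset.mem_of_mem_erase ho'), ?_⟩ ?_
    · have e₁ : φ (overlapLeft o) = φ (overlapWord o) := by
        rw [overlapLeft, overlapWord, he.append, he.append,
          h.core.sound _ (mem_store_considered h₁.1)]
      have e₂ : φ (overlapRight o) = φ (overlapWord o) := by
        rw [h₁.2.2.word_eq, overlapRight, he.append, he.append,
          h.core.sound _ (mem_store_considered h₁.2.1)]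
      exact e₁.trans e₂.symm
    · rw [hc]
      intro o' ho'
      by_cases hoo : o' = o
      · subst hoo
        exact .inr (.inr ⟨.refl _, .refl _,
          rank_overlapLeft (h.core.ordered _ (mem_store_considered h₁.1)),
          rank_overlapRight h₁.2.2 (h.core.ordered _ (mem_store_considered h₁.2.1))⟩)
      · exact .inr (.inl (Finset.mem_erase.2 ⟨hoo, ho'⟩))
  | overlapsDone hc =>
    exact h.set_phase _ trivial (by rw [hc]; exact fun o h => absurd h (Finset.notMem_empty o))
  | resolveLeft c' todo a a' b hc hr =>
    rw [hc] at hp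
    obtain ⟨r, p, q, rfl, rfl, rfl, hlt, hφ, -⟩ := hr.exists_rule he h.core
    have hrX := mem_of_addNew_subset hsub'
    refine h.addNew_phase hlt hφ _ ⟨hp.1, (he.context hφ p q).symm.trans hp.2⟩ ?_
    rw [hc]
    rintro o (ho | ⟨h₁, h₂, h₃, h₄⟩)
    · exact .inr (.inl ho)
    · have h₅ := (rank_append_lt hlt p q).trans h₃
      exact .inr (.inr ⟨h₁.trans (.rule hrX p q h₃ h₅), h₂, h₅, h₄⟩)
  | resolveRight c' todo a b b' hc hirr hr =>
    rw [hc] at hp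
    obtain ⟨r, p, q, rfl, rfl, rfl, hlt, hφ, -⟩ := hr.exists_rule he h.core
    have hrX := mem_of_addNew_subset hsub'
    refine h.addNew_phase hlt hφ _ ⟨hp.1, hp.2.trans (he.context hφ p q)⟩ ?_
    rw [hc]
    rintro o (ho | ⟨h₁, h₂, h₃, h₄⟩)
    · exact .inr (.inl ho)
    · have h₅ := (rank_append_lt hlt p q).trans h₄
      exact .inr (.inr ⟨h₁, h₂.trans (.rule hrX p q h₄ h₅), h₃, h₅⟩)
  | resolveEq todo a hc hirr =>
    rw [hc] at hp
    refine h.set_phase _ hp.1 ?_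
    rw [hc]
    rintro o (ho | ⟨h₁, h₂, -⟩)
    · exact .inr ho
    · exact .inl (h₁.trans h₂.symm)
  | resolveGt todo a b hc _ _ hlt =>
    rw [hc] at hp
    have hrX := mem_of_addNew_subset hsub'
    refine h.addNew_phase (r := (a, b)) (rank_lt_of_sLex hlt) hp.2 _ hp.1 ?_
    rw [hc]
    rintro o (ho | ⟨h₁, h₂, h₃, h₄⟩)
    · exact .inr ho
    · have : Conn X (rank (overlapWord o)) a b := by
        simpa using Conn.rule hrX [] [] (by simpa using h₃) (by simpa using h₄)
      exact .inl (h₁.trans (this.trans h₂.symm))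
  | resolveLt todo a b hc _ _ hlt =>
    rw [hc] at hp
    have hrX := mem_of_addNew_subset hsub'
    refine h.addNew_phase (r := (b, a)) (rank_lt_of_sLex hlt) hp.2.symm _ hp.1 ?_
    rw [hc]
    rintro o (ho | ⟨h₁, h₂, h₃, h₄⟩)
    · exact .inr ho
    · have : Conn X (rank (overlapWord o)) b a := by
        simpa using Conn.rule hrX [] [] (by simpa using h₄) (by simpa using h₃)
      exact .inl (h₁.trans (this.symm.trans h₂.symm))
  | endPass W hc hT hW =>
    rw [hc] at hpend
    have hg := (hW.good he h.core h.core.good).1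
    have hsub : ∀ a ∈ W.needed, a ∈ W.arrows := fun a ha => hg.needed_subset ha
    exact ⟨{ h.core with
        rules_valid := fun a ha => hg.valid a (hsub a ha)
        rules_noDiag := fun a ha => hg.noDiag a (hsub a ha)
        arrows_valid := fun a ha => hg.valid a (hsub a ha)
        arrows_noDiag := fun a ha => hg.noDiag a (hsub a ha)
        needed_subset := Finset.empty_subset _ }, trivial, h.deleted, hpend⟩

end Invariants

end WeldKB

namespace WeldKB

variable {A : Type*} [Fintype A] [LinearOrder A]

/-! ### Runs -/

section Run

variable {G : Type*} [Group G] {inv : A → A} {φ : List A → G} {X : Set (Rule A)}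
  {R I : Finset (Rule A)} {σ : ℕ → Config A}

theorem IsInitialRules.cases (h : IsInitialRules inv R I) {r : Rule A} (hr : r ∈ I) :
    (∃ e ∈ R, IsInitialRule inv e (some r)) ∨ ∃ x, r = ([x, inv x], []) := by
  obtain ⟨choice, hc, rfl⟩ := h
  rcases Finset.mem_union.1 hr with hr | hr
  · obtain ⟨e, he, hr⟩ := Finset.mem_biUnion.1 hr
    rw [Option.mem_toFinset, Option.mem_def] at hr
    exact .inl ⟨e, he, hr ▸ hc e he⟩
  · obtain ⟨x, -, rfl⟩ := Finset.mem_image.1 hr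
    exact .inr ⟨x, rfl⟩

theorem IsInitialRules.cancel_mem (h : IsInitialRules inv R I) (x : A) :
    ([x, inv x], []) ∈ I := by
  obtain ⟨choice, hc, rfl⟩ := h
  exact Finset.mem_union_right _ (Finset.mem_image_of_mem _ (Finset.mem_univ x))

/-- Cyclic reduction is reversible as far as triviality in a group goes, so each relation follows
from its initial rule, and a dropped one follows from the inverse law alone. -/
theorem IsInitialRules.relation (he : IsEval inv φ) (h : IsInitialRules inv R I)
    (hI : ∀ r ∈ I, φ r.1 = φ r.2) {e : Rule A} (heR : e ∈ R) : φ e.1 = φ e.2 := by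
  obtain ⟨choice, hc, rfl⟩ := h
  have h₁ := hc e heR
  cases hce : choice e with
  | none =>
    rw [hce] at h₁
    exact (IsCyclicRelator.eval he h₁).2 he.nil
  | some r =>
    rw [hce] at h₁
    refine (h₁.eval_of_rule he).2 (hI r (Finset.mem_union_left _ ?_))
    exact Finset.mem_biUnion.2 ⟨e, heR, by simp [hce]⟩

theorem inv_start (he : IsEval inv φ) (h : IsInitialRules inv R I)
    (hR : ∀ r ∈ R, φ r.1 = φ r.2) : Inv inv φ X (start inv I) := by
  have hI : ∀ r ∈ I, φ r.1 = φ r.2 ∧ rank r.2 < rank r.1 := by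
    intro r hr
    rcases h.cases hr with ⟨e, heR, hr⟩ | ⟨x, rfl⟩
    · exact ⟨(hr.eval_of_rule he).1 (hR e heR), rank_lt_of_sLex hr.2.sLex⟩
    · exact ⟨he.cancel x, rank_lt_of_length (by simp)⟩
  have hv : ∀ a ∈ I.biUnion (ruleAutomaton inv), a.Valid φ := by
    intro a ha
    obtain ⟨r, hr, ha⟩ := Finset.mem_biUnion.1 ha
    exact ruleAutomaton_valid he (hI r hr).1 a ha
  have hg : (weld ⟨I.biUnion (ruleAutomaton inv), I.biUnion (ruleAutomaton inv)⟩ [] []).Good φ :=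
    WDiff.good_weld he hv (Finset.Subset.refl _) rfl
  refine ⟨⟨?_, ?_, ?_, ?_, ?_, hg.valid, hg.noDiag, hg.valid, hg.noDiag, hg.needed_subset⟩,
    trivial, ?_, ?_⟩
  · exact fun r hr => absurd hr (Finset.notMem_empty r)
  · exact fun r _ => ⟨Finset.notMem_empty r, Finset.notMem_empty r⟩
  · exact fun r _ => Finset.notMem_empty r
  · exact fun r hr => (hI r (by simpa [start] using hr)).2
  · exact fun r hr => (hI r (by simpa [start] using hr)).1
  · exact fun r hr => absurd hr (Finset.notMem_empty r)
  · exact fun o ho => absurd ho (Finset.notMem_empty _)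

/-- The rules which occur in the store at some time. -/
def everStored (σ : ℕ → Config A) : Set (Rule A) := {r | ∃ t, r ∈ (σ t).store}

theorem IsRun.initial_subset (hσ : IsRun inv R σ) :
    ∃ I, IsInitialRules inv R I ∧ ∀ r ∈ I, r ∈ everStored σ := by
  obtain ⟨⟨I, hI, h₀⟩, -⟩ := hσ
  refine ⟨I, hI, fun r hr => ⟨0, ?_⟩⟩
  rw [h₀]
  simpa [Config.store, start] using hr

theorem IsRun.cancel_mem (hσ : IsRun inv R σ) (x : A) : ([x, inv x], []) ∈ everStored σ := by
  obtain ⟨I, hI, hsub⟩ := hσ.initial_subset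
  exact hsub _ (hI.cancel_mem x)

theorem IsRun.invariant (hinv : Function.Involutive inv) (he : IsEval inv φ) (hσ : IsRun inv R σ)
    (hR : ∀ r ∈ R, φ r.1 = φ r.2) (t : ℕ) : Inv inv φ (everStored σ) (σ t) := by
  induction t with
  | zero =>
    obtain ⟨⟨I, hI, h₀⟩, -⟩ := hσ
    rw [h₀]
    exact inv_start he hI hR
  | succ t ih =>
    exact (hσ.2 t).preserves_inv hinv he hσ.cancel_mem (fun r hr => ⟨t, hr⟩)
      (fun r hr => ⟨t + 1, hr⟩) ih

/-- The stored rules generate the congruence of the presentation. -/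
theorem IsRun.thue_iff (hinv : Function.Involutive inv) (hσ : IsRun inv R σ)
    (hR : ∀ x : A, ([x, inv x], []) ∈ R) {u v : List A} :
    Thue (↑R) u v ↔ Thue (everStored σ) u v := by
  constructor
  · intro h
    -- In the group presented by the stored rules the initial rules hold, hence so do the relations.
    obtain ⟨G, _, φ, he, hφ⟩ := exists_isEval hinv (everStored σ) hσ.cancel_mem
    obtain ⟨I, hI, hsub⟩ := hσ.initial_subset
    rw [hφ]
    exact he.thue (fun r hr => hI.relation he
      (fun r hr => (hφ _ _).1 (Thue.of_mem (hsub r hr))) hr) h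
  · intro h
    -- In the group of the presentation the invariants make every stored rule hold.
    obtain ⟨G, _, φ, he, hφ⟩ := exists_isEval hinv (R : Set (Rule A)) hR
    rw [hφ]
    refine he.thue (X := everStored σ) ?_ h
    rintro r ⟨t, hr⟩
    exact (hσ.invariant hinv he (fun r hr => (hφ _ _).1 (Thue.of_mem hr)) t).core.sound r hr

/-- A rule which leaves the store is derivable from lighter rules. -/
theorem Step.derivable_of_notMem {c c' : Config A} (h : Inv inv φ X c) (hs : Step inv c c')
    {r : Rule A} (hr : r ∈ c.store) (hr' : r ∉ c'.store) : Derivable X r := by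
  have hp := h.phase
  have hadd : ∀ s, r ∈ (c.addNew s).store := fun s => by
    rw [store_addNew]; exact Finset.mem_insert_of_mem hr
  have hstep : ∀ c'' w w', RStep (c, w) (c'', w') → r ∈ c''.store := by
    rintro c'' w w' ⟨p, l, q, ρ, -, -, -, heq⟩
    rw [(Prod.mk.inj heq).1]
    exact hadd _
  -- Only two operations shrink S: emptying `Delete`, for whose rules derivability is an invariant,
  -- and `discardNow`.
  cases hs with
  | beginPass hc =>
    refine h.deleted r ?_
    simp only [Config.store, Finset.mem_union, Finset.notMem_empty, or_false, not_or] at hr hr'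
    tauto
  | front c' todo inp w w' x v e hc hs => exact absurd (hstep _ _ _ hs) hr'
  | back c' todo inp w w' x v e hc hs => exact absurd (hstep _ _ _ hs) hr'
  | whole c' todo inp u u' v e hc hne hs => exact absurd (hstep _ _ _ hs) hr'
  | rhs c' todo inp u v v' e hc hs => exact absurd (hstep _ _ _ hs) hr'
  | resolveLeft c' todo a a' b hc hs => exact absurd (hstep _ _ _ hs) hr'
  | resolveRight c' todo a b b' hc hirr hs => exact absurd (hstep _ _ _ hs) hr'
  | resolveGt todo a b hc h₁ h₂ hlt => exact absurd (hadd _) hr'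
  | resolveLt todo a b hc h₁ h₂ hlt => exact absurd (hadd _) hr'
  | promote todo inp out hc heq hn =>
    exfalso
    simp only [Config.store, Finset.mem_union, Finset.mem_insert, Finset.mem_erase] at hr hr'
    tauto
  | install todo inp out hc hne hne' hnew =>
    exfalso
    simp only [Config.store, Finset.mem_union, Finset.mem_insert] at hr hr'
    tauto
  | take s hc hs =>
    exfalso
    simp only [Config.store, Finset.mem_union, Finset.mem_insert, Finset.mem_erase] at hr hr'
    tauto
  | discardNow todo inp out hc hred =>
    rw [hc] at hp
    obtain ⟨h₁, h₂, h₃, ho, ht, hx⟩ := hp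
    have : r = inp := by
      simp only [Config.store, Finset.mem_union, Finset.mem_erase] at hr hr'
      tauto
    exact this ▸ ho.derivable (hx rfl).1 (hx rfl).2
  | discardLater todo inp out hc hred =>
    exfalso
    simp only [Config.store, Finset.mem_union, Finset.mem_insert, Finset.mem_erase] at hr hr'
    tauto
  | _ => exact absurd hr hr'

end Run

end WeldKB

namespace WeldKB

variable {A : Type*} [Fintype A] [LinearOrder A]

/-! ### Confluence -/

section Confluence

variable {X P : Set (Rule A)}

/-- The set `P` of rules of `X` suffices for rewriting: all other rules of `X` are derivable from
lighter ones, no left-hand side of `P` occurs properly inside another one, and the critical pairs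
of `P` are resolved. -/
structure Complete (X P : Set (Rule A)) : Prop where
  subset : P ⊆ X
  ordered : ∀ r ∈ X, rank r.2 < rank r.1
  derivable : ∀ r ∈ X, r ∈ P ∨ Derivable X r
  resolved : ∀ r₁ ∈ P, ∀ r₂ ∈ P, ∀ k, IsOverlap ((r₁, r₂), k) → Resolved X ((r₁, r₂), k)
  minimal : ∀ r₁ ∈ P, ∀ r₂ ∈ P, ¬ r₂.1 <:+: r₁.1.dropLast

theorem Complete.rank_lt_of_rewrites (h : Complete X P) {u v : List A} (huv : Rewrites X u v) :
    rank v < rank u := by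
  obtain ⟨r, hr, s, w, rfl, rfl⟩ := huv
  exact rank_append_lt (h.ordered r hr) s w

/-- A derivation of `r` begins, after its last visit to `r.1`, with a lighter rule. -/
theorem Complete.exists_lighter (h : Complete X P) {r : Rule A} (hr : r ∈ X)
    (hd : Derivable X r) :
    ∃ r' ∈ lighter X r, ∃ s w, r.1 = s ++ r'.1 ++ w ∧
      Conn X (rank r.1) (s ++ r'.2 ++ w) r.2 := by
  have key : ∀ b, Conn (lighter X r) (rank r.1 + 1) r.1 b → b = r.1 ∨
      ∃ r' ∈ lighter X r, ∃ s w, r.1 = s ++ r'.1 ++ w ∧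
        Conn X (rank r.1) (s ++ r'.2 ++ w) b := by
    intro b hb
    induction hb with
    | refl => exact .inl rfl
    | @tail b c _ hl ih =>
      -- A return to `r.1` discards the chain built so far; a step away from `r.1` must lead down,
      -- as the bound excludes larger strings.
      by_cases hc : c = r.1
      · exact .inl hc
      have hcr : rank c < rank r.1 :=
        lt_of_le_of_ne (Nat.lt_succ_iff.1 hl.2.1) fun e => hc (rank_injective e)
      rcases ih with rfl | ⟨r', hr', s, w, hsw, hconn⟩
      · rcases hl.2.2 with ⟨r', hr', s, w, hs, rfl⟩ | hrw
        · exact .inr ⟨r', hr', s, w, hs, .refl _⟩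
        · obtain ⟨r', hr', hrw⟩ := hrw
          have := h.rank_lt_of_rewrites ⟨r', hr'.1, hrw⟩
          omega
      · refine .inr ⟨r', hr', s, w, hsw, hconn.trans (Relation.ReflTransGen.single ⟨?_, hcr, ?_⟩)⟩
        · refine hconn.rank_lt ?_
          rw [hsw]
          exact rank_append_lt (h.ordered r' hr'.1) s w
        · exact hl.2.2.imp (fun ⟨r, hr, h⟩ => ⟨r, hr.1, h⟩) (fun ⟨r, hr, h⟩ => ⟨r, hr.1, h⟩)
  refine (key r.2 hd).resolve_left fun e => ?_
  have := h.ordered r hr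
  rw [e] at this
  exact lt_irrefl _ this

/-- A rewriting by any rule may be replaced by a rewriting by a rule of `P`. -/
theorem Complete.exists_mem (h : Complete X P) {r : Rule A} (hr : r ∈ X) (s w : List A) :
    ∃ r' ∈ P, ∃ s' w', s ++ r.1 ++ w = s' ++ r'.1 ++ w' ∧
      Conn X (rank (s ++ r.1 ++ w)) (s ++ r.2 ++ w) (s' ++ r'.2 ++ w') := by
  induction hn : weight r using Nat.strong_induction_on generalizing r s w with
  | _ n ih =>
  subst hn
  rcases h.derivable r hr with hP | hd
  · exact ⟨r, hP, s, w, rfl, .refl _⟩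
  · obtain ⟨r', hr', s', w', hsw, hconn⟩ := h.exists_lighter hr hd
    -- The lighter rule acts on the same string `s ++ r.1 ++ w`, in a larger context, so the bound
    -- of the chains does not change.
    obtain ⟨r'', hr'', s'', w'', hsw', hconn'⟩ :=
      ih _ hr'.2 hr'.1 (s ++ s') (w' ++ w) rfl
    have e : s ++ r.1 ++ w = s ++ s' ++ r'.1 ++ (w' ++ w) := by rw [hsw]; simp
    refine ⟨r'', hr'', s'', w'', e.trans hsw', ?_⟩
    have h₁ := (hconn.context s w).symm
    have e' : s ++ (s' ++ r'.2 ++ w') ++ w = s ++ s' ++ r'.2 ++ (w' ++ w) := by simp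
    rw [e'] at h₁
    rw [← e] at hconn'
    exact h₁.trans hconn'

theorem Complete.disjoint_peak (h : Complete X P) {r₁ r₂ : Rule A} (h₁ : r₁ ∈ X) (h₂ : r₂ ∈ X)
    (s q w : List A) :
    Conn X (rank (s ++ r₁.1 ++ q ++ r₂.1 ++ w)) (s ++ r₁.2 ++ q ++ r₂.1 ++ w)
      (s ++ r₁.1 ++ q ++ r₂.2 ++ w) := by
  have e₁ := rank_append_lt (h.ordered r₁ h₁) s (q ++ r₂.1 ++ w)
  have e₂ := rank_append_lt (h.ordered r₂ h₂) (s ++ r₁.1 ++ q) w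
  have e₃ := rank_append_lt (h.ordered r₁ h₁) s (q ++ r₂.2 ++ w)
  have c₁ := Conn.rule (n := rank (s ++ r₁.1 ++ q ++ r₂.1 ++ w)) h₂ (s ++ r₁.2 ++ q) w
    (by simp only [List.append_assoc] at *; omega) (by simp only [List.append_assoc] at *; omega)
  have c₂ := Conn.rule (n := rank (s ++ r₁.1 ++ q ++ r₂.1 ++ w)) h₁ s (q ++ r₂.2 ++ w)
    (by simp only [List.append_assoc] at *; omega) (by simp only [List.append_assoc] at *; omega)
  simp only [List.append_assoc] at *
  exact c₁.trans c₂.symm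

theorem Complete.overlap_peak (h : Complete X P) {r₁ r₂ : Rule A} (h₁ : r₁ ∈ P) (h₂ : r₂ ∈ P)
    {p z q : List A} (e₁ : r₁.1 = p ++ z) (e₂ : r₂.1 = z ++ q) (s w : List A) :
    Conn X (rank (s ++ p ++ z ++ q ++ w)) (s ++ r₁.2 ++ q ++ w) (s ++ p ++ r₂.2 ++ w) := by
  -- An empty `z` is no overlap in the sense of `IsOverlap`; the two left-hand sides are then
  -- adjacent and disjoint.
  by_cases hz : z = []
  · subst hz
    rw [List.append_nil] at e₁
    rw [List.nil_append] at e₂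
    subst e₁ e₂
    simpa using h.disjoint_peak (h.subset h₁) (h.subset h₂) s [] w
  · have ho : IsOverlap ((r₁, r₂), z.length) := by
      refine ⟨List.length_pos_iff.2 hz, ?_, ?_, ?_⟩ <;> simp [e₁, e₂]
    have := (h.resolved r₁ h₁ r₂ h₂ _ ho).context s w
    simp only [overlapWord, overlapLeft, overlapRight, e₁, e₂, List.drop_left,
      List.length_append, Nat.add_sub_cancel, List.take_left] at this
    simpa using this

theorem Complete.ordered_peak (h : Complete X P) {r₁ r₂ : Rule A} (h₁ : r₁ ∈ P) (h₂ : r₂ ∈ P)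
    {s p w₁ w₂ : List A} (e : r₁.1 ++ w₁ = p ++ (r₂.1 ++ w₂)) :
    Conn X (rank (s ++ r₁.1 ++ w₁)) (s ++ r₁.2 ++ w₁) (s ++ p ++ r₂.2 ++ w₂) := by
  rcases List.append_eq_append_iff.1 e with ⟨q, rfl, rfl⟩ | ⟨z, hz, hz'⟩
  · simpa using h.disjoint_peak (h.subset h₁) (h.subset h₂) s q w₂
  · rcases List.append_eq_append_iff.1 hz' with ⟨q, rfl, rfl⟩ | ⟨q, hq, rfl⟩
    · rcases List.eq_nil_or_concat q with rfl | ⟨q, a, rfl⟩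
      · have := h.overlap_peak h₁ h₂ (p := p) (z := r₂.1) (q := []) (by simpa using hz)
          (by simp) s w₁
        simpa [hz] using this
      · refine absurd ⟨p, q, ?_⟩ (h.minimal r₁ h₁ r₂ h₂)
        rw [hz, List.concat_eq_append, ← List.append_assoc, ← List.append_assoc,
          List.dropLast_concat]
    · have := h.overlap_peak h₁ h₂ hz hq s w₂
      simpa [hz] using this

/-- Every peak is connected below its top. -/
theorem Complete.peak (h : Complete X P) {m u v : List A} (hu : Rewrites X m u)
    (hv : Rewrites X m v) : Conn X (rank m) u v := by
  obtain ⟨r₁, h₁, s₁, w₁, e₁, rfl⟩ := hu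
  obtain ⟨r₂, h₂, s₂, w₂, e₂, rfl⟩ := hv
  obtain ⟨r₁', h₁', s₁', w₁', e₁', c₁⟩ := h.exists_mem h₁ s₁ w₁
  obtain ⟨r₂', h₂', s₂', w₂', e₂', c₂⟩ := h.exists_mem h₂ s₂ w₂
  rw [← e₁] at e₁' c₁
  rw [← e₂] at e₂' c₂
  refine c₁.trans (Conn.trans ?_ c₂.symm)
  have e : s₁' ++ (r₁'.1 ++ w₁') = s₂' ++ (r₂'.1 ++ w₂') := by
    rw [← List.append_assoc, ← List.append_assoc, ← e₁', ← e₂']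
  rcases List.append_eq_append_iff.1 e with ⟨p, rfl, hp⟩ | ⟨p, rfl, hp⟩
  · rw [e₁']
    exact h.ordered_peak h₁' h₂' hp
  · rw [e₂']
    exact (h.ordered_peak h₂' h₁' hp).symm

/-- The strings have a common descendant. -/
def Joins (X : Set (Rule A)) (u v : List A) : Prop :=
  ∃ w, Relation.ReflTransGen (Rewrites X) u w ∧ Relation.ReflTransGen (Rewrites X) v w

theorem joins_of_rewrites {u v : List A} (h : Rewrites X u v) : Joins X u v :=
  ⟨v, .single h, .refl⟩

theorem Joins.symm {u v : List A} (h : Joins X u v) : Joins X v u :=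
  let ⟨w, h₁, h₂⟩ := h
  ⟨w, h₂, h₁⟩

/-- Newman's argument with joinability of peaks weakened to connectedness below the top: by
induction everything below `m` is confluent, so a chain below `m` can be contracted link by link
into a common descendant. -/
theorem Complete.confluent (h : Complete X P) {m u v : List A}
    (hu : Relation.ReflTransGen (Rewrites X) m u) (hv : Relation.ReflTransGen (Rewrites X) m v) :
    Joins X u v := by
  induction hn : rank m using Nat.strong_induction_on generalizing m u v with
  | _ n ih =>
  subst hn
  rcases hu.cases_head with rfl | ⟨u₁, hu₁, hu₂⟩
  · exact ⟨v, hv, .refl⟩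
  rcases hv.cases_head with rfl | ⟨v₁, hv₁, hv₂⟩
  · exact ⟨u, .refl, hu⟩
  have key : ∀ x, Conn X (rank m) u₁ x → Joins X u₁ x := by
    intro x hx
    induction hx with
    | refl => exact ⟨u₁, .refl, .refl⟩
    | @tail b c _ hl ihx =>
      obtain ⟨y, hy₁, hy₂⟩ := ihx
      rcases hl.2.2 with hbc | hcb
      · obtain ⟨z, hz₁, hz₂⟩ := ih _ hl.1 hy₂ (.single hbc) rfl
        exact ⟨z, hy₁.trans hz₁, hz₂⟩
      · exact ⟨y, hy₁, .head hcb hy₂⟩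
  obtain ⟨x, hx₁, hx₂⟩ := key v₁ (h.peak hu₁ hv₁)
  obtain ⟨y, hy₁, hy₂⟩ := ih _ (h.rank_lt_of_rewrites hu₁) hu₂ hx₁ rfl
  obtain ⟨z, hz₁, hz₂⟩ := ih _ (h.rank_lt_of_rewrites hv₁) hv₂ (hx₂.trans hy₂) rfl
  exact ⟨z, hy₁.trans hz₂, hz₁⟩

theorem Complete.joins_of_thue (h : Complete X P) {u v : List A} (huv : Thue X u v) :
    Joins X u v := by
  induction huv with
  | rel _ _ h => exact joins_of_rewrites h
  | refl x => exact ⟨x, .refl, .refl⟩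
  | symm _ _ _ ih => exact ih.symm
  | trans _ _ _ _ _ ih₁ ih₂ =>
    obtain ⟨a, h₁, h₂⟩ := ih₁
    obtain ⟨b, h₃, h₄⟩ := ih₂
    obtain ⟨c, h₅, h₆⟩ := h.confluent h₂ h₃
    exact ⟨c, h₁.trans h₅, h₄.trans h₆⟩

theorem eq_of_not_reducible {u v : List A} (hu : ¬ Reducible X u)
    (h : Relation.ReflTransGen (Rewrites X) u v) : u = v := by
  rcases h.cases_head with rfl | ⟨w, hw, -⟩
  · rfl
  · exact absurd ⟨w, hw⟩ hu

/-- Irreducible strings of the same class are equal. -/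
theorem Complete.eq_of_thue (h : Complete X P) {u v : List A} (hu : ¬ Reducible X u)
    (hv : ¬ Reducible X v) (huv : Thue X u v) : u = v := by
  obtain ⟨w, h₁, h₂⟩ := h.joins_of_thue huv
  exact (eq_of_not_reducible hu h₁).trans (eq_of_not_reducible hv h₂).symm

theorem Complete.exists_infix (h : Complete X P) {u : List A} (hu : Reducible X u) :
    ∃ r ∈ P, r.1 <:+: u := by
  obtain ⟨r, hr, s, w, rfl⟩ := reducible_iff.1 hu
  obtain ⟨r', hr', s', w', e, -⟩ := h.exists_mem hr s w
  exact ⟨r', hr', s', w', e.symm⟩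

end Confluence

end WeldKB

namespace WeldKB

variable {A : Type*} [Fintype A] [LinearOrder A]

/-! ### Passes end -/

section Termination

variable {G : Type*} [Group G] {inv : A → A} {φ : List A → G} {X : Set (Rule A)} {c c' : Config A}

/-- The phases of a pass before the rules of `This` are compared. -/
def Phase.IsScan : Phase A → Prop
  | .scan _ => True
  | .minimize _ _ _ _ _ => True
  | .handle _ _ _ _ => True
  | _ => False

/-- The rules which are or may come to be in `New` during the present scan, up to a bound. -/
def avail (K : ℕ) (C T N D : Finset (Rule A)) (M : Finset (Arrow A)) : Set (Rule A) :=
  {r | rank r.1 ≤ K ∧ rank r.2 ≤ K ∧ r ∉ C ∧ r ∉ T ∧ r ∉ D ∧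
    (r ∈ N ∨ ∀ x, x <:+: r.1 → x ≠ r.1 → ¬ Reducible (setOfRules M) x)}

theorem finite_avail (K : ℕ) (C T N D : Finset (Rule A)) (M : Finset (Arrow A)) :
    (avail K C T N D M).Finite :=
  ((finite_rank_le K).prod (finite_rank_le K)).subset fun _ h => ⟨h.1, h.2.1⟩

/-- A quadruple of numbers, in the lexicographic order. -/
def lex4 (a b c d : ℕ) : ℕ ×ₗ ℕ ×ₗ ℕ ×ₗ ℕ := toLex (a, toLex (b, toLex (c, d)))

theorem lex4_lt {a b c d a' b' c' d' : ℕ}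
    (h : a' < a ∨ a' = a ∧ (b' < b ∨ b' ≤ b ∧ (c' < c ∨ c' = c ∧ d' < d))) :
    lex4 a' b' c' d' < lex4 a b c d := by
  simp only [lex4, Prod.Lex.toLex_lt_toLex]
  rcases h with h | ⟨rfl, h | ⟨h, h'⟩⟩
  · exact .inl h
  · exact .inr ⟨rfl, .inl h⟩
  · rcases h.lt_or_eq with h | rfl
    · exact .inr ⟨rfl, .inl h⟩
    · exact .inr ⟨rfl, .inr ⟨rfl, h'⟩⟩

def HandleLine.idx : HandleLine → ℕ
  | .sew => 2
  | .install => 1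
  | .discard => 0

/-- The rules of `Considered` and of `New` which remain to be handled, where `n` counts the rules
available for `New`. -/
def remaining (n : ℕ) (N todo : Finset (Rule A)) (inp : Rule A) : ℕ :=
  todo.card + (if inp ∈ N then 0 else 1) + n

/-- The first entry separates scanning from comparing, the second counts rules still to be dealt
with, the third the stages for one rule, the fourth the progress within a stage. The factor 20 lets
a loss of weight outweigh any jump back among the ten lines. The value at `beginPass` plays no role.
-/
noncomputable def phaseMeasure (n : ℕ) (T N : Finset (Rule A)) : Phase A → ℕ ×ₗ ℕ ×ₗ ℕ ×ₗ ℕ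
  | .beginPass => lex4 0 0 0 0
  | .scan todo => lex4 1 (todo.card + n) 2 0
  | .minimize todo inp line cur e => lex4 1 (remaining n N todo inp) 1
      (20 * (weight cur + weight e) + (10 - line.idx))
  | .handle todo inp _ line => lex4 1 (remaining n N todo inp) 0 line.idx
  | .compare => lex4 0 T.card 0 0
  | .overlaps todo => lex4 0 T.card (2 * todo.card + 1) 0
  | .resolve todo a b => lex4 0 T.card (2 * todo.card + 2) (rank a + rank b)

/-- A measure which decreases until the pass ends. -/
noncomputable def passMeasure (K : ℕ) (c : Config A) : ℕ ×ₗ ℕ ×ₗ ℕ ×ₗ ℕ :=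
  phaseMeasure (avail K c.considered c.thisRules c.newRules c.deleteRules c.rules).ncard
    c.thisRules c.newRules c.phase

/-- The ranks of the left-hand sides are at most `K`. -/
def Config.Bounded (K : ℕ) (c : Config A) : Prop := ∀ r ∈ c.store, rank r.1 ≤ K

/-- The left-hand side of a rule created by rapid reduction has only R-irreducible proper
substrings, so any such rule that counts as available afterwards did so before. -/
theorem avail_addNew_subset {K : ℕ} {r : Rule A}
    (hmin : ∀ x, x <:+: r.1 → x ≠ r.1 → ¬ RReducible c x) :
    avail K c.considered c.thisRules (c.addNew r).newRules c.deleteRules c.rules ⊆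
      avail K c.considered c.thisRules c.newRules c.deleteRules c.rules := by
  rintro s ⟨h₁, h₂, h₃, h₄, h₅, h₆⟩
  refine ⟨h₁, h₂, h₃, h₄, h₅, ?_⟩
  rcases h₆ with h₆ | h₆
  · rcases mem_newRules_addNew.1 h₆ with h₆ | ⟨rfl, -⟩
    · exact .inl h₆
    · exact .inr hmin
  · exact .inr h₆

/-- A reduction step during minimization. -/
theorem Inv.measure_rStep (he : IsEval inv φ) (h : Inv inv φ X c) {K : ℕ} {todo : Finset (Rule A)}
    {inp cur cur' e : Rule A} {line : MinLine} {w w' : List A}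
    (hc : c.phase = .minimize todo inp line cur e) (hb : c.Bounded K)
    (hs : RStep (c, w) (c', w')) (hw : w <:+: cur.1 ∨ w <:+: cur.2)
    (hlt : weight cur' < weight cur) :
    Config.Bounded K { c' with phase := .minimize todo inp line cur' e } ∧
      passMeasure K { c' with phase := .minimize todo inp line cur' e } < passMeasure K c := by
  obtain ⟨r, p, q, rfl, rfl, rfl, hr, hφ, hmin⟩ := hs.exists_rule he h.core
  have hp := h.phase
  rw [hc] at hp
  obtain ⟨h₁, h₂, h₃, hm⟩ := hp
  have hinp := hb inp (h₃.elim mem_store_considered mem_store_new)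
  have hrK : rank r.1 ≤ K := by
    have hrw : r.1 <:+: p ++ r.1 ++ q := ⟨p, q, rfl⟩
    have hs := h.inp_ordered h₃
    rcases hw with hw | hw
    · exact (rank_infix_le (hrw.trans hw)).trans ((rank_fst_le_of_weight hs hm.le_input).trans hinp)
    · exact (rank_infix_le (hrw.trans hw)).trans
        ((rank_snd_lt_of_weight hs hm.le_input).le.trans hinp)
  constructor
  · intro s hs
    change s ∈ (c.addNew r).store at hs
    rw [store_addNew, Finset.mem_insert] at hs
    rcases hs with rfl | hs
    · exact hrK
    · exact hb s hs
  · rw [addNew_eq]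
    simp only [passMeasure, hc, phaseMeasure]
    refine lex4_lt (.inr ⟨rfl, .inr ⟨?_, .inr ⟨rfl, by omega⟩⟩⟩)
    refine Nat.add_le_add (Nat.add_le_add_left ?_ _)
      (Set.ncard_le_ncard (avail_addNew_subset hmin) (finite_avail _ _ _ _ _ _))
    by_cases hi : inp ∈ c.newRules
    · simp [hi, mem_newRules_addNew]
    · simp only [hi, if_false]
      split_ifs <;> simp

/-- A step of minimization without reduction. -/
theorem measure_minimize {K : ℕ} {todo : Finset (Rule A)}
    {inp cur cur' e e' : Rule A} {line line' : MinLine}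
    (hc : c.phase = .minimize todo inp line cur e) (hb : c.Bounded K)
    (hlt : 20 * (weight cur' + weight e') + (10 - line'.idx) <
      20 * (weight cur + weight e) + (10 - line.idx)) :
    Config.Bounded K { c with phase := .minimize todo inp line' cur' e' } ∧
      passMeasure K { c with phase := .minimize todo inp line' cur' e' } < passMeasure K c := by
  refine ⟨hb, ?_⟩
  simp only [passMeasure, hc, phaseMeasure]
  exact lex4_lt (.inr ⟨rfl, .inr ⟨le_rfl, .inr ⟨rfl, hlt⟩⟩⟩)

/-- The handling of a rule is completed. -/
theorem measure_handle {n n' : ℕ} {T N T' N' : Finset (Rule A)} {todo : Finset (Rule A)}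
    {inp out : Rule A} {line : HandleLine} (hn : n' ≤ n) (h : inp ∈ N → n' < n) :
    phaseMeasure n' T' N' (.scan todo) < phaseMeasure n T N (.handle todo inp out line) := by
  simp only [phaseMeasure, remaining]
  refine lex4_lt (.inr ⟨rfl, .inl ?_⟩)
  split_ifs with hi
  · have := h hi
    omega
  · omega

theorem Inv.inp_mem_avail (h : Inv inv φ X c) {K : ℕ} (hb : c.Bounded K) {r : Rule A}
    (hr : r ∈ c.newRules) :
    r ∈ avail K c.considered c.thisRules c.newRules c.deleteRules c.rules := by
  refine ⟨hb r (mem_store_new hr), (h.inp_ordered (.inr hr)).le.trans (hb r (mem_store_new hr)),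
    fun h' => (h.core.disj_considered r h').2.1 hr, fun h' => (h.core.disj_this r h').1 hr,
    h.core.disj_new r hr, .inl hr⟩

theorem ncard_lt_of_notMem {s t : Set (Rule A)} (hst : s ⊆ t) (ht : t.Finite) {r : Rule A}
    (hr : r ∈ t) (hr' : r ∉ s) : s.ncard < t.ncard :=
  Set.ncard_lt_ncard ⟨hst, fun h => hr' (h hr)⟩ ht

set_option maxHeartbeats 2000000 in
-- `Rules` is constant during a scan, so the available rules never increase. A handled rule of `New`
-- ceases to be available: it goes to `This` or `Delete`, or it is deleted at once. After the scan
-- `New` may grow freely, since it is no longer counted.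
theorem Step.measure_lt (he : IsEval inv φ) (h : Inv inv φ X c) (hs : Step inv c c') {K : ℕ}
    (hb : c.phase.IsScan → c.Bounded K) (h₀ : c.phase ≠ .beginPass)
    (h₁ : c'.phase ≠ .beginPass) :
    (c'.phase.IsScan → c'.Bounded K) ∧ passMeasure K c' < passMeasure K c := by
  have hp := h.phase
  cases hs with
  | beginPass hc => exact absurd hc h₀
  | endPass W hc hT hW => exact absurd rfl h₁
  | pickConsidered todo r hc hr =>
    rw [hc] at hp
    refine ⟨fun _ => hb (by rw [hc]; trivial), ?_⟩
    simp only [passMeasure, hc, phaseMeasure, remaining]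
    refine lex4_lt (.inr ⟨rfl, .inr ⟨?_, .inl (by decide)⟩⟩)
    have := Finset.card_erase_add_one hr
    split_ifs <;> omega
  | pickNew r hc hr =>
    refine ⟨fun _ => hb (by rw [hc]; trivial), ?_⟩
    simp only [passMeasure, hc, phaseMeasure, remaining, hr, if_true]
    exact lex4_lt (.inr ⟨rfl, .inr ⟨by omega, .inl (by decide)⟩⟩)
  | scanDone hc hn =>
    refine ⟨fun h => h.elim, ?_⟩
    simp only [passMeasure, hc, phaseMeasure]
    exact lex4_lt (.inl (by decide))
  | front c' todo inp w w' x v e hc hr =>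
    have := h.measure_rStep (cur' := (w' ++ [x], v)) he hc (hb (by rw [hc]; trivial)) hr
      (.inl ⟨[], [x], rfl⟩) (weight_lt_fst (by
        simpa using rank_append_lt (hr.eval he h.core).2.1 [] [x]))
    exact ⟨fun _ => this.1, this.2⟩
  | back c' todo inp w w' x v e hc hr =>
    have := h.measure_rStep (cur' := (x :: w', v)) he hc (hb (by rw [hc]; trivial)) hr
      (.inl ⟨[x], [], by simp⟩) (weight_lt_fst (by
        simpa using rank_append_lt (hr.eval he h.core).2.1 [x] []))
    exact ⟨fun _ => this.1, this.2⟩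
  | whole c' todo inp u u' v e hc hne hr =>
    have := h.measure_rStep (cur' := (u', v)) he hc (hb (by rw [hc]; trivial)) hr
      (.inl (List.infix_refl _)) (weight_lt_fst (hr.eval he h.core).2.1)
    exact ⟨fun _ => this.1, this.2⟩
  | rhs c' todo inp u v v' e hc hr =>
    have := h.measure_rStep (cur' := (u, v')) he hc (hb (by rw [hc]; trivial)) hr
      (.inr (List.infix_refl _)) (weight_lt_snd (hr.eval he h.core).2.1)
    exact ⟨fun _ => this.1, this.2⟩
  | frontSame todo inp w x v e hc hirr heq =>
    have := measure_minimize hc (hb (by rw [hc]; trivial)) (line' := .back)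
      (cur' := (w ++ [x], v)) (e' := e) (by simp only [MinLine.idx]; omega)
    exact ⟨fun _ => this.1, this.2⟩
  | frontChanged todo inp w x v e hc hirr heq =>
    have := measure_minimize hc (hb (by rw [hc]; trivial)) (line' := .whole)
      (cur' := (w ++ [x], v)) (e' := e) (by simp only [MinLine.idx]; omega)
    exact ⟨fun _ => this.1, this.2⟩
  | backDone todo inp w x v e hc hirr =>
    have := measure_minimize hc (hb (by rw [hc]; trivial)) (line' := .whole)
      (cur' := (x :: w, v)) (e' := e) (by simp only [MinLine.idx]; omega)
    exact ⟨fun _ => this.1, this.2⟩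
  | wholeDone todo inp u v e hc hirr =>
    rw [hc] at hp
    have hle := hp.2.2.2.le_entry
    have := measure_minimize hc (hb (by rw [hc]; trivial)) (line' := .shorten)
      (cur' := (u, v)) (e' := (u, v)) (by simp only [MinLine.idx]; omega)
    exact ⟨fun _ => this.1, this.2⟩
  | tidy todo inp line r line' r' e hc ht =>
    have hlt : 20 * (weight r' + weight e) + (10 - line'.idx) <
        20 * (weight r + weight e) + (10 - line.idx) := by
      have h9 : line'.idx ≤ 9 := by cases line' <;> simp [MinLine.idx]
      rcases ht.weight_lt_or with hlt | ⟨rfl, hlt⟩ <;> omega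
    have := measure_minimize hc (hb (by rw [hc]; trivial)) hlt
    exact ⟨fun _ => this.1, this.2⟩
  | rhsDone todo inp u v e hc hirr =>
    have := measure_minimize hc (hb (by rw [hc]; trivial)) (line' := .swap)
      (cur' := (u, v)) (e' := e) (by simp only [MinLine.idx]; omega)
    exact ⟨fun _ => this.1, this.2⟩
  | again todo inp r e hc hne =>
    rw [hc] at hp
    have hlt := hp.2.2.2.loop.resolve_right fun h => hne h.1
    have := measure_minimize hc (hb (by rw [hc]; trivial)) (line' := .shorten)
      (cur' := r) (e' := r) (by simp only [MinLine.idx]; omega)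
    exact ⟨fun _ => this.1, this.2⟩
  | output todo inp r e hc heq =>
    refine ⟨fun _ => hb (by rw [hc]; trivial), ?_⟩
    simp only [passMeasure, hc, phaseMeasure]
    exact lex4_lt (.inr ⟨rfl, .inr ⟨le_rfl, .inl (by decide)⟩⟩)
  | sew todo inp out W hc hne hW =>
    refine ⟨fun _ => hb (by rw [hc]; trivial), ?_⟩
    simp only [passMeasure, hc, phaseMeasure]
    exact lex4_lt (.inr ⟨rfl, .inr ⟨le_rfl, .inr ⟨rfl, by decide⟩⟩⟩)
  | sewNothing todo inp out hc heq =>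
    refine ⟨fun _ => hb (by rw [hc]; trivial), ?_⟩
    simp only [passMeasure, hc, phaseMeasure]
    exact lex4_lt (.inr ⟨rfl, .inr ⟨le_rfl, .inr ⟨rfl, by decide⟩⟩⟩)
  | keep todo inp out hc heq hn =>
    refine ⟨fun _ => hb (by rw [hc]; trivial), ?_⟩
    simp only [passMeasure, hc]
    exact measure_handle le_rfl fun h => absurd h hn
  | promote todo inp out hc heq hn =>
    have hb := hb (by rw [hc]; trivial)
    refine ⟨fun _ r hr => ?_, ?_⟩
    · refine hb r ?_
      simp only [Config.store, Finset.mem_union, Finset.mem_insert, Finset.mem_erase] at hr ⊢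
      rcases hr with ((hr | rfl | hr) | hr) | hr <;> tauto
    · have hlt := ncard_lt_of_notMem (s := avail K c.considered (insert inp c.thisRules)
          (c.newRules.erase inp) c.deleteRules c.rules) (fun r hr => ?_)
        (finite_avail _ _ _ _ _ _) (h.inp_mem_avail hb hn)
        (fun h => h.2.2.2.1 (Finset.mem_insert_self _ _))
      · simp only [passMeasure, hc]
        exact measure_handle hlt.le fun _ => hlt
      · simp only [avail, Finset.mem_insert, Finset.mem_erase] at hr ⊢
        exact ⟨hr.1, hr.2.1, hr.2.2.1, fun h => hr.2.2.2.1 (.inr h), hr.2.2.2.2.1,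
          hr.2.2.2.2.2.imp_left And.right⟩
  | installOld todo inp out hc hne hold =>
    refine ⟨fun _ => hb (by rw [hc]; trivial), ?_⟩
    simp only [passMeasure, hc, phaseMeasure]
    exact lex4_lt (.inr ⟨rfl, .inr ⟨le_rfl, .inr ⟨rfl, by decide⟩⟩⟩)
  | install todo inp out hc hne hne' hnew =>
    have hb := hb (by rw [hc]; trivial)
    rw [hc] at hp
    obtain ⟨-, -, h₃, ho, -⟩ := hp
    refine ⟨fun _ r hr => ?_, ?_⟩
    · by_cases hro : r = out
      · subst hro
        refine (rank_fst_le_of_weight (h.inp_ordered h₃) ?_).trans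
          (hb inp (h₃.elim mem_store_considered mem_store_new))
        exact ho.lighter_or_eq.elim le_of_lt fun h => h.1 ▸ le_rfl
      · refine hb r ?_
        simp only [Config.store, Finset.mem_union, Finset.mem_insert, hro, false_or] at hr ⊢
        exact hr
    · simp only [passMeasure, hc, phaseMeasure]
      refine lex4_lt (.inr ⟨rfl, .inr ⟨Nat.add_le_add_left (Set.ncard_le_ncard (fun r hr => ?_)
        (finite_avail _ _ _ _ _ _)) _, .inr ⟨rfl, by decide⟩⟩⟩)
      exact ⟨hr.1, hr.2.1, hr.2.2.1, fun h => hr.2.2.2.1 (Finset.mem_insert_of_mem h),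
        hr.2.2.2.2⟩
  | discardNow todo inp out hc hred =>
    have hb := hb (by rw [hc]; trivial)
    obtain ⟨x, hx, hxne, hxr⟩ := hred
    -- A rule deleted at once has a reducible proper substring in its left-hand side, so rapid
    -- reduction cannot create it again in this pass. This is the reason for the two ways of
    -- discarding.
    have hn : inp ∉ avail K (c.considered.erase inp) c.thisRules (c.newRules.erase inp)
        c.deleteRules c.rules := fun h =>
      h.2.2.2.2.2.elim (Finset.notMem_erase _ _) fun h => h x hx hxne hxr
    have hsub : avail K (c.considered.erase inp) c.thisRules (c.newRules.erase inp)
        c.deleteRules c.rules ⊆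
        avail K c.considered c.thisRules c.newRules c.deleteRules c.rules := by
      intro r hr
      have hri : r ≠ inp := by rintro rfl; exact hn hr
      exact ⟨hr.1, hr.2.1, fun h => hr.2.2.1 (Finset.mem_erase.2 ⟨hri, h⟩), hr.2.2.2.1,
        hr.2.2.2.2.1, hr.2.2.2.2.2.imp_left Finset.mem_of_mem_erase⟩
    refine ⟨fun _ r hr => hb r ?_, ?_⟩
    · simp only [Config.store, Finset.mem_union, Finset.mem_erase] at hr ⊢
      tauto
    · simp only [passMeasure, hc]
      exact measure_handle (Set.ncard_le_ncard hsub (finite_avail _ _ _ _ _ _)) fun hi =>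
        ncard_lt_of_notMem hsub (finite_avail _ _ _ _ _ _) (h.inp_mem_avail hb hi) hn
  | discardLater todo inp out hc hred =>
    have hb := hb (by rw [hc]; trivial)
    rw [hc] at hp
    obtain ⟨-, -, h₃, -⟩ := hp
    have hn : inp ∉ avail K (c.considered.erase inp) c.thisRules (c.newRules.erase inp)
        (insert inp c.deleteRules) c.rules := fun h =>
      h.2.2.2.2.1 (Finset.mem_insert_self _ _)
    have hsub : avail K (c.considered.erase inp) c.thisRules (c.newRules.erase inp)
        (insert inp c.deleteRules) c.rules ⊆
        avail K c.considered c.thisRules c.newRules c.deleteRules c.rules := by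
      intro r hr
      have hri : r ≠ inp := by rintro rfl; exact hn hr
      exact ⟨hr.1, hr.2.1, fun h => hr.2.2.1 (Finset.mem_erase.2 ⟨hri, h⟩), hr.2.2.2.1,
        fun h => hr.2.2.2.2.1 (Finset.mem_insert_of_mem h),
        hr.2.2.2.2.2.imp_left Finset.mem_of_mem_erase⟩
    refine ⟨fun _ r hr => hb r ?_, ?_⟩
    · simp only [Config.store, Finset.mem_union, Finset.mem_erase, Finset.mem_insert] at hr ⊢
      rcases hr with ((hr | hr) | hr) | rfl | hr <;> tauto
    · simp only [passMeasure, hc]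
      exact measure_handle (Set.ncard_le_ncard hsub (finite_avail _ _ _ _ _ _)) fun hi =>
        ncard_lt_of_notMem hsub (finite_avail _ _ _ _ _ _) (h.inp_mem_avail hb hi) hn
  | take r hc hr =>
    refine ⟨fun h => h.elim, ?_⟩
    simp only [passMeasure, hc, phaseMeasure]
    exact lex4_lt (.inr ⟨rfl, .inl (Finset.card_erase_lt_of_mem hr)⟩)
  | overlap todo o hc ho =>
    refine ⟨fun h => h.elim, ?_⟩
    have := Finset.card_erase_add_one ho
    simp only [passMeasure, hc, phaseMeasure]
    exact lex4_lt (.inr ⟨rfl, .inr ⟨le_rfl, .inl (by omega)⟩⟩)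
  | overlapsDone hc =>
    refine ⟨fun h => h.elim, ?_⟩
    simp only [passMeasure, hc, phaseMeasure]
    exact lex4_lt (.inr ⟨rfl, .inr ⟨le_rfl, .inl (by omega)⟩⟩)
  | resolveLeft c' todo a a' b hc hr =>
    refine ⟨fun h => h.elim, ?_⟩
    have hlt := (hr.eval he h.core).2.1
    obtain ⟨r, p, q, -, -, rfl, -⟩ := hr.exists_rule he h.core
    rw [addNew_eq]
    simp only [passMeasure, hc, phaseMeasure]
    exact lex4_lt (.inr ⟨rfl, .inr ⟨le_rfl, .inr ⟨rfl, by omega⟩⟩⟩)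
  | resolveRight c' todo a b b' hc hirr hr =>
    refine ⟨fun h => h.elim, ?_⟩
    have hlt := (hr.eval he h.core).2.1
    obtain ⟨r, p, q, -, -, rfl, -⟩ := hr.exists_rule he h.core
    rw [addNew_eq]
    simp only [passMeasure, hc, phaseMeasure]
    exact lex4_lt (.inr ⟨rfl, .inr ⟨le_rfl, .inr ⟨rfl, by omega⟩⟩⟩)
  | resolveEq todo a hc hirr =>
    refine ⟨fun h => h.elim, ?_⟩
    simp only [passMeasure, hc, phaseMeasure]
    exact lex4_lt (.inr ⟨rfl, .inr ⟨le_rfl, .inl (by omega)⟩⟩)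
  | resolveGt todo a b hc h₁ h₂ hlt =>
    refine ⟨fun h => h.elim, ?_⟩
    rw [addNew_eq]
    simp only [passMeasure, hc, phaseMeasure]
    exact lex4_lt (.inr ⟨rfl, .inr ⟨le_rfl, .inl (by omega)⟩⟩)
  | resolveLt todo a b hc h₁ h₂ hlt =>
    refine ⟨fun h => h.elim, ?_⟩
    rw [addNew_eq]
    simp only [passMeasure, hc, phaseMeasure]
    exact lex4_lt (.inr ⟨rfl, .inr ⟨le_rfl, .inl (by omega)⟩⟩)

/-- Passes follow each other without end. -/
theorem IsRun.exists_beginPass {R : Finset (Rule A)} {σ : ℕ → Config A}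
    (hinv : Function.Involutive inv) (he : IsEval inv φ) (hσ : IsRun inv R σ)
    (hR : ∀ r ∈ R, φ r.1 = φ r.2) (T : ℕ) : ∃ t ≥ T, (σ t).phase = .beginPass := by
  by_contra hcon
  push Not at hcon
  have hI := hσ.invariant hinv he hR
  -- Scanning creates no left-hand side above those present. Comparing may, but no scan follows it
  -- unless a new pass begins.
  obtain ⟨K, hK⟩ : ∃ K, (σ T).Bounded K :=
    ⟨(σ T).store.sup fun r => rank r.1, fun r hr => Finset.le_sup (f := fun r => rank r.1) hr⟩
  have key : ∀ n, ((σ (T + n)).phase.IsScan → (σ (T + n)).Bounded K) := by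
    intro n
    induction n with
    | zero => exact fun _ => hK
    | succ n ih =>
      exact ((hσ.2 (T + n)).measure_lt he (hI _) ih (hcon _ (by omega)) (hcon _ (by omega))).1
  have hdesc : ∀ n, passMeasure K (σ (T + (n + 1))) < passMeasure K (σ (T + n)) := fun n =>
    ((hσ.2 (T + n)).measure_lt he (hI _) (key n) (hcon _ (by omega)) (hcon _ (by omega))).2
  exact (RelEmbedding.natGT (r := ((· < ·) : ℕ ×ₗ ℕ ×ₗ ℕ ×ₗ ℕ → _ → Prop))
    (fun n => passMeasure K (σ (T + n))) hdesc).not_wellFounded wellFounded_lt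

end Termination

end WeldKB

namespace WeldKB

variable {A : Type*} [Fintype A] [LinearOrder A]

/-! ### Rules which are kept for ever -/

section Steps

variable {G : Type*} [Group G] {inv : A → A} {φ : List A → G} {X : Set (Rule A)} {c c' : Config A}
  {r : Rule A}

theorem RStep.exists_addNew {w w' : List A} (h : RStep (c, w) (c', w')) : ∃ s, c' = c.addNew s := by
  obtain ⟨p, l, q, ρ, -, -, -, heq⟩ := h
  exact ⟨_, (Prod.mk.inj heq).1⟩

theorem notMem_newRules_addNew (hr : r ∈ c.store) (hn : r ∉ c.newRules) (s : Rule A) :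
    r ∉ (c.addNew s).newRules := fun h =>
  (mem_newRules_addNew.1 h).elim hn fun h => h.2 (h.1 ▸ hr)

/-- Rules enter `New` only through `addNew`, which ignores rules already in S. -/
theorem Step.notMem_newRules (hs : Step inv c c') (hr : r ∈ c.store) (hn : r ∉ c.newRules) :
    r ∉ c'.newRules := by
  have hadd := notMem_newRules_addNew hr hn
  have hstep : ∀ c'' w w', RStep (c, w) (c'', w') → r ∉ c''.newRules := by
    intro c'' w w' h
    obtain ⟨s, rfl⟩ := h.exists_addNew
    exact hadd s
  cases hs with
  | front c' todo inp w w' x v e hc hs => exact hstep c' _ _ hs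
  | back c' todo inp w w' x v e hc hs => exact hstep c' _ _ hs
  | whole c' todo inp u u' v e hc hne hs => exact hstep c' _ _ hs
  | rhs c' todo inp u v v' e hc hs => exact hstep c' _ _ hs
  | resolveLeft c' todo a a' b hc hs => exact hstep c' _ _ hs
  | resolveRight c' todo a b b' hc hirr hs => exact hstep c' _ _ hs
  | resolveGt todo a b hc h₁ h₂ hlt => exact hadd _
  | resolveLt todo a b hc h₁ h₂ hlt => exact hadd _
  | promote todo inp out hc heq hn' => exact fun h => hn (Finset.mem_of_mem_erase h)
  | discardNow todo inp out hc hred => exact fun h => hn (Finset.mem_of_mem_erase h)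
  | discardLater todo inp out hc hred => exact fun h => hn (Finset.mem_of_mem_erase h)
  | _ => exact hn

theorem Step.isScan_or (hs : Step inv c c') (hc : c.phase.IsScan) :
    c'.phase.IsScan ∨ c'.newRules = ∅ := by
  cases hs with
  | scanDone h hn => exact .inr hn
  | beginPass h => exact .inl trivial
  | take r h hr => rw [h] at hc; exact hc.elim
  | overlap todo o h ho => rw [h] at hc; exact hc.elim
  | overlapsDone h => rw [h] at hc; exact hc.elim
  | resolveLeft c' todo a a' b h hs => rw [h] at hc; exact hc.elim
  | resolveRight c' todo a b b' h hirr hs => rw [h] at hc; exact hc.elim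
  | resolveEq todo a h hirr => rw [h] at hc; exact hc.elim
  | resolveGt todo a b h h₁ h₂ hlt => rw [h] at hc; exact hc.elim
  | resolveLt todo a b h h₁ h₂ hlt => rw [h] at hc; exact hc.elim
  | endPass W h hT hW => rw [h] at hc; exact hc.elim
  | _ => exact .inl trivial

theorem Step.mem_deleteRules (hs : Step inv c c') (hc : c.phase ≠ .beginPass)
    (hr : r ∈ c.deleteRules) : r ∈ c'.deleteRules := by
  have hadd : ∀ s, r ∈ (c.addNew s).deleteRules := fun s => by rw [addNew_eq]; exact hr
  have hstep : ∀ c'' w w', RStep (c, w) (c'', w') → r ∈ c''.deleteRules := by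
    intro c'' w w' h
    obtain ⟨s, rfl⟩ := h.exists_addNew
    exact hadd s
  cases hs with
  | beginPass h => exact absurd h hc
  | front c' todo inp w w' x v e hc hs => exact hstep c' _ _ hs
  | back c' todo inp w w' x v e hc hs => exact hstep c' _ _ hs
  | whole c' todo inp u u' v e hc hne hs => exact hstep c' _ _ hs
  | rhs c' todo inp u v v' e hc hs => exact hstep c' _ _ hs
  | resolveLeft c' todo a a' b hc hs => exact hstep c' _ _ hs
  | resolveRight c' todo a b b' hc hirr hs => exact hstep c' _ _ hs
  | resolveGt todo a b hc h₁ h₂ hlt => exact hadd _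
  | resolveLt todo a b hc h₁ h₂ hlt => exact hadd _
  | discardLater todo inp out hc hred => exact Finset.mem_insert_of_mem hr
  | _ => exact hr

/-- A pass empties `Delete`. -/
theorem Step.notMem_store_of_deleteRules (h : Inv inv φ X c) (hs : Step inv c c')
    (hc : c.phase = .beginPass) (hr : r ∈ c.deleteRules) : r ∉ c'.store := by
  have h₁ : r ∉ c.considered := fun h' => (h.core.disj_considered r h').2.2 hr
  have h₂ : r ∉ c.thisRules := fun h' => (h.core.disj_this r h').2 hr
  have h₃ : r ∉ c.newRules := fun h' => h.core.disj_new r h' hr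
  cases hs with
  | beginPass => simp [Config.store, h₁, h₂, h₃]
  | _ => simp_all

/-- `Rules` changes only at the end of a pass. -/
theorem Step.rules_eq_or (hs : Step inv c c') :
    (c'.rules = c.rules ∧ c'.phase ≠ .beginPass) ∨
      (c.phase = .compare ∧ c'.phase = .beginPass ∧ c'.thisRules = ∅ ∧
        ∃ W, Relabelled c c.wdiff W ∧ c'.rules = W.needed) := by
  have hstep : ∀ c'' w w', RStep (c, w) (c'', w') → c''.rules = c.rules := by
    intro c'' w w' h
    obtain ⟨s, rfl⟩ := h.exists_addNew
    exact rules_addNew c s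
  cases hs with
  | front c' todo inp w w' x v e hc hs => exact .inl ⟨hstep c' _ _ hs, nofun⟩
  | back c' todo inp w w' x v e hc hs => exact .inl ⟨hstep c' _ _ hs, nofun⟩
  | whole c' todo inp u u' v e hc hne hs => exact .inl ⟨hstep c' _ _ hs, nofun⟩
  | rhs c' todo inp u v v' e hc hs => exact .inl ⟨hstep c' _ _ hs, nofun⟩
  | resolveLeft c' todo a a' b hc hs => exact .inl ⟨hstep c' _ _ hs, nofun⟩
  | resolveRight c' todo a b b' hc hirr hs => exact .inl ⟨hstep c' _ _ hs, nofun⟩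
  | resolveGt todo a b hc h₁ h₂ hlt => exact .inl ⟨rules_addNew _ _, nofun⟩
  | resolveLt todo a b hc h₁ h₂ hlt => exact .inl ⟨rules_addNew _ _, nofun⟩
  | endPass W hc hT hW => exact .inr ⟨hc, rfl, hT, W, hW, rfl⟩
  | _ => exact .inl ⟨rfl, nofun⟩

/-- The rule `r` has been found minimal, and has been sewn into the automaton `W`. -/
structure Minimal (M W : Finset (Arrow A)) (r : Rule A) : Prop where
  front : ¬ Reducible (setOfRules M) r.1.dropLast
  back : ¬ Reducible (setOfRules M) r.1.tail
  rhs : ¬ Reducible (setOfRules M) r.2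
  sL2Accepts : SL2Accepts r
  traces : Traces W (pad r.1 r.2)

/-- The rule `r` is to be minimized, or has been found minimal. -/
def PhaseSettled (r : Rule A) (C : Finset (Rule A)) (M W : Finset (Arrow A)) : Phase A → Prop
  | .beginPass => r ∈ C
  | .scan todo => r ∈ todo ∨ Minimal M W r
  | .minimize todo inp _ _ _ => r ∈ todo ∨ inp = r ∨ Minimal M W r
  | .handle todo inp _ _ => r ∈ todo ∨ inp = r ∨ Minimal M W r
  | _ => Minimal M W r

/-- The rule `r` is kept, and is minimized in every pass. -/
def Settled (r : Rule A) (c : Config A) : Prop :=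
  PhaseSettled r c.considered c.rules c.wdiff.needed c.phase

theorem settled_addNew {s : Rule A} {ph : Phase A} :
    Settled r { c.addNew s with phase := ph } ↔ Settled r { c with phase := ph } := by
  rw [addNew_eq]
  rfl

set_option maxHeartbeats 1000000 in
-- As `r` stays in S and out of `Delete`, its minimization cannot end in a discard, and as it is not
-- in `New` it ends in `keep`: it was found minimal and sewn. Later sewing keeps its trace, and
-- `Rules` is fixed until the pass ends, when `r` must again be in `Considered`.
theorem Step.settled (he : IsEval inv φ) (h : Inv inv φ X c) (hs : Step inv c c')
    (hn : r ∉ c.newRules) (hr' : r ∈ c'.store) (hd' : r ∉ c'.deleteRules) (hset : Settled r c) :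
    Settled r c' := by
  have hp := h.phase
  have hn' := hn
  unfold Settled at hset
  have hstep : ∀ c'' w w' ph, RStep (c, w) (c'', w') → Settled r { c with phase := ph } →
      Settled r { c'' with phase := ph } := by
    intro c'' w w' ph h
    obtain ⟨s, rfl⟩ := h.exists_addNew
    exact settled_addNew.2
  cases hs with
  | beginPass hc => rw [hc] at hset; exact .inl hset
  | pickConsidered todo r' hc hr =>
    rw [hc] at hset
    rcases hset with hset | hset
    · by_cases e : r' = r
      · exact .inr (.inl e)
      · exact .inl (Finset.mem_erase.2 ⟨Ne.symm e, hset⟩)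
    · exact .inr (.inr hset)
  | pickNew r' hc hr =>
    rw [hc] at hset
    exact .inr (.inr (hset.resolve_left (Finset.notMem_empty _)))
  | scanDone hc hn =>
    rw [hc] at hset
    exact hset.resolve_left (Finset.notMem_empty _)
  | front c' todo inp w w' x v e hc hs => rw [hc] at hset; exact hstep c' _ _ _ hs hset
  | back c' todo inp w w' x v e hc hs => rw [hc] at hset; exact hstep c' _ _ _ hs hset
  | whole c' todo inp u u' v e hc hne hs => rw [hc] at hset; exact hstep c' _ _ _ hs hset
  | rhs c' todo inp u v v' e hc hs => rw [hc] at hset; exact hstep c' _ _ _ hs hset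
  | resolveLeft c' todo a a' b hc hs => rw [hc] at hset; exact hstep c' _ _ _ hs hset
  | resolveRight c' todo a b b' hc hirr hs => rw [hc] at hset; exact hstep c' _ _ _ hs hset
  | resolveGt todo a b hc h₁ h₂ hlt => rw [hc] at hset; exact settled_addNew.2 hset
  | resolveLt todo a b hc h₁ h₂ hlt => rw [hc] at hset; exact settled_addNew.2 hset
  | sew todo inp out W hc hne hW =>
    rw [hc] at hset hp
    obtain ⟨-, -, -, ho, -, -⟩ := hp
    refine hset.imp_right fun h' => h'.imp_right fun h' => { h' with traces := ?_ }
    exact (hW.good he h.core ho.sound).2.2 _ h'.traces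
  | keep todo inp out hc heq hn =>
    rw [hc] at hset hp
    obtain ⟨-, -, hin, ho, ht, -⟩ := hp
    rcases hset with hset | rfl | hset
    · exact .inl hset
    · subst heq
      have hne : out ≠ ([], []) := by
        rintro rfl
        exact lt_irrefl _ (h.inp_ordered hin)
      obtain ⟨-, h₁, h₂⟩ := ho.lighter_or_eq.resolve_left (lt_irrefl _)
      exact .inr ⟨h₁, h₂, ho.rhs_irreducible, ho.sL2Accepts hne,
        (ht.resolve_left nofun).resolve_left hne⟩
    · exact .inr hset
  | promote todo inp out hc heq hn =>
    rw [hc] at hset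
    exact hset.imp_right fun h => h.resolve_left fun e => hn' (e ▸ hn)
  | discardNow todo inp out hc hred =>
    rw [hc] at hset hp
    refine hset.imp_right fun h' => h'.resolve_left ?_
    rintro rfl
    have hC : inp ∈ c.considered := hp.2.2.1.resolve_right hn'
    have h₁ := h.core.disj_considered inp hC
    simp only [Config.store, Finset.mem_union, Finset.mem_erase] at hr'
    tauto
  | discardLater todo inp out hc hred =>
    rw [hc] at hset
    refine hset.imp_right fun h' => h'.resolve_left ?_
    rintro rfl
    exact hd' (Finset.mem_insert_self _ _)
  | endPass W hc hT hW =>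
    have hn' : r ∉ c.newRules := hn
    simp only [Config.store, Finset.mem_union] at hr'
    rw [hT] at hr'
    have := Finset.notMem_empty r
    exact (show r ∈ c.considered by tauto)
  | frontSame todo inp w x v e hc => rw [hc] at hset; exact hset
  | frontChanged todo inp w x v e hc => rw [hc] at hset; exact hset
  | backDone todo inp w x v e hc => rw [hc] at hset; exact hset
  | wholeDone todo inp u v e hc => rw [hc] at hset; exact hset
  | tidy todo inp line r line' r' e hc => rw [hc] at hset; exact hset
  | rhsDone todo inp u v e hc => rw [hc] at hset; exact hset
  | again todo inp r e hc => rw [hc] at hset; exact hset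
  | output todo inp r e hc => rw [hc] at hset; exact hset
  | sewNothing todo inp out hc => rw [hc] at hset; exact hset
  | installOld todo inp out hc => rw [hc] at hset; exact hset
  | install todo inp out hc => rw [hc] at hset; exact hset
  | take r hc => rw [hc] at hset; exact hset
  | overlap todo o hc => rw [hc] at hset; exact hset
  | overlapsDone hc => rw [hc] at hset; exact hset
  | resolveEq todo a hc => rw [hc] at hset; exact hset

/-- The trace of `r` uses needed arrows only, so it survives the relabelling and the deletion of
unneeded arrows. -/
theorem Minimal.reducible (he : IsEval inv φ) (h : Inv inv φ X c)
    (hm : Minimal c.rules c.wdiff.needed r) {W : WDiff A} (hW : Relabelled c c.wdiff W) :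
    Reducible (setOfRules W.needed) r.1 := by
  obtain ⟨hg, ht⟩ := hW.good he h.core h.core.good
  exact (ht _ hm.traces).reducible (fun a ha => hg.noDiag a (hg.needed_subset ha)) hm.sL2Accepts

end Steps

end WeldKB

namespace WeldKB

variable {A : Type*} [Fintype A] [LinearOrder A]

/-! ### Persistent rules: where they settle, their completeness and permanence -/

section Persistent

variable {G : Type*} [Group G] {inv : A → A} {φ : List A → G} {R : Finset (Rule A)}
  {σ : ℕ → Config A} {r : Rule A}

/-- What is known about every run. -/
structure Proceeds (inv : A → A) (φ : List A → G) (σ : ℕ → Config A) : Prop where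
  isEval : IsEval inv φ
  invariant : ∀ t, Inv inv φ (everStored σ) (σ t)
  step : ∀ t, Step inv (σ t) (σ (t + 1))
  exists_beginPass : ∀ T, ∃ t ≥ T, (σ t).phase = .beginPass

theorem IsRun.proceeds (hinv : Function.Involutive inv) (he : IsEval inv φ) (hσ : IsRun inv R σ)
    (hR : ∀ r ∈ R, φ r.1 = φ r.2) : Proceeds inv φ σ :=
  ⟨he, hσ.invariant hinv he hR, hσ.2, hσ.exists_beginPass hinv he hR⟩

/-- The rules which are in the store from some time on. -/
def persistent (σ : ℕ → Config A) : Set (Rule A) := {r | ∃ T, ∀ t ≥ T, r ∈ (σ t).store}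

theorem persistent_subset (σ : ℕ → Config A) : persistent σ ⊆ everStored σ :=
  fun _ ⟨T, hT⟩ => ⟨T, hT T le_rfl⟩

/-- A stored rule which is not persistent is removed at some moment, and each removal comes with a
derivation. -/
theorem Proceeds.derivable (h : Proceeds inv φ σ) (hr : r ∈ everStored σ) :
    r ∈ persistent σ ∨ Derivable (everStored σ) r := by
  by_contra hcon
  rw [not_or] at hcon
  obtain ⟨s, hs⟩ := hr
  refine hcon.1 ⟨s, fun t ht => ?_⟩
  induction t, ht using Nat.le_induction with
  | base => exact hs
  | succ t _ ih =>
    by_contra hr'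
    exact hcon.2 ((h.step t).derivable_of_notMem (h.invariant t) ih hr')

/-- Otherwise the beginning of the next pass would remove the rule from S. -/
theorem Proceeds.notMem_deleteRules (h : Proceeds inv φ σ) {T : ℕ}
    (hr : ∀ t ≥ T, r ∈ (σ t).store) {t : ℕ} (ht : T ≤ t) : r ∉ (σ t).deleteRules := by
  intro hd
  have hex : ∃ n, (σ (t + n)).phase = .beginPass := by
    obtain ⟨s, hs, hp⟩ := h.exists_beginPass t
    exact ⟨s - t, by rwa [Nat.add_sub_cancel' hs]⟩
  classical
  have key : ∀ n ≤ Nat.find hex, r ∈ (σ (t + n)).deleteRules := by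
    intro n
    induction n with
    | zero => exact fun _ => hd
    | succ n ih => exact fun hn => (h.step _).mem_deleteRules (Nat.find_min hex hn) (ih (by omega))
  exact (h.step _).notMem_store_of_deleteRules (h.invariant _) (Nat.find_spec hex) (key _ le_rfl)
    (hr _ (by omega))

/-- A scan ends only when `New` is empty, and a rule that has stayed in S does not re-enter `New`.
So one full pass suffices. -/
theorem Proceeds.eventually_notMem_newRules (h : Proceeds inv φ σ) (hr : r ∈ persistent σ) :
    ∃ T, ∀ t ≥ T, r ∉ (σ t).newRules := by
  obtain ⟨T, hT⟩ := hr
  obtain ⟨t₁, ht₁, hp₁⟩ := h.exists_beginPass T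
  have hscan : ∀ t ≥ t₁ + 1, (σ t).phase.IsScan ∨ r ∉ (σ t).newRules := by
    intro t ht
    induction t, ht using Nat.le_induction with
    | base =>
      have := h.step t₁
      generalize σ (t₁ + 1) = c' at this
      cases this with
      | beginPass => exact .inl trivial
      | _ => simp_all
    | succ t ht ih =>
      rcases ih with ih | ih
      · refine ((h.step t).isScan_or ih).imp_right fun h => ?_
        rw [h]
        exact Finset.notMem_empty r
      · exact .inr ((h.step t).notMem_newRules (hT t (by omega)) ih)
  obtain ⟨t₂, ht₂, hp₂⟩ := h.exists_beginPass (t₁ + 1)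
  refine ⟨t₂, fun t ht => ?_⟩
  induction t, ht using Nat.le_induction with
  | base =>
    refine (hscan t₂ ht₂).resolve_left fun h => ?_
    rw [hp₂] at h
    exact h
  | succ t ht ih => exact (h.step t).notMem_newRules (hT t (by omega)) ih

theorem Proceeds.thisRules_eq_empty (h : Proceeds inv φ σ) {t : ℕ}
    (hp : (σ (t + 1)).phase = .beginPass) : (σ (t + 1)).thisRules = ∅ :=
  (h.step t).rules_eq_or.elim (fun h => absurd hp h.2) fun h => h.2.2.1

/-- At the beginning of a late pass `This` is empty and the rule is neither in `New` nor in
`Delete`, so it is in `Considered`. -/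
theorem Proceeds.eventually_settled (h : Proceeds inv φ σ) (hr : r ∈ persistent σ) :
    ∃ T, ∀ t ≥ T, Settled r (σ t) := by
  obtain ⟨T₂, hT₂⟩ := h.eventually_notMem_newRules hr
  obtain ⟨T₁, hT₁⟩ := hr
  have hdel := fun t (ht : T₁ ≤ t) => h.notMem_deleteRules hT₁ ht
  obtain ⟨t₀, ht₀, hp⟩ := h.exists_beginPass (T₁ + T₂ + 1)
  refine ⟨t₀, fun t ht => ?_⟩
  induction t, ht using Nat.le_induction with
  | base =>
    obtain ⟨s, rfl⟩ : ∃ s, t₀ = s + 1 := ⟨t₀ - 1, by omega⟩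
    have h₁ := hT₁ (s + 1) (by omega)
    have h₂ := hT₂ (s + 1) (by omega)
    have h₃ := hdel (s + 1) (by omega)
    have h₄ := Finset.notMem_empty r
    rw [← h.thisRules_eq_empty hp] at h₄
    simp only [Config.store, Finset.mem_union] at h₁
    rw [Settled, hp]
    exact (show r ∈ (σ (s + 1)).considered by tauto)
  | succ t ht ih =>
    exact (h.step t).settled h.isEval (h.invariant t) (hT₂ t (by omega)) (hT₁ _ (by omega))
      (hdel _ (by omega)) ih

theorem Settled.minimal {c : Config A} (h : Settled r c) (hc : c.phase = .compare) :
    Minimal c.rules c.wdiff.needed r := by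
  rw [Settled, hc] at h
  exact h

theorem Proceeds.exists_minimal (h : Proceeds inv φ σ) (hr : r ∈ persistent σ) (T : ℕ) :
    ∃ t ≥ T, Minimal (σ t).rules (σ t).wdiff.needed r ∧ RReducible (σ (t + 1)) r.1 := by
  obtain ⟨T₁, hT₁⟩ := h.eventually_settled hr
  obtain ⟨t, ht, hp⟩ := h.exists_beginPass (T + T₁ + 1)
  obtain ⟨s, rfl⟩ : ∃ s, t = s + 1 := ⟨t - 1, by omega⟩
  obtain ⟨hc, -, -, W, hW, hrules⟩ := (h.step s).rules_eq_or.resolve_left fun h => h.2 hp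
  have hm := (hT₁ s (by omega)).minimal hc
  refine ⟨s, by omega, hm, ?_⟩
  rw [RReducible, hrules]
  exact hm.reducible h.isEval (h.invariant s) hW

/-- `Rules` changes only at the end of a pass, and there the freshly sewn rule makes its left-hand
side reducible by the new automaton. -/
theorem Proceeds.eventually_rReducible_fst (h : Proceeds inv φ σ) (hr : r ∈ persistent σ) :
    ∃ T, ∀ t ≥ T, RReducible (σ t) r.1 := by
  obtain ⟨T, hT⟩ := h.eventually_settled hr
  obtain ⟨s, hs, -, hred⟩ := h.exists_minimal hr T
  refine ⟨s + 1, fun t ht => ?_⟩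
  induction t, ht using Nat.le_induction with
  | base => exact hred
  | succ t ht ih =>
    rcases (h.step t).rules_eq_or with ⟨hrules, -⟩ | ⟨hc, -, -, W, hW, hrules⟩
    · rw [RReducible, hrules]
      exact ih
    · rw [RReducible, hrules]
      exact ((hT t (by omega)).minimal hc).reducible h.isEval (h.invariant t) hW

theorem Proceeds.eventually_rReducible_of_infix (h : Proceeds inv φ σ) (hr : r ∈ persistent σ)
    {w : List A} (hw : r.1 <:+: w) : ∃ T, ∀ t ≥ T, RReducible (σ t) w := by
  obtain ⟨T, hT⟩ := h.eventually_rReducible_fst hr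
  exact ⟨T, fun t ht => (hT t ht).infix hw⟩

/-- The rules which are kept for ever suffice for rewriting. -/
theorem Proceeds.complete (h : Proceeds inv φ σ) : Complete (everStored σ) (persistent σ) where
  subset := persistent_subset σ
  ordered := fun r ⟨t, hr⟩ => (h.invariant t).core.ordered r hr
  derivable := fun _ => h.derivable
  resolved := by
    intro r₁ h₁ r₂ h₂ k hk
    obtain ⟨T₁, hT₁⟩ := h.eventually_settled h₁
    obtain ⟨T₂, hT₂⟩ := h.eventually_settled h₂
    -- When a pass begins both rules are in `Considered` and no overlap is pending, so this one has
    -- been resolved.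
    obtain ⟨t, ht, hp⟩ := h.exists_beginPass (T₁ + T₂)
    have hc₁ := hT₁ t (by omega)
    have hc₂ := hT₂ t (by omega)
    rw [Settled, hp] at hc₁ hc₂
    refine (h.invariant t).resolved ?_ (o := ((r₁, r₂), k)) hc₁ hc₂ hk
    rw [hp]
    exact fun _ h => h
  minimal := by
    intro r₁ h₁ r₂ h₂ hin
    obtain ⟨T, hT⟩ := h.eventually_rReducible_of_infix h₂ hin
    obtain ⟨t, ht, hm, -⟩ := h.exists_minimal h₁ T
    exact hm.front (hT t ht)

theorem Proceeds.eventually_rReducible (h : Proceeds inv φ σ) {w : List A}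
    (hw : Reducible (everStored σ) w) : ∃ T, ∀ t ≥ T, RReducible (σ t) w := by
  obtain ⟨r, hr, hrw⟩ := h.complete.exists_infix hw
  exact h.eventually_rReducible_of_infix hr hrw

theorem permanentlyIrreducible_of_not_reducible {w : List A}
    (h : ¬ Reducible (everStored σ) w) : PermanentlyIrreducible σ w := by
  refine fun T => ⟨T, le_rfl, fun hr => h ?_⟩
  obtain ⟨r, hr, hrw⟩ := reducible_iff.1 hr
  exact reducible_iff.2 ⟨r, ⟨T, hr⟩, hrw⟩

/-- A string reducible by some rule ever stored is eventually always R-reducible. The right-hand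
side and the maximal proper substrings of `r.1` are found R-irreducible at arbitrarily late times,
so no rule ever stored reduces them. -/
theorem Proceeds.permanent (h : Proceeds inv φ σ) (hr : r ∈ persistent σ) : Permanent σ r := by
  refine ⟨permanentlyIrreducible_of_not_reducible fun hred => ?_, fun x hx hne =>
    permanentlyIrreducible_of_not_reducible fun hred => ?_⟩
  · obtain ⟨T, hT⟩ := h.eventually_rReducible hred
    obtain ⟨t, ht, hm, -⟩ := h.exists_minimal hr T
    exact hm.rhs (hT t ht)
  · obtain ⟨T, hT⟩ := h.eventually_rReducible hred
    obtain ⟨t, ht, hm, -⟩ := h.exists_minimal hr T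
    rcases infix_dropLast_or_tail hx hne with hx | hx
    · exact hm.front ((hT t ht).infix hx)
    · exact hm.back ((hT t ht).infix hx)

/-- Every string has a chain of permanent reductions to an irreducible string. -/
theorem Proceeds.exists_permanentReduction (h : Proceeds inv φ σ) (u : List A) :
    ∃ w, Thue (everStored σ) u w ∧ ¬ Reducible (everStored σ) w ∧
      ∃ T, ∀ t ≥ T, Relation.ReflTransGen (PermanentReduction σ t) u w := by
  induction hn : rank u using Nat.strong_induction_on generalizing u with
  | _ n ih =>
  subst hn
  by_cases hu : Reducible (everStored σ) u
  · obtain ⟨r, hr, s, q, rfl⟩ := h.complete.exists_infix hu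
    have hrw : RewritesBy r (s ++ r.1 ++ q) (s ++ r.2 ++ q) := ⟨s, q, rfl, rfl⟩
    have hrX : Rewrites (everStored σ) _ _ := ⟨r, persistent_subset σ hr, hrw⟩
    obtain ⟨w, hw, hirr, T₁, hT₁⟩ := ih _ (h.complete.rank_lt_of_rewrites hrX) _ rfl
    have hperm := h.permanent hr
    obtain ⟨T₂, hT₂⟩ := hr
    exact ⟨w, .trans _ _ _ (.rel _ _ hrX) hw, hirr, T₁ + T₂, fun t ht =>
      .head ⟨r, hT₂ t (by omega), hperm, hrw⟩ (hT₁ t (by omega))⟩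
  · exact ⟨u, .refl u, hu, 0, fun _ _ => .refl⟩

/-- Finitely many strings have rank at most `n`, so a common time serves them all. -/
theorem Proceeds.eventually_forall_rReducible (h : Proceeds inv φ σ) (n : ℕ) :
    ∃ T, ∀ t ≥ T, ∀ w, rank w ≤ n → Reducible (everStored σ) w → RReducible (σ t) w := by
  have hev : ∀ w, ∀ᶠ t in Filter.atTop, Reducible (everStored σ) w → RReducible (σ t) w := by
    intro w
    by_cases hw : Reducible (everStored σ) w
    · obtain ⟨T, hT⟩ := h.eventually_rReducible hw
      filter_upwards [Filter.eventually_ge_atTop T] with t ht _ using hT t ht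
    · exact .of_forall fun _ h => absurd h hw
  exact Filter.eventually_atTop.1
    ((Filter.eventually_all_finite (finite_rank_le n)).2 fun w _ => hev w)

end Persistent

end WeldKB

theorem mainTheorem2 {A : Type*} [Fintype A] [LinearOrder A] (inv : A → A)
    (hinv : Function.Involutive inv) (R : Finset (WeldKB.Rule A))
    (hR : ∀ x : A, ([x, inv x], []) ∈ R)
    (σ : ℕ → WeldKB.Config A) (hσ : WeldKB.IsRun inv R σ)
    (u v : List A)
    (hv : WeldKB.IsSLexLeast (WeldKB.Thue (↑R : Set (WeldKB.Rule A)) u) v) :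
    (∃ T, ∀ t ≥ T, Relation.ReflTransGen (WeldKB.PermanentReduction σ t) u v) ∧
      ∃ T, ∀ t ≥ T, ∀ w, WeldKB.RReducesTo (σ t) u w ↔ w = v := by
  open WeldKB in
  obtain ⟨G, _, φ, he, hφ⟩ := exists_isEval hinv (R : Set (Rule A)) hR
  have h : Proceeds inv φ σ := hσ.proceeds hinv he fun r hr => (hφ _ _).1 (Thue.of_mem hr)
  have huv : Thue (everStored σ) u v := (hσ.thue_iff hinv hR).1 hv.1
  -- A reduct of `v` would be a congruent string preceding it.
  have hv' : ¬ Reducible (everStored σ) v := by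
    rintro ⟨w, hw⟩
    have hlt := h.complete.rank_lt_of_rewrites hw
    rcases hv.2 w ((hσ.thue_iff hinv hR).2 (.trans _ _ _ huv (.rel _ _ hw))) with rfl | hvw
    · exact lt_irrefl _ hlt
    · exact hlt.not_gt (rank_lt_of_sLex hvw)
  have heq : ∀ w, Thue (everStored σ) u w → ¬ Reducible (everStored σ) w → w = v := fun w huw hw =>
    h.complete.eq_of_thue hw hv' (.trans _ _ _ (.symm _ _ huw) huv)
  constructor
  · obtain ⟨w, huw, hw, hT⟩ := h.exists_permanentReduction u
    exact heq w huw hw ▸ hT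
  · obtain ⟨T, hT⟩ := h.eventually_forall_rReducible (rank u)
    refine ⟨T, fun t ht => ?_⟩
    have hcore := (h.invariant t).core
    have hred : ∀ w, RReducesTo (σ t) u w → w = v := by
      intro w hw
      obtain ⟨hφw, hle, hirr⟩ := hw.eval he hcore
      -- The result does not exceed `u`, so at this time its R-irreducibility implies irreducibility
      -- by all rules ever stored.
      exact heq w ((hσ.thue_iff hinv hR).1 ((hφ _ _).2 hφw)) fun hc => hirr (hT t ht w hle hc)
    refine fun w => ⟨hred w, ?_⟩
    rintro rfl
    obtain ⟨w, hw⟩ := exists_rReducesTo he hcore u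
    exact hred w hw ▸ hw
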